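/- Throughout, $\lambda$ is the security parameter; a function $f$ is negligible if for every $c\in\mathbb N$ one has $f(\lambda)<\lambda^{-c}$ for all large $\lambda$. A polynomial-size quantum machine is a circuit with polynomially many wires and gates over a fixed finite universal gate set, including measurements and resets; a non-uniform QPT adversary $\mathcal A=\{\mathcal A_\lambda,|\psi_\lambda\rangle\}$ is a family of interactive polynomial-size quantum machines with polynomial-size advice states, which exchanges classical messages and may receive quantum states. Algorithms of schemes are called efficient if they are given by polynomial-size circuits (in $\lambda$ and the length of the predicate description). **ABE.** An attribute-based encryption scheme $(\mathsf{Gen},\mathsf{KeyGen},\mathsf{Enc},\mathsf{Dec})$, for attributes $X\in\{0,1\}^{p(\lambda)}$ and predicates $P:\{0,1\}^{p(\lambda)}\to\{0,1\}$ given by bit-string descriptions, consists of efficient randomized classical algorithms $\mathsf{Gen}(1^\lambda)\to(\mathsf{pk},\mathsf{msk})$, $\mathsf{KeyGen}(\mathsf{msk},P)\to\mathsf{sk}_P$, $\mathsf{Enc}(\mathsf{pk},X,m)\to\mathsf{ct}$, $\mathsf{Dec}(\mathsf{sk}_P,\mathsf{ct})\to m'$ or $\bot$, such that, for a negligible function $\nu$,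 whenever $P(X)=1$ an honest encryption of $m$ under $X$ is decrypted to $m$ with $\mathsf{sk}_P$ with probability at least $1-\nu(\lambda)$. It is post-quantum if for every non-uniform QPT adversary the difference of the probabilities of output $1$ in the following game with $b=0$ and with $b=1$ is negligible in absolute value: the adversary gets $\mathsf{pk}$ and makes key queries $P_i$, answered by $\mathsf{KeyGen}(\mathsf{msk},P_i)$; it outputs $X^*$ and messages $m_0,m_1$ of equal length; if some $P_i(X^*)=1$ the game ends with output $\bot$; otherwise it receives $\mathsf{Enc}(\mathsf{pk},X^*,m_b)$, makes further key queries (answered by $\bot$ if $P_i(X^*)=1$), and outputs a bit. **Construction.** Let $\mathsf{ABE}$ be a post-quantum attribute-based encryption scheme for messages of $\lambda+1$ bits. For $x,\theta\in\{0,1\}^\lambda$ let $|x\rangle_\theta$ be the BB84 state in which bit $x_i$ is encoded in the computational basis if $\theta_i=0$ and in the Hadamard basis if $\theta_i=1$. Define $\mathsf{CD\text{-}ABE}=(\mathsf{Gen},\mathsf{KeyGen},\mathsf{Enc}',\mathsf{Dec}',\mathsf{Del},\mathsf{Ver})$ for one-bit messages, with $\mathsf{Gen},\mathsf{KeyGen}$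 unchanged, by: - $\mathsf{Enc}'(\mathsf{pk},X,b)$: sample uniform $x,\theta\in\{0,1\}^\lambda$; output $\mathsf{ct}=\big(|x\rangle_\theta,\ \mathsf{Enc}(\mathsf{pk},X,(\theta,\,b\oplus\bigoplus_{i:\theta_i=0}x_i))\big)$ and $\mathsf{vk}=(x,\theta)$. - $\mathsf{Dec}'(\mathsf{sk}_P,(|x\rangle_\theta,\mathsf{ct}'))$: compute $(\theta,b')\leftarrow\mathsf{Dec}(\mathsf{sk}_P,\mathsf{ct}')$ (output $\bot$ if this is $\bot$), measure the first register in basis $\theta$ to obtain $x$, output $b'\oplus\bigoplus_{i:\theta_i=0}x_i$. - $\mathsf{Del}(\mathsf{ct})$: measure the first register in the Hadamard basis and output the result $x'$ as $\mathsf{cert}$. - $\mathsf{Ver}((x,\theta),x')$: output $\top$ if and only if $x_i=x'_i$ for all $i$ with $\theta_i=1$. **Claim.** $\mathsf{CD\text{-}ABE}$ is an attribute-based encryption scheme with certified deletion, that is: 1. all its algorithms are efficient (those other than $\mathsf{Enc}',\mathsf{Dec}',\mathsf{Del}$ being classical); 2. (correctness of decryption) for a negligible $\nu$ and all $P,X$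 with $P(X)=1$ and all $b$, an honest encryption of $b$ under $X$ is decrypted to $b$ with $\mathsf{sk}_P$ with probability at least $1-\nu(\lambda)$; 3. (correctness of deletion) for a negligible $\nu$ and all $X,b$, the certificate $\mathsf{Del}(\mathsf{ct})$ of an honest ciphertext is accepted by $\mathsf{Ver}$ with probability at least $1-\nu(\lambda)$; 4. (certified deletion security) for every non-uniform QPT adversary $\mathcal A$, both $\mathsf{TD}\big(\mathsf{EV\text{-}EXP}^{\mathcal A}_\lambda(0),\mathsf{EV\text{-}EXP}^{\mathcal A}_\lambda(1)\big)$ (trace distance) and $\big|\Pr[\mathsf{C\text{-}EXP}^{\mathcal A}_\lambda(0)=1]-\Pr[\mathsf{C\text{-}EXP}^{\mathcal A}_\lambda(1)=1]\big|$ are negligible. Here both experiments with bit $b$ begin as follows. Sample $(\mathsf{pk},\mathsf{msk})\leftarrow\mathsf{Gen}(1^\lambda)$ and give $\mathsf{pk}$ to $\mathcal A_\lambda(|\psi_\lambda\rangle)$, which makes key queries $P_i$, answered by $\mathsf{KeyGen}(\mathsf{msk},P_i)$, and outputs an attribute $X^*$. If some $P_i(X^*)=1$, the experiment ends with output $\bot$.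 Otherwise sample $(\mathsf{ct},\mathsf{vk})\leftarrow\mathsf{Enc}'(\mathsf{pk},X^*,b)$ and give $\mathsf{ct}$ to $\mathcal A_\lambda$, which makes further key queries (answered by $\bot$ if $P_i(X^*)=1$) and then outputs a certificate $\mathsf{cert}$ and a residual register $\mathsf A'$. $\mathsf{EV\text{-}EXP}$ outputs the state of $\mathsf A'$ if $\mathsf{Ver}(\mathsf{vk},\mathsf{cert})=\top$, and $\bot$ otherwise. $\mathsf{C\text{-}EXP}$ instead sends $\mathsf{Ver}(\mathsf{vk},\mathsf{cert})$ to $\mathcal A_\lambda$, which again makes key queries (answered by $\bot$ if $P_i(X^*)=1$) and outputs a bit, the output of the experiment. -/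

import Mathlib

open scoped MatrixOrder ComplexOrder

noncomputable section

namespace CertifiedDeletion

/-! ### Bit strings, negligible functions, uniform averages -/

/-- Bit strings of length `n`. -/
abbrev Bits (n : ℕ) : Type := Fin n → Bool

/-- `f` is negligible: for every `c`, eventually `f n < n ^ (-c)`. -/
def Negligible (f : ℕ → ℝ) : Prop :=
  ∀ c : ℕ, ∃ N : ℕ, ∀ n : ℕ, N < n → f n < ((n : ℝ) ^ c)⁻¹

/-- `f` is bounded by a polynomial. -/
def PolyBounded (f : ℕ → ℕ) : Prop :=
  ∃ p : Polynomial ℕ, ∀ n, f n ≤ p.eval n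

/-- The average of `f` over uniformly random `r`-bit coins. -/
def avg {V : Type} [AddCommMonoid V] [Module ℝ V] {r : ℕ} (f : Bits r → V) : V :=
  ((2 : ℝ) ^ r)⁻¹ • ∑ c, f c

/-- Encoding of "a string or the symbol `⊥`" by one more bit: `⊥` is `00…0`, and a string `s` is
`1s`. -/
def optBits {m : ℕ} : Option (Bits m) → Bits (m + 1)
  | none => fun _ => false
  | some s => Fin.cons true s

/-! ### Operators on qubit registers -/

/-- Operators on an `n`-qubit register; the computational basis is indexed by bit strings. -/
abbrev Op (n : ℕ) : Type := Matrix (Bits n) (Bits n) ℂ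

/-- The operator `|ψ⟩⟨ψ|`. -/
def ketbra {n : ℕ} (ψ : Bits n → ℂ) : Op n := Matrix.vecMulVec ψ (star ψ)

/-- The operator `|s⟩⟨s|` of a computational basis state. -/
def basisOp {n : ℕ} (s : Bits n) : Op n := Matrix.single s s 1

/-- The tensor product of an operator on the first `a` qubits and one on the last `b` qubits. -/
def tensor {a b : ℕ} (A : Op a) (B : Op b) : Op (a + b) :=
  Matrix.of fun y z =>
    A (fun i => y (Fin.castAdd b i)) (fun i => z (Fin.castAdd b i)) *
      B (fun i => y (Fin.natAdd a i)) (fun i => z (Fin.natAdd a i))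

/-- The (unnormalized) state after the wires `w` have been measured in the computational basis
with outcome `t`. -/
def project {ι : Type} [Fintype ι] {n : ℕ} (w : ι → Fin n) (t : ι → Bool) (ρ : Op n) : Op n :=
  Matrix.of fun y z => if y ∘ w = t ∧ z ∘ w = t then ρ y z else 0

/-- The (unnormalized) state after one wire has been measured with outcome `t`. -/
def projectBit {n : ℕ} (i : Fin n) (t : Bool) (ρ : Op n) : Op n :=
  project (fun _ : Unit => i) (fun _ => t) ρ

/-- Discard the content of the wires `w` and put the state `σ` there instead:
`Tr_w(ρ) ⊗ σ`, with `σ` on the wires `w`. -/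
def load {m n : ℕ} (w : Fin m ↪ Fin n) (σ : Op m) (ρ : Op n) : Op n :=
  Matrix.of fun y z =>
    σ (y ∘ w) (z ∘ w) *
      ∑ t : Bits m, ρ (Function.extend w t y) (Function.extend w t z)

/-- Write the classical string `s` on the wires `w`. -/
def write {m n : ℕ} (w : Fin m ↪ Fin n) (s : Bits m) (ρ : Op n) : Op n :=
  load w (basisOp s) ρ

/-- Write a bit on one wire. -/
def writeBit {n : ℕ} (i : Fin n) (s : Bool) (ρ : Op n) : Op n :=
  Matrix.of fun y z =>
    if y i = s ∧ z i = s then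
      ∑ t : Bool, ρ (Function.update y i t) (Function.update z i t)
    else 0

/-- The reduced state on the wires `w` (partial trace over all the other wires). -/
def reduce {m n : ℕ} (w : Fin m ↪ Fin n) (ρ : Op n) : Op m :=
  Matrix.of fun s t => ∑ y : Bits n, if y ∘ w = s then ρ y (Function.extend w t y) else 0

/-- The trace norm `Tr √(A† A)`. -/
def traceNorm {ι : Type} [Fintype ι] [DecidableEq ι] (A : Matrix ι ι ℂ) : ℝ :=
  (Matrix.trace (CFC.sqrt (A.conjTranspose * A))).re

/-- The trace distance `½ ‖ρ - τ‖₁`. -/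
def traceDist {ι : Type} [Fintype ι] [DecidableEq ι] (ρ τ : Matrix ι ι ℂ) : ℝ :=
  (1 / 2) * traceNorm (ρ - τ)

/-! ### Circuits -/

/-- A target wire with at most two control wires. -/
structure Loc (n : ℕ) where
  ctrl : Finset (Fin n)
  tgt : Fin n
  card_le : ctrl.card ≤ 2
  notMem : tgt ∉ ctrl

/-- The single-qubit gates: bit flip, Hadamard and `T = diag(1, e^{iπ/4})`. -/
inductive Gate1
  | X
  | H
  | T

/-- The Hadamard matrix. -/
def hadamard : Matrix Bool Bool ℂ :=
  Matrix.of fun a b => (if a && b then -1 else 1) / (Real.sqrt 2 : ℂ)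

def Gate1.mat : Gate1 → Matrix Bool Bool ℂ
  | .X => Matrix.of fun a b => if a = b then 0 else 1
  | .H => hadamard
  | .T => Matrix.diagonal fun a => if a then Complex.exp (Complex.I * (Real.pi / 4)) else 1

/-- Elementary gates: (at most doubly) controlled `X`, `H`, `T`, the measurement of a wire in the
computational basis, and the reset of a wire to `|0⟩`. The set contains `H`, `T` and CNOT, hence
is universal. -/
inductive Gate (n : ℕ)
  | unitary (u : Gate1) (loc : Loc n)
  | measure (i : Fin n)
  | reset (i : Fin n)

/-- The unitary matrix of `u` applied at a location. -/
def Gate1.matAt {n : ℕ} (u : Gate1) (loc : Loc n) : Op n :=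
  Matrix.of fun y z =>
    if ∀ i, i ≠ loc.tgt → y i = z i then
      if ∀ c ∈ loc.ctrl, z c = true then u.mat (y loc.tgt) (z loc.tgt)
      else if y loc.tgt = z loc.tgt then 1 else 0
    else 0

/-- The quantum operation of a gate. -/
def Gate.apply {n : ℕ} : Gate n → Op n → Op n
  | .unitary u loc, ρ => u.matAt loc * ρ * (u.matAt loc).conjTranspose
  | .measure i, ρ => projectBit i false ρ + projectBit i true ρ
  | .reset i, ρ => writeBit i false ρ

/-- The quantum operation of a circuit, the head of the list being applied first. -/
def applyCircuit {n : ℕ} (C : List (Gate n)) (ρ : Op n) : Op n :=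
  C.foldl (fun σ g => g.apply σ) ρ

/-- NOT with at most two controls, on classical strings. -/
def Loc.flip {n : ℕ} (loc : Loc n) (y : Bits n) : Bits n :=
  if ∀ c ∈ loc.ctrl, y c = true then Function.update y loc.tgt (!y loc.tgt) else y

/-- A classical circuit (NOT, CNOT and Toffoli gates, with ancillas). -/
def applyClassical {n : ℕ} (C : List (Loc n)) (y : Bits n) : Bits n :=
  C.foldl (fun y g => g.flip y) y

/-- `f` is computed by a classical circuit with at most `S` wires and at most `S` gates; the wires
that do not carry the input start as `0`. -/
def ClassicalComputable (S : ℕ) {ι κ : Type} (f : (ι → Bool) → (κ → Bool)) : Prop :=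
  ∃ (N : ℕ) (C : List (Loc N)) (inp : ι ↪ Fin N) (out : κ ↪ Fin N),
    N ≤ S ∧ C.length ≤ S ∧
      ∀ s, applyClassical C (Function.extend inp s fun _ => false) ∘ out = f s

/-- A quantum circuit with at most `S` wires and at most `S` gates prepares, on every classical
input `s`, the state that is described by `F s`: the string `v` (the measured value of the
wires `outC`) appears together with the subnormalized state `F s v` of the wires `outQ`. -/
def QuantumPrepares (S : ℕ) {ι : Type} {v q : ℕ}
    (F : (ι → Bool) → Bits v → Op q) : Prop :=
  ∃ (N : ℕ) (C : List (Gate N)) (inp : ι ↪ Fin N) (outC : Fin v ↪ Fin N) (outQ : Fin q ↪ Fin N),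
    N ≤ S ∧ C.length ≤ S ∧ (∀ i j, outC i ≠ outQ j) ∧
      ∀ s t, reduce outQ (project outC t
        (applyCircuit C (basisOp (Function.extend inp s fun _ => false)))) = F s t

/-- A quantum circuit with at most `S` wires and at most `S` gates performs, on classical input `s`
and on a quantum register of `q` qubits, the measurement with outcomes `o : O` (encoded as bit
strings) and effects `M s o`. -/
def QuantumMeasures (S : ℕ) {ι O : Type} [Fintype O] {q m : ℕ} (code : O → Bits m)
    (M : (ι → Bool) → O → Op q) : Prop :=
  ∃ (N : ℕ) (C : List (Gate N)) (inC : ι ↪ Fin N) (inQ : Fin q ↪ Fin N) (out : Fin m ↪ Fin N),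
    N ≤ S ∧ C.length ≤ S ∧ (∀ i j, inC i ≠ inQ j) ∧
      ∀ (s : ι → Bool) (σ : Op q) (t : Bits m),
        Matrix.trace (project out t (applyCircuit C
          (load inQ σ (basisOp (Function.extend inC s fun _ => false))))) =
          ∑ o, if code o = t then Matrix.trace (M s o * σ) else 0

/-! ### Key generation, common to both kinds of schemes

`k` is the security parameter. Predicates on attributes are described by bit strings of arbitrary
length `d`. Randomized classical algorithms are functions of uniformly random coins, which are
their first string argument. -/

structure KeySystem where
  attrLen : ℕ → ℕ
  /-- The value at an attribute of the predicate with a given description. -/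
  eval : ∀ k d : ℕ, Bits d → Bits (attrLen k) → Bool
  pkLen : ℕ → ℕ
  mskLen : ℕ → ℕ
  genCoins : ℕ → ℕ
  gen : ∀ k, Bits (genCoins k) → Bits (pkLen k) × Bits (mskLen k)
  skLen : ℕ → ℕ → ℕ
  keyCoins : ℕ → ℕ → ℕ
  keyGen : ∀ k d, Bits (keyCoins k d) → Bits (mskLen k) → Bits d → Bits (skLen k d)

/-- `Gen` and `KeyGen` are polynomial-time (classical circuits of polynomial size). -/
def KeySystem.Efficient (K : KeySystem) : Prop :=
  ∃ p : Polynomial ℕ,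
    (∀ k, ClassicalComputable (p.eval k) fun c : Bits (K.genCoins k) =>
      Sum.elim (K.gen k c).1 (K.gen k c).2) ∧
    (∀ k d, ClassicalComputable (p.eval (k + d))
      fun s : Fin (K.keyCoins k d) ⊕ Fin (K.mskLen k) ⊕ Fin d → Bool =>
        K.keyGen k d (fun i => s (.inl i)) (fun i => s (.inr (.inl i)))
          (fun i => s (.inr (.inr i))))

/-! ### Interactive machines

An adversary is a register of `n` qubits, initially in an advice state, together with a list of
instructions. Messages are classical: sent strings are measured on designated wires, received
ones are written on designated wires. -/

/-- An instruction: an elementary gate, or a key query. For a key query the wire `ctrl` is measured;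
if the result is `1`, the description of a predicate is read off the wires `pred`, and the answer
(a secret key or `⊥`) is written on the wires `ans`; if it is `0`, no query is made. -/
inductive Instr (skLen : ℕ → ℕ) (n : ℕ)
  | gate (g : Gate n)
  | query (ctrl : Fin n) (d : ℕ) (pred : Fin d ↪ Fin n) (ans : Fin (skLen d + 1) ↪ Fin n)

/-- Run a list of instructions against the key generation oracle that answers the queries in `allow`
with a fresh key and all others with `⊥`. The state consists of the list `h` of the answered
queries and of the (unnormalized) state `ρ` of the register; at the end, `final` is summed
over all the branches. -/
def KeySystem.run (K : KeySystem) (k : ℕ) (msk : Bits (K.mskLen k)) (allow : ∀ d, Bits d → Bool)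
    {V : Type} [AddCommMonoid V] [Module ℝ V] {n : ℕ} :
    List (Instr (K.skLen k) n) → List (Σ d, Bits d) → Op n →
      (List (Σ d, Bits d) → Op n → V) → V
  | [], h, ρ, final => final h ρ
  | .gate g :: is, h, ρ, final => K.run k msk allow is h (g.apply ρ) final
  | .query ctrl d pred ans :: is, h, ρ, final =>
      K.run k msk allow is h (projectBit ctrl false ρ) final +
      ∑ P : Bits d,
        if allow d P then
          avg fun c => K.run k msk allow is (⟨d, P⟩ :: h)
            (write ans (optBits (some (K.keyGen k d c msk P)))
              (project pred P (projectBit ctrl true ρ))) final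
        else
          K.run k msk allow is h
            (write ans (optBits none) (project pred P (projectBit ctrl true ρ))) final

/-- The probability that the measurement of wire `i` gives `1`. -/
def probOne {n : ℕ} (i : Fin n) (ρ : Op n) : ℝ := (Matrix.trace (projectBit i true ρ)).re

/-! ### Attribute-based encryption -/

/-- The algorithms of a classical attribute-based encryption scheme with messages of `msgLen k`
bits. -/
structure ABE (msgLen : ℕ → ℕ) extends KeySystem where
  ctLen : ℕ → ℕ
  encCoins : ℕ → ℕ
  enc : ∀ k, Bits (encCoins k) → Bits (pkLen k) → Bits (attrLen k) → Bits (msgLen k) →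
    Bits (ctLen k)
  decCoins : ℕ → ℕ → ℕ
  dec : ∀ k d, Bits (decCoins k d) → Bits (skLen k d) → Bits (ctLen k) → Option (Bits (msgLen k))

namespace ABE

variable {msgLen : ℕ → ℕ}

def Efficient (E : ABE msgLen) : Prop :=
  E.toKeySystem.Efficient ∧
  ∃ p : Polynomial ℕ,
    (∀ k, ClassicalComputable (p.eval k)
      fun s : Fin (E.encCoins k) ⊕ Fin (E.pkLen k) ⊕ Fin (E.attrLen k) ⊕ Fin (msgLen k) → Bool =>
        E.enc k (fun i => s (.inl i)) (fun i => s (.inr (.inl i)))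
          (fun i => s (.inr (.inr (.inl i)))) (fun i => s (.inr (.inr (.inr i))))) ∧
    (∀ k d, ClassicalComputable (p.eval (k + d))
      fun s : Fin (E.decCoins k d) ⊕ Fin (E.skLen k d) ⊕ Fin (E.ctLen k) → Bool =>
        optBits (E.dec k d (fun i => s (.inl i)) (fun i => s (.inr (.inl i)))
          (fun i => s (.inr (.inr i)))))

/-- The probability that an encryption of `m` under the attribute `X` is decrypted to `m` with a key
for the predicate `P`. -/
def decProb (E : ABE msgLen) (k d : ℕ) (P : Bits d) (X : Bits (E.attrLen k))
    (m : Bits (msgLen k)) : ℝ :=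
  avg fun c₁ => avg fun c₂ => avg fun c₃ => avg fun c₄ =>
    if E.dec k d c₄ (E.keyGen k d c₂ (E.gen k c₁).2 P) (E.enc k c₃ (E.gen k c₁).1 X m) = some m
    then (1 : ℝ) else 0

def Correct (E : ABE msgLen) : Prop :=
  ∃ ν : ℕ → ℝ, Negligible ν ∧ ∀ k d (P : Bits d) (X : Bits (E.attrLen k)) (m : Bits (msgLen k)),
    E.eval k d P X = true → 1 - ν k ≤ E.decProb k d P X m

/-- A quantum adversary with advice in the semantic security game, at security parameter `k`. -/
structure Adversary (E : ABE msgLen) (k : ℕ) where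
  n : ℕ
  advice : Bits n → ℂ
  advice_norm : ∑ s, ‖advice s‖ ^ 2 = 1
  /-- The public key is received here. -/
  pk : Fin (E.pkLen k) ↪ Fin n
  pre : List (Instr (E.skLen k) n)
  /-- The challenge attribute and the two challenge messages are read off these wires. -/
  attr : Fin (E.attrLen k) ↪ Fin n
  msg₀ : Fin (msgLen k) ↪ Fin n
  msg₁ : Fin (msgLen k) ↪ Fin n
  /-- The challenge ciphertext is received here. -/
  ct : Fin (E.ctLen k) ↪ Fin n
  post : List (Instr (E.skLen k) n)
  out : Fin n

def Adversary.size {E : ABE msgLen} {k : ℕ} (A : E.Adversary k) : ℕ :=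
  A.n + A.pre.length + A.post.length

/-- The probability that the adversary outputs `1` when the `b`-th message is encrypted. -/
def game (E : ABE msgLen) (k : ℕ) (A : E.Adversary k) (b : Bool) : ℝ :=
  avg fun c : Bits (E.genCoins k) =>
    E.run k (E.gen k c).2 (fun _ _ => true) A.pre [] (write A.pk (E.gen k c).1 (ketbra A.advice))
      fun h ρ =>
        ∑ X : Bits (E.attrLen k), ∑ m₀ : Bits (msgLen k), ∑ m₁ : Bits (msgLen k),
          if ∀ q ∈ h, E.eval k q.1 q.2 X = false then
            avg fun c' : Bits (E.encCoins k) =>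
              E.run k (E.gen k c).2 (fun d P => !E.eval k d P X) A.post []
                (write A.ct (E.enc k c' (E.gen k c).1 X (if b then m₁ else m₀))
                  (project A.msg₁ m₁ (project A.msg₀ m₀ (project A.attr X ρ))))
                fun _ ρ' => probOne A.out ρ'
          else 0

/-- Adaptive semantic security against non-uniform quantum polynomial-time adversaries. -/
def Secure (E : ABE msgLen) : Prop :=
  ∀ A : ∀ k, E.Adversary k, PolyBounded (fun k => (A k).size) →
    Negligible fun k => |E.game k (A k) false - E.game k (A k) true|

/-- `E` is a post-quantum attribute-based encryption scheme. -/
def IsPostQuantumABE (E : ABE msgLen) : Prop := E.Efficient ∧ E.Correct ∧ E.Secure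

end ABE

/-! ### Attribute-based encryption with certified deletion -/

/-- The algorithms of an attribute-based encryption scheme for one-bit messages with certified
deletion: quantum ciphertexts, classical verification keys and deletion certificates.
`enc k pk X b vk` is the subnormalized state of the ciphertext that comes with the
verification key `vk`; `dec` and `del` are measurements of the ciphertext, given by the effects
of their outcomes. -/
structure CDABE extends KeySystem where
  ctQubits : ℕ → ℕ
  vkLen : ℕ → ℕ
  certLen : ℕ → ℕ
  enc : ∀ k, Bits (pkLen k) → Bits (attrLen k) → Bool → Bits (vkLen k) → Op (ctQubits k)
  dec : ∀ k d, Bits (skLen k d) → Option Bool → Op (ctQubits k)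
  del : ∀ k, Bits (certLen k) → Op (ctQubits k)
  ver : ∀ k, Bits (vkLen k) → Bits (certLen k) → Bool

namespace CDABE

/-- All the algorithms are given by circuits of polynomial size (classical ones for `Gen`, `KeyGen`
and `Ver`). -/
def Efficient (S : CDABE) : Prop :=
  S.toKeySystem.Efficient ∧
  ∃ p : Polynomial ℕ,
    (∀ k, QuantumPrepares (p.eval k)
      fun s : Fin (S.pkLen k) ⊕ Fin (S.attrLen k) ⊕ Unit → Bool =>
        S.enc k (fun i => s (.inl i)) (fun i => s (.inr (.inl i))) (s (.inr (.inr ())))) ∧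
    (∀ k d, QuantumMeasures (p.eval (k + d))
      (fun o : Option Bool => optBits (o.map fun b => (fun _ => b : Bits 1)))
      fun s : Bits (S.skLen k d) => S.dec k d s) ∧
    (∀ k, QuantumMeasures (p.eval k) (fun t : Bits (S.certLen k) => t)
      fun _ : Bits 0 => S.del k) ∧
    (∀ k, ClassicalComputable (p.eval k)
      fun (s : Fin (S.vkLen k) ⊕ Fin (S.certLen k) → Bool) (_ : Unit) =>
        S.ver k (fun i => s (.inl i)) (fun i => s (.inr i)))

/-- The probability that an encryption of `b` under the attribute `X` is decrypted to `b` with a key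
for the predicate `P`. -/
def decProb (S : CDABE) (k d : ℕ) (P : Bits d) (X : Bits (S.attrLen k)) (b : Bool) : ℝ :=
  avg fun c₁ => avg fun c₂ => ∑ vk,
    (Matrix.trace (S.dec k d (S.keyGen k d c₂ (S.gen k c₁).2 P) (some b) *
      S.enc k (S.gen k c₁).1 X b vk)).re

/-- Correctness of decryption. -/
def Correct (S : CDABE) : Prop :=
  ∃ ν : ℕ → ℝ, Negligible ν ∧ ∀ k d (P : Bits d) (X : Bits (S.attrLen k)) (b : Bool),
    S.eval k d P X = true → 1 - ν k ≤ S.decProb k d P X b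

/-- The probability that the certificate produced by `Del` from an honest ciphertext is accepted. -/
def delProb (S : CDABE) (k : ℕ) (X : Bits (S.attrLen k)) (b : Bool) : ℝ :=
  avg fun c => ∑ vk, ∑ cert, if S.ver k vk cert = true then
    (Matrix.trace (S.del k cert * S.enc k (S.gen k c).1 X b vk)).re else 0

/-- Correctness of deletion. -/
def DeletionCorrect (S : CDABE) : Prop :=
  ∃ ν : ℕ → ℝ, Negligible ν ∧ ∀ k (X : Bits (S.attrLen k)) (b : Bool), 1 - ν k ≤ S.delProb k X b

/-- A quantum adversary with advice in the certified deletion experiments, at security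
parameter `k`. -/
structure Adversary (S : CDABE) (k : ℕ) where
  n : ℕ
  advice : Bits n → ℂ
  advice_norm : ∑ s, ‖advice s‖ ^ 2 = 1
  /-- The public key is received here. -/
  pk : Fin (S.pkLen k) ↪ Fin n
  pre : List (Instr (S.skLen k) n)
  /-- The challenge attribute is read off these wires. -/
  attr : Fin (S.attrLen k) ↪ Fin n
  /-- The quantum ciphertext is received here. -/
  ct : Fin (S.ctQubits k) ↪ Fin n
  mid : List (Instr (S.skLen k) n)
  /-- The deletion certificate is read off these wires. -/
  cert : Fin (S.certLen k) ↪ Fin n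
  /-- The verification outcome is received here. -/
  res : Fin n
  post : List (Instr (S.skLen k) n)
  out : Fin n

def Adversary.size {S : CDABE} {k : ℕ} (A : S.Adversary k) : ℕ :=
  A.n + A.pre.length + A.mid.length + A.post.length

/-- The part common to both experiments. `bot` is applied to the state of the adversary when the
experiment exits at the challenge; otherwise `final` is applied to the master secret key, the
challenge attribute, the verification outcome and the state of the adversary after it has sent
its certificate. -/
def deletionGame (S : CDABE) (k : ℕ) (A : S.Adversary k) (b : Bool)
    {V : Type} [AddCommMonoid V] [Module ℝ V] (bot : Op A.n → V)
    (final : Bits (S.mskLen k) → Bits (S.attrLen k) → Bool → Op A.n → V) : V :=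
  avg fun c : Bits (S.genCoins k) =>
    S.run k (S.gen k c).2 (fun _ _ => true) A.pre [] (write A.pk (S.gen k c).1 (ketbra A.advice))
      fun h ρ =>
        ∑ X : Bits (S.attrLen k),
          if ∀ q ∈ h, S.eval k q.1 q.2 X = false then
            ∑ vk : Bits (S.vkLen k),
              S.run k (S.gen k c).2 (fun d P => !S.eval k d P X) A.mid []
                (load A.ct (S.enc k (S.gen k c).1 X b vk) (project A.attr X ρ))
                fun _ ρ' =>
                  ∑ t : Bits (S.certLen k),
                    final (S.gen k c).2 X (S.ver k vk t) (project A.cert t ρ')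
          else bot (project A.attr X ρ)

/-- The output "the register in the state `ρ`"; the additional basis state `none` stands
for `⊥`. -/
def outState {n : ℕ} (ρ : Op n) : Matrix (Option (Bits n)) (Option (Bits n)) ℂ
  | some y, some z => ρ y z
  | _, _ => 0

/-- The output `⊥`, with the weight of the branch `ρ`. -/
def outBot {n : ℕ} (ρ : Op n) : Matrix (Option (Bits n)) (Option (Bits n)) ℂ :=
  Matrix.single none none ρ.trace

/-- The everlasting security experiment: its output is the residual state of the adversary if the
certificate is accepted, and `⊥` otherwise. The residual register consists of all the wires
of the adversary (for any smaller register the trace distance can only decrease). -/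
def evExp (S : CDABE) (k : ℕ) (A : S.Adversary k) (b : Bool) :
    Matrix (Option (Bits A.n)) (Option (Bits A.n)) ℂ :=
  S.deletionGame k A b outBot fun _ _ v ρ => if v then outState ρ else outBot ρ

/-- The probability that the computational experiment outputs `1`: the adversary learns whether its
certificate is accepted, makes further key queries, and outputs a bit. -/
def cExp (S : CDABE) (k : ℕ) (A : S.Adversary k) (b : Bool) : ℝ :=
  S.deletionGame k A b (fun _ => 0) fun msk X v ρ =>
    S.run k msk (fun d P => !S.eval k d P X) A.post [] (writeBit A.res v ρ)
      fun _ ρ' => probOne A.out ρ'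

/-- Certified deletion security against non-uniform quantum polynomial-time adversaries. -/
def Secure (S : CDABE) : Prop :=
  ∀ A : ∀ k, S.Adversary k, PolyBounded (fun k => (A k).size) →
    (Negligible fun k => traceDist (S.evExp k (A k) false) (S.evExp k (A k) true)) ∧
    (Negligible fun k => |S.cExp k (A k) false - S.cExp k (A k) true|)

/-- `S` is an attribute-based encryption scheme with certified deletion. -/
def IsABEWithCertifiedDeletion (S : CDABE) : Prop :=
  S.Efficient ∧ S.Correct ∧ S.DeletionCorrect ∧ S.Secure

end CDABE

/-! ### The construction -/

/-- The BB84 state `|x⟩_θ`: bit `x i` is encoded in the computational basis if `θ i = 0` and in the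
Hadamard basis if `θ i = 1`. -/
def bb84 {k : ℕ} (x θ : Bits k) : Bits k → ℂ := fun z =>
  ∏ i, if θ i then hadamard (z i) (x i) else if z i = x i then 1 else 0

/-- The parity of the bits `x i` with `θ i = 0`. -/
def parity {k : ℕ} (x θ : Bits k) : Bool :=
  decide (Odd (Finset.univ.filter fun i => θ i = false ∧ x i = true).card)

/-- The plaintext `(θ, b')`. -/
def plaintext {k : ℕ} (θ : Bits k) (b' : Bool) : Bits (k + 1) := Fin.snoc θ b'

namespace ABE

/-- The scheme with certified deletion that is built from `E`. Verification keys are `(x, θ)`. -/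
def withDeletion (E : ABE fun k => k + 1) : CDABE where
  toKeySystem := E.toKeySystem
  ctQubits k := k + E.ctLen k
  vkLen k := k + k
  certLen k := k
  enc k pk X b vk :=
    let x : Bits k := fun i => vk (Fin.castAdd k i)
    let θ : Bits k := fun i => vk (Fin.natAdd k i)
    ((2 : ℝ) ^ (k + k))⁻¹ • avg fun c : Bits (E.encCoins k) =>
      tensor (ketbra (bb84 x θ)) (basisOp (E.enc k c pk X (plaintext θ (b ^^ parity x θ))))
  dec k d sk o :=
    ∑ ct : Bits (E.ctLen k), avg fun c : Bits (E.decCoins k d) =>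
      match E.dec k d c sk ct with
      | none => if o = none then tensor 1 (basisOp ct) else 0
      | some m =>
        let θ : Bits k := fun i => m i.castSucc
        let b' : Bool := m (Fin.last k)
        ∑ x : Bits k,
          if o = some (b' ^^ parity x θ) then tensor (ketbra (bb84 x θ)) (basisOp ct) else 0
  del _ x' := tensor (ketbra (bb84 x' fun _ => true)) 1
  ver k vk x' := decide (∀ i : Fin k, vk (Fin.natAdd k i) = true → vk (Fin.castAdd k i) = x' i)

end ABE

end CertifiedDeletion

end

noncomputable section

namespace CertifiedDeletion

/-! ### Elementary operations: linearity, Kraus representations, traces -/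

/-! Efficiency and correctness are explicit computations with circuits and BB84 amplitudes; the
substance is security. The challenge bit enters only through the masked bit `b ⊕ parity x θ`. For
fixed `θ`, certificate `t` and value of the masked bit, the contribution of the accepted runs to the
difference of the two experiments is, up to sign, a linear functional evaluated at `∑ x,
(-1)^(parity x θ) |x⟩⟨x|_θ`, where `x` ranges over the strings that agree with `t` wherever `θ i =
1`. At a position with `θ i = 0` this operator is `|0⟩⟨0| - |1⟩⟨1| = |+⟩⟨-| + |-⟩⟨+|`. Hence in the
Hadamard basis it is a sum of purely off-diagonal terms `|u⟩⟨u'|` with `u' = flipOff θ u`, as soon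
as `θ` has a zero (`sum_signed_bb84`). By Cauchy–Schwarz the functional at `|u⟩⟨u'|` is at most
`√(p(t|u) p(t|u'))`, where `p(t|u)` is the probability `certProb` of the certificate `t` on the
input `H|u⟩`. Whatever happens after the certificate has been sent only has to be contractive, not
efficient; this is the source of everlasting security (`certProb_bound`, `acceptPart_sub_le`).

The strings `u` and `u'` differ exactly where `θ i = 0`, and acceptance forces both to agree with
`t` elsewhere. So their distances to `t` add up to the number of zeros of `θ`, which is at least
`k/4` outside an exponentially small fraction of the bases; then one of the distances is at least
`k/8`. It remains to see that accepted certificates are rarely far from `u`. If the ciphertext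
encrypted a fixed string instead of `θ`, then `θ` would be independent of `u` and `t`, and a
certificate at distance `m` would be accepted with probability `2^(-m)`. Semantic security transfers
this to the real plaintext. To keep the reductions simple, the event of being far is replaced by the
weight `wt u t ^ c`: the acceptance indicator is a product of literals in the bits of `t`, `wt` is
an average of literals, and multiplication by a literal does not increase a bound on all Fourier
coefficients. So only the Fourier coefficients of the change of `certProb` have to be small, and
these are, up to a factor `2`, advantages of adversaries that output a parity of certificate bits
(`exists_fourierBound`). Since `c` is arbitrary, the resulting bound is negligible
(`exists_acceptPart_bound`).

The rejected runs are all runs minus the accepted ones (`deletionGame_eq_parts`), and the accepted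
ones obey the same bound. For all runs together the verification has disappeared. In the everlasting
experiment the output `⊥` depends only on the trace of the state, which does not feel the
ciphertext; in the computational one the adversary is always told that its certificate was rejected,
which is an efficient attack on the underlying scheme (`game_rejectTest`). The trace distance is
reduced to scalar functionals because the trace norm of a Hermitian matrix is attained at a unitary
(`exists_unitary_traceNorm`). All reductions have `x`, `θ`, `u` and the parity set built in;
non-uniformity makes the bounds uniform in these strings (`Secure.uniform`). -/

theorem isLinearMap_real_of_complex {ι κ : Type} {F : Matrix ι ι ℂ → Matrix κ κ ℂ}
    (hF : IsLinearMap ℂ F) : IsLinearMap ℝ F where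
  map_add := hF.map_add
  map_smul r A := by
    have h : ∀ (τ : Type) (B : Matrix τ τ ℂ), r • B = (r : ℂ) • B := fun τ B => by
      ext i j; simp
    rw [h, h, hF.map_smul]

theorem IsLinearMap.map_sum' {R M N ι : Type*} [Semiring R] [AddCommMonoid M] [AddCommMonoid N]
    [Module R M] [Module R N] {F : M → N} (hF : IsLinearMap R F) (s : Finset ι) (g : ι → M) :
    F (∑ i ∈ s, g i) = ∑ i ∈ s, F (g i) :=
  map_sum (hF.mk' F) g s

theorem IsLinearMap.comp' {R M N P : Type*} [Semiring R] [AddCommMonoid M] [AddCommMonoid N]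
    [AddCommMonoid P] [Module R M] [Module R N] [Module R P] {F : M → N} {G : N → P}
    (hG : IsLinearMap R G) (hF : IsLinearMap R F) : IsLinearMap R (fun x => G (F x)) :=
  ((hG.mk' G).comp (hF.mk' F)).isLinear

theorem isLinearMap_sum {R M N ι : Type*} [CommSemiring R] [AddCommMonoid M] [AddCommMonoid N]
    [Module R M] [Module R N] (s : Finset ι) {F : ι → M → N} (hF : ∀ i, IsLinearMap R (F i)) :
    IsLinearMap R (fun x => ∑ i ∈ s, F i x) where
  map_add x y := by simp only [(hF _).map_add, Finset.sum_add_distrib]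
  map_smul c x := by simp only [(hF _).map_smul, Finset.smul_sum]

theorem isLinearMap_add {R M N : Type*} [CommSemiring R] [AddCommMonoid M] [AddCommMonoid N]
    [Module R M] [Module R N] {F G : M → N} (hF : IsLinearMap R F) (hG : IsLinearMap R G) :
    IsLinearMap R (fun x => F x + G x) where
  map_add x y := by rw [hF.map_add, hG.map_add]; abel
  map_smul c x := by rw [hF.map_smul, hG.map_smul, smul_add]

theorem isLinearMap_smul {R M N : Type*} [CommSemiring R] [AddCommMonoid M] [AddCommMonoid N]
    [Module R M] [Module R N] {F : M → N} (hF : IsLinearMap R F) (r : R) :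
    IsLinearMap R (fun x => r • F x) where
  map_add x y := by rw [hF.map_add, smul_add]
  map_smul c x := by rw [hF.map_smul, smul_comm]

theorem isLinearMap_zero {R M N : Type*} [CommSemiring R] [AddCommMonoid M] [AddCommMonoid N]
    [Module R M] [Module R N] : IsLinearMap R (fun _ : M => (0 : N)) where
  map_add x y := by simp
  map_smul c x := by simp

theorem isLinearMap_avg {M V : Type} [AddCommMonoid M] [AddCommMonoid V]
    [Module ℝ M] [Module ℝ V] {r : ℕ} {F : Bits r → M → V} (hF : ∀ i, IsLinearMap ℝ (F i)) :
    IsLinearMap ℝ (fun x => avg fun c => F c x) :=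
  isLinearMap_smul (isLinearMap_sum _ hF) _

theorem map_avg {V W : Type} [AddCommMonoid V] [AddCommMonoid W] [Module ℝ V] [Module ℝ W]
    {L : V → W} (hL : IsLinearMap ℝ L) {r : ℕ} (f : Bits r → V) :
    L (avg f) = avg fun c => L (f c) := by
  simp only [avg, hL.map_smul, IsLinearMap.map_sum' hL]

theorem isLinearMap_project {ι : Type} [Fintype ι] {n : ℕ} (w : ι → Fin n) (t : ι → Bool) :
    IsLinearMap ℂ (project w t : Op n → Op n) where
  map_add A B := by ext y z; simp only [project, Matrix.of_apply, Matrix.add_apply]; split_ifs <;> simp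
  map_smul c A := by ext y z; simp only [project, Matrix.of_apply, Matrix.smul_apply]; split_ifs <;> simp

theorem isLinearMap_load {m n : ℕ} (w : Fin m ↪ Fin n) (σ : Op m) :
    IsLinearMap ℂ (load w σ : Op n → Op n) where
  map_add A B := by
    ext y z; simp only [load, Matrix.of_apply, Matrix.add_apply, Finset.sum_add_distrib, mul_add]
  map_smul c A := by
    ext y z
    simp only [load, Matrix.of_apply, Matrix.smul_apply, smul_eq_mul, ← Finset.mul_sum]; ring

theorem isLinearMap_load_left {m n : ℕ} (w : Fin m ↪ Fin n) (ρ : Op n) :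
    IsLinearMap ℂ (fun σ : Op m => load w σ ρ) where
  map_add A B := by
    ext y z; simp only [load, Matrix.of_apply, Matrix.add_apply, add_mul]
  map_smul c A := by
    ext y z
    simp only [load, Matrix.of_apply, Matrix.smul_apply, smul_eq_mul, mul_assoc]

theorem isLinearMap_tensor_left {a b : ℕ} (B : Op b) :
    IsLinearMap ℂ (fun A : Op a => tensor A B) where
  map_add A A' := by
    ext y z; simp only [tensor, Matrix.of_apply, Matrix.add_apply, add_mul]
  map_smul c A := by
    ext y z
    simp only [tensor, Matrix.of_apply, Matrix.smul_apply, smul_eq_mul, mul_assoc]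

/-- The embedding of a single wire. -/
def wire {n : ℕ} (i : Fin n) : Fin 1 ↪ Fin n := ⟨fun _ => i, fun _ _ _ => Subsingleton.elim _ _⟩

theorem extend_wire {n : ℕ} (i : Fin n) (t : Bits 1) (y : Bits n) :
    Function.extend (wire i) t y = Function.update y i (t 0) := by
  funext j
  by_cases h : j = i
  · subst h
    rw [Function.update_self]
    exact (wire j).injective.extend_apply t y 0
  · rw [Function.update_of_ne h, Function.extend_apply']
    rintro ⟨a, ha⟩; exact h ha.symm

theorem sum_bits_one {V : Type*} [AddCommMonoid V] (f : Bits 1 → V) :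
    ∑ t, f t = ∑ b : Bool, f fun _ => b := by
  refine (Fintype.sum_equiv (Equiv.funUnique (Fin 1) Bool).symm _ _ fun b => ?_).symm
  congr 1

/-- Makes resets and single-bit messages instances of `load`, so that linearity, Kraus form and
trace need only be treated there. -/
theorem writeBit_eq_write {n : ℕ} (i : Fin n) (s : Bool) (ρ : Op n) :
    writeBit i s ρ = write (wire i) (fun _ => s) ρ := by
  ext y z
  simp only [writeBit, write, load, Matrix.of_apply, basisOp, Matrix.single_apply, sum_bits_one,
    extend_wire]
  have h : ∀ y : Bits n, ((fun _ => s) = y ∘ wire i) ↔ y i = s := fun y => by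
    constructor
    · intro h; exact (congrFun h 0).symm
    · rintro h; funext j; exact h.symm
  simp only [h]
  split_ifs <;> simp

theorem isLinearMap_writeBit {n : ℕ} (i : Fin n) (s : Bool) :
    IsLinearMap ℂ (writeBit i s : Op n → Op n) := by
  have : (writeBit i s : Op n → Op n) = load (wire i) (basisOp fun _ => s) :=
    funext fun ρ => writeBit_eq_write i s ρ
  rw [this]; exact isLinearMap_load _ _

theorem isLinearMap_conj {n : ℕ} (U : Op n) :
    IsLinearMap ℂ (fun ρ : Op n => U * ρ * U.conjTranspose) where
  map_add A B := by rw [mul_add, add_mul]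
  map_smul c A := by rw [Matrix.mul_smul, Matrix.smul_mul]

theorem isLinearMap_gate {n : ℕ} (g : Gate n) : IsLinearMap ℂ g.apply := by
  cases g with
  | unitary u loc => exact isLinearMap_conj _
  | measure i => exact isLinearMap_add (isLinearMap_project _ _) (isLinearMap_project _ _)
  | reset i => exact isLinearMap_writeBit _ _

theorem applyCircuit_nil {n : ℕ} (ρ : Op n) : applyCircuit [] ρ = ρ := rfl

theorem applyCircuit_cons {n : ℕ} (g : Gate n) (C : List (Gate n)) (ρ : Op n) :
    applyCircuit (g :: C) ρ = applyCircuit C (g.apply ρ) := rfl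

theorem applyCircuit_append {n : ℕ} (C D : List (Gate n)) (ρ : Op n) :
    applyCircuit (C ++ D) ρ = applyCircuit D (applyCircuit C ρ) := by
  simp [applyCircuit, List.foldl_append]

theorem isLinearMap_circuit {n : ℕ} (C : List (Gate n)) : IsLinearMap ℂ (applyCircuit C) := by
  induction C with
  | nil => exact ⟨fun _ _ => rfl, fun _ _ => rfl⟩
  | cons g C ih => exact IsLinearMap.comp' (G := applyCircuit C) ih (isLinearMap_gate g)

/-- `T` maps `|φ⟩⟨ψ|` to `∑ j, |f j φ⟩⟨f j ψ|`. -/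
def HasKraus {a b : ℕ} (T : Op a → Op b) : Prop :=
  ∃ (ι : Type) (_ : Fintype ι) (f : ι → (Bits a → ℂ) → Bits b → ℂ), ∀ φ ψ,
    T (Matrix.vecMulVec φ (star ψ)) = ∑ j, Matrix.vecMulVec (f j φ) (star (f j ψ))

theorem hasKraus_project {ι : Type} [Fintype ι] {n : ℕ} (w : ι → Fin n) (t : ι → Bool) :
    HasKraus (project w t : Op n → Op n) := by
  refine ⟨Unit, inferInstance, fun _ φ y => if y ∘ w = t then φ y else 0, fun φ ψ => ?_⟩
  ext y z
  simp only [project, Matrix.of_apply, Matrix.vecMulVec_apply, Finset.univ_unique,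
    Finset.sum_singleton, Pi.star_apply]
  by_cases h1 : y ∘ w = t <;> by_cases h2 : z ∘ w = t <;> simp [h1, h2]

/-- The index `t` runs over the discarded content of the wires `w`: each basis state that is traced
out contributes one Kraus term. -/
theorem load_vecMulVec {m n : ℕ} (w : Fin m ↪ Fin n) (a a' : Bits m → ℂ) (φ ψ : Bits n → ℂ) :
    load w (Matrix.vecMulVec a (star a')) (Matrix.vecMulVec φ (star ψ)) =
      ∑ t : Bits m, Matrix.vecMulVec (fun y => a (y ∘ w) * φ (Function.extend w t y))
        (star fun y => a' (y ∘ w) * ψ (Function.extend w t y)) := by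
  ext y z
  simp only [load, Matrix.of_apply, Matrix.vecMulVec_apply, Matrix.sum_apply, Pi.star_apply,
    star_mul', Finset.mul_sum]
  refine Finset.sum_congr rfl fun t _ => ?_
  ring

theorem basisOp_eq_vecMulVec {n : ℕ} (s : Bits n) :
    basisOp s = Matrix.vecMulVec (Pi.single s 1) (star (Pi.single s 1)) := by
  rw [basisOp, Matrix.single_eq_single_vecMulVec_single]
  congr 1
  funext t
  by_cases h : t = s
  · subst h; simp
  · simp [h]

theorem hasKraus_write {m n : ℕ} (w : Fin m ↪ Fin n) (s : Bits m) :
    HasKraus (write w s : Op n → Op n) :=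
  ⟨Bits m, inferInstance, _, fun φ ψ => by
    rw [write, basisOp_eq_vecMulVec]; exact load_vecMulVec w _ _ φ ψ⟩

theorem hasKraus_conj {n : ℕ} (U : Op n) :
    HasKraus (fun ρ : Op n => U * ρ * U.conjTranspose) := by
  refine ⟨Unit, inferInstance, fun _ φ => U.mulVec φ, fun φ ψ => ?_⟩
  simp only [Finset.univ_unique, Finset.sum_singleton]
  rw [Matrix.mul_vecMulVec, Matrix.vecMulVec_mul, Matrix.star_mulVec]

theorem HasKraus.add {a b : ℕ} {S T : Op a → Op b} (hS : HasKraus S) (hT : HasKraus T) :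
    HasKraus (fun ρ => S ρ + T ρ) := by
  obtain ⟨ι, _, f, hf⟩ := hS
  obtain ⟨κ, _, g, hg⟩ := hT
  refine ⟨ι ⊕ κ, inferInstance, Sum.elim f g, fun φ ψ => ?_⟩
  simp [hf, hg, Fintype.sum_sum_type]

theorem HasKraus.comp {a b c : ℕ} {S : Op b → Op c} {T : Op a → Op b} (hS : HasKraus S)
    (hSl : IsLinearMap ℂ S) (hT : HasKraus T) : HasKraus (fun ρ => S (T ρ)) := by
  obtain ⟨ι, _, f, hf⟩ := hS
  obtain ⟨κ, _, g, hg⟩ := hT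
  refine ⟨κ × ι, inferInstance, fun j φ => f j.2 (g j.1 φ), fun φ ψ => ?_⟩
  simp only [hg, IsLinearMap.map_sum' hSl, hf, Fintype.sum_prod_type]

theorem hasKraus_gate {n : ℕ} (g : Gate n) : HasKraus g.apply := by
  cases g with
  | unitary u loc => exact hasKraus_conj _
  | measure i => exact (hasKraus_project _ _).add (hasKraus_project _ _)
  | reset i =>
    have : (Gate.reset i).apply = write (wire i) (fun _ => false) :=
      funext fun ρ => writeBit_eq_write i _ ρ
    rw [this]; exact hasKraus_write _ _

/-! Traces -/

theorem extend_comp_self {m n : ℕ} (w : Fin m ↪ Fin n) (t : Bits m) (y : Bits n) :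
    Function.extend w t y ∘ w = t := Function.extend_comp w.injective t y

theorem extend_extend {m n : ℕ} (w : Fin m ↪ Fin n) (s t : Bits m) (y : Bits n) :
    Function.extend w s (Function.extend w t y) = Function.extend w s y := by
  funext j
  by_cases h : ∃ a, w a = j
  · obtain ⟨a, rfl⟩ := h; simp [w.injective.extend_apply]
  · simp [Function.extend_apply' _ _ _ h]

theorem extend_comp_eq {m n : ℕ} (w : Fin m ↪ Fin n) (y : Bits n) :
    Function.extend w (y ∘ w) y = y := by
  funext j
  by_cases h : ∃ a, w a = j
  · obtain ⟨a, rfl⟩ := h; simp [w.injective.extend_apply]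
  · simp [Function.extend_apply' _ _ _ h]

/-- Exchange the content of the wires `w` with an external string. -/
def exchange {m n : ℕ} (w : Fin m ↪ Fin n) : Bits n × Bits m ≃ Bits n × Bits m :=
  Function.Involutive.toPerm (fun p => (Function.extend w p.2 p.1, p.1 ∘ w)) fun p => by
    simp [extend_comp_self, extend_extend, extend_comp_eq]

/-- Exchanging the wires `w` with an external string is a bijection of pairs; this is the change of
variables behind `trace_load`. -/
theorem sum_exchange {V : Type*} [AddCommMonoid V] {m n : ℕ} (w : Fin m ↪ Fin n)
    (f : Bits n → Bits m → V) :
    ∑ y, ∑ t, f (Function.extend w t y) (y ∘ w) = ∑ y, ∑ t, f y t := by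
  rw [← Fintype.sum_prod_type', ← Fintype.sum_prod_type']
  exact Fintype.sum_equiv (exchange w) _ _ fun p => rfl

theorem trace_load {m n : ℕ} (w : Fin m ↪ Fin n) (σ : Op m) (ρ : Op n) :
    (load w σ ρ).trace = σ.trace * ρ.trace := by
  simp only [Matrix.trace, Matrix.diag, load, Matrix.of_apply, Finset.mul_sum]
  rw [sum_exchange w (fun y t => σ t t * ρ y y), Finset.sum_comm]
  simp only [Finset.sum_mul]
  rw [Finset.sum_comm]

theorem trace_basisOp {n : ℕ} (s : Bits n) : (basisOp s).trace = 1 := by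
  simp [basisOp]

theorem trace_write {m n : ℕ} (w : Fin m ↪ Fin n) (s : Bits m) (ρ : Op n) :
    (write w s ρ).trace = ρ.trace := by
  rw [write, trace_load, trace_basisOp, one_mul]

theorem trace_project {ι : Type} [Fintype ι] {n : ℕ} (w : ι → Fin n) (t : ι → Bool) (ρ : Op n) :
    (project w t ρ).trace = ∑ y, if y ∘ w = t then ρ y y else 0 := by
  simp [Matrix.trace, project]

theorem sum_trace_project {ι : Type} [Fintype ι] [DecidableEq ι] {n : ℕ} (w : ι → Fin n)
    (ρ : Op n) : ∑ t, (project w t ρ).trace = ρ.trace := by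
  simp only [trace_project]
  rw [Finset.sum_comm]
  simp [Matrix.trace]

theorem trace_projectBit {n : ℕ} (i : Fin n) (t : Bool) (ρ : Op n) :
    (projectBit i t ρ).trace = ∑ y, if y i = t then ρ y y else 0 := by
  rw [projectBit, trace_project]
  refine Finset.sum_congr rfl fun y _ => ?_
  congr 1
  exact propext ⟨fun h => congrFun h (), fun h => funext fun _ => h⟩

theorem trace_projectBit_add {n : ℕ} (i : Fin n) (ρ : Op n) :
    (projectBit i false ρ).trace + (projectBit i true ρ).trace = ρ.trace := by
  rw [trace_projectBit, trace_projectBit, ← Finset.sum_add_distrib]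
  refine Finset.sum_congr rfl fun y _ => ?_
  cases y i <;> simp [Matrix.diag]

/-! Unitaries -/

theorem sum_agree {V : Type*} [AddCommMonoid V] {n : ℕ} (i : Fin n) (z : Bits n)
    (f : Bits n → V) :
    (∑ y, if ∀ j, j ≠ i → y j = z j then f y else 0) =
      ∑ b : Bool, f (Function.update z i b) := by
  rw [← Finset.sum_filter]
  symm
  refine Finset.sum_bij (fun b _ => Function.update z i b) ?_ ?_ ?_ ?_
  · intro b _
    simp only [Finset.mem_filter, Finset.mem_univ, true_and]
    intro j hj; simp [hj]
  · intro b _ b' _ h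
    simpa using congrFun h i
  · intro y hy
    simp only [Finset.mem_filter, Finset.mem_univ, true_and] at hy
    refine ⟨y i, Finset.mem_univ _, ?_⟩
    funext j
    by_cases h : j = i
    · subst h; simp
    · simp [h, hy j h]
  · intro b _; rfl

/-- The entries of `u`, or of the identity if the controls are not satisfied. -/
def Gate1.entry (u : Gate1) (c : Prop) [Decidable c] (a b : Bool) : ℂ :=
  if c then u.mat a b else if a = b then 1 else 0

theorem Gate1.matAt_apply {n : ℕ} (u : Gate1) (loc : Loc n) (y z : Bits n) :
    u.matAt loc y z = if ∀ i, i ≠ loc.tgt → y i = z i then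
      u.entry (∀ c ∈ loc.ctrl, z c = true) (y loc.tgt) (z loc.tgt) else 0 := rfl

theorem sqrt_two_sq : (Real.sqrt 2 : ℂ) * Real.sqrt 2 = 2 := by
  rw [← Complex.ofReal_mul, Real.mul_self_sqrt (by norm_num)]; norm_num

theorem sqrt_two_ne : (Real.sqrt 2 : ℂ) ≠ 0 := by
  intro h
  have := sqrt_two_sq
  rw [h] at this; norm_num at this

theorem hadamard_star (a b : Bool) : (starRingEnd ℂ) (hadamard a b) = hadamard a b := by
  cases a <;> cases b <;> simp [hadamard]

theorem hadamard_comm (a b : Bool) : hadamard a b = hadamard b a := by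
  cases a <;> cases b <;> simp [hadamard]

theorem hadamard_orth (a b : Bool) :
    ∑ c : Bool, hadamard c a * hadamard c b = if a = b then 1 else 0 := by
  have h := sqrt_two_sq
  have h0 := sqrt_two_ne
  have h2 : (1 : ℂ) / Real.sqrt 2 * (1 / Real.sqrt 2) = 1 / 2 := by
    rw [div_mul_div_comm, h]; norm_num
  have h3 : (-1 : ℂ) / Real.sqrt 2 = - (1 / Real.sqrt 2) := by ring
  cases a <;> cases b <;> simp [hadamard, -one_div] <;> simp only [h3, neg_mul, mul_neg, h2] <;> norm_num

theorem Gate1.mat_unitary (u : Gate1) (a b : Bool) :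
    ∑ c : Bool, star (u.mat c a) * u.mat c b = if a = b then 1 else 0 := by
  cases u with
  | X => cases a <;> cases b <;> simp [Gate1.mat]
  | H =>
    simp only [Gate1.mat, Complex.star_def, hadamard_star]
    exact hadamard_orth a b
  | T =>
    have : (starRingEnd ℂ) (Complex.exp (Complex.I * (Real.pi / 4))) *
        Complex.exp (Complex.I * (Real.pi / 4)) = 1 := by
      rw [← Complex.exp_conj, ← Complex.exp_add]
      simp [map_ofNat]
    cases a <;> cases b <;> simp [Gate1.mat, Matrix.diagonal_apply, this]

theorem Gate1.entry_unitary (u : Gate1) (c : Prop) [Decidable c] (a b : Bool) :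
    ∑ x : Bool, star (u.entry c x a) * u.entry c x b = if a = b then 1 else 0 := by
  by_cases h : c
  · simp only [Gate1.entry, h, if_true]; exact u.mat_unitary a b
  · simp only [Gate1.entry, h, if_false]
    cases a <;> cases b <;> simp

theorem Loc.ctrl_update {n : ℕ} (loc : Loc n) (z : Bits n) (b : Bool) :
    (∀ c ∈ loc.ctrl, Function.update z loc.tgt b c = true) ↔ ∀ c ∈ loc.ctrl, z c = true := by
  refine forall₂_congr fun c hc => ?_
  rw [Function.update_of_ne]
  rintro rfl; exact loc.notMem hc

/-- The target is not a control, so strings that differ only at the target satisfy the same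
controls. The matrix therefore splits into 2 × 2 blocks, each of them the gate or the identity. -/
theorem Gate1.matAt_unitary {n : ℕ} (u : Gate1) (loc : Loc n) :
    (u.matAt loc).conjTranspose * u.matAt loc = 1 := by
  ext z z'
  simp only [Matrix.mul_apply, Matrix.conjTranspose_apply, Matrix.one_apply]
  have h1 : ∀ y, star (u.matAt loc y z) * u.matAt loc y z' =
      if ∀ i, i ≠ loc.tgt → y i = z i then
        star (u.entry (∀ c ∈ loc.ctrl, z c = true) (y loc.tgt) (z loc.tgt)) * u.matAt loc y z'
      else 0 := fun y => by
    rw [Gate1.matAt_apply]; split_ifs <;> simp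
  simp only [h1]
  rw [sum_agree]
  simp only [Gate1.matAt_apply, Function.update_self]
  by_cases h : ∀ i, i ≠ loc.tgt → z i = z' i
  · have hc : (∀ c ∈ loc.ctrl, z c = true) ↔ ∀ c ∈ loc.ctrl, z' c = true := by
      refine forall₂_congr fun c hc => ?_
      rw [h c]; rintro rfl; exact loc.notMem hc
    have hb : ∀ b, (∀ i, i ≠ loc.tgt → Function.update z loc.tgt b i = z' i) ↔ True := fun b =>
      iff_true_intro fun i hi => by rw [Function.update_of_ne hi]; exact h i hi
    simp only [hb, if_true]
    have : ∀ x, u.entry (∀ c ∈ loc.ctrl, z c = true) x (z loc.tgt) =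
        u.entry (∀ c ∈ loc.ctrl, z' c = true) x (z loc.tgt) := fun x => by
      simp only [Gate1.entry, hc]
    simp only [this]
    rw [Gate1.entry_unitary]
    congr 1
    refine propext ⟨fun ht => ?_, fun hz => by rw [hz]⟩
    funext i
    by_cases hi : i = loc.tgt
    · rw [hi]; exact ht
    · exact h i hi
  · have hb : ∀ b, ¬ (∀ i, i ≠ loc.tgt → Function.update z loc.tgt b i = z' i) := fun b hb =>
      h fun i hi => by rw [← hb i hi, Function.update_of_ne hi]
    have hz : z ≠ z' := by rintro rfl; exact h fun _ _ => rfl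
    simp [hb, hz]

theorem trace_conj_unitary {n : ℕ} {U : Op n} (hU : U.conjTranspose * U = 1) (ρ : Op n) :
    (U * ρ * U.conjTranspose).trace = ρ.trace := by
  rw [Matrix.trace_mul_comm, ← mul_assoc, hU, one_mul]

theorem trace_gate {n : ℕ} (g : Gate n) (ρ : Op n) : (g.apply ρ).trace = ρ.trace := by
  cases g with
  | unitary u loc => exact trace_conj_unitary (u.matAt_unitary loc) ρ
  | measure i =>
    simp only [Gate.apply, Matrix.trace_add]
    exact trace_projectBit_add i ρ
  | reset i => simp only [Gate.apply, writeBit_eq_write, trace_write]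

/-! ### Runs of interactive machines -/

namespace KeySystem

variable (K : KeySystem) (k : ℕ) (msk : Bits (K.mskLen k)) (allow : ∀ d, Bits d → Bool)
  {V W : Type} [AddCommMonoid V] [Module ℝ V] [AddCommMonoid W] [Module ℝ W] {n : ℕ}

/-- Branches are only ever combined by sums and averages, so linear post-processing can be moved
inside a run. Applied to scalar functionals of operator-valued experiments and to families of
functionals. -/
theorem run_map {L : V → W} (hL : IsLinearMap ℝ L) (is : List (Instr (K.skLen k) n))
    (h : List (Σ d, Bits d)) (ρ : Op n) (final : List (Σ d, Bits d) → Op n → V) :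
    L (K.run k msk allow is h ρ final) = K.run k msk allow is h ρ fun h ρ => L (final h ρ) := by
  induction is generalizing h ρ with
  | nil => rfl
  | cons i is ih =>
    cases i with
    | gate g => exact ih _ _
    | query ctrl d pred ans =>
      simp only [KeySystem.run, hL.map_add, IsLinearMap.map_sum' hL, ih]
      congr 1
      refine Finset.sum_congr rfl fun P _ => ?_
      split_ifs
      · rw [map_avg hL]; simp only [ih]
      · rw [ih]

theorem run_append (is js : List (Instr (K.skLen k) n))
    (h : List (Σ d, Bits d)) (ρ : Op n) (final : List (Σ d, Bits d) → Op n → V) :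
    K.run k msk allow (is ++ js) h ρ final =
      K.run k msk allow is h ρ fun h ρ => K.run k msk allow js h ρ final := by
  induction is generalizing h ρ with
  | nil => rfl
  | cons i is ih =>
    cases i with
    | gate g => exact ih _ _
    | query ctrl d pred ans =>
      simp only [List.cons_append, KeySystem.run, ih]

theorem run_gates (C : List (Gate n)) (h : List (Σ d, Bits d)) (ρ : Op n)
    (final : List (Σ d, Bits d) → Op n → V) :
    K.run k msk allow (C.map Instr.gate) h ρ final = final h (applyCircuit C ρ) := by
  induction C generalizing ρ with
  | nil => rfl
  | cons g C ih => exact ih _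

/-- The oracle answers according to `allow`; the history is recorded for `final` alone, and is
irrelevant if `final` ignores it. -/
theorem run_history (is : List (Instr (K.skLen k) n)) (h h' : List (Σ d, Bits d)) (ρ : Op n)
    (final : Op n → V) :
    K.run k msk allow is h ρ (fun _ => final) = K.run k msk allow is h' ρ fun _ => final := by
  induction is generalizing h h' ρ with
  | nil => rfl
  | cons i is ih =>
    cases i with
    | gate g => exact ih _ _ _
    | query ctrl d pred ans =>
      simp only [KeySystem.run]
      rw [ih h h']
      congr 1
      refine Finset.sum_congr rfl fun P _ => ?_
      split_ifs
      · congr 1; funext c; exact ih _ _ _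
      · exact ih _ _ _

theorem isLinearMap_run (is : List (Instr (K.skLen k) n)) (h : List (Σ d, Bits d))
    {final : List (Σ d, Bits d) → Op n → V} (hf : ∀ h, IsLinearMap ℝ (final h)) :
    IsLinearMap ℝ fun ρ => K.run k msk allow is h ρ final := by
  induction is generalizing h with
  | nil => exact hf h
  | cons i is ih =>
    cases i with
    | gate g =>
      exact IsLinearMap.comp' (ih h) (isLinearMap_real_of_complex (isLinearMap_gate g))
    | query ctrl d pred ans =>
      simp only [KeySystem.run]
      have hp : ∀ b, IsLinearMap ℝ (projectBit ctrl b : Op n → Op n) := fun b =>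
        isLinearMap_real_of_complex (isLinearMap_project _ _)
      have hw : ∀ s P, IsLinearMap ℝ fun ρ : Op n =>
          write ans s (project pred P (projectBit ctrl true ρ)) := fun s P =>
        IsLinearMap.comp' (isLinearMap_real_of_complex (isLinearMap_load ans (basisOp s)))
          (IsLinearMap.comp' (isLinearMap_real_of_complex (isLinearMap_project _ _)) (hp true))
      refine isLinearMap_add (IsLinearMap.comp' (ih h) (hp false)) (isLinearMap_sum _ fun P => ?_)
      split_ifs
      · exact isLinearMap_avg fun c => IsLinearMap.comp' (ih _) (hw _ _)
      · exact IsLinearMap.comp' (ih _) (hw _ _)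

end KeySystem

theorem avg_const {V : Type} [AddCommMonoid V] [Module ℝ V] {r : ℕ} (v : V) :
    (avg fun _ : Bits r => v) = v := by
  rw [avg, Finset.sum_const, Finset.card_univ]
  simp only [Fintype.card_pi, Fintype.card_bool, Finset.prod_const, Finset.card_univ,
    Fintype.card_fin]
  rw [← Nat.cast_smul_eq_nsmul ℝ, smul_smul]
  push_cast
  rw [inv_mul_cancel₀ (by positivity), one_smul]

/-- The real part of the trace. -/
def rtr {ι : Type} [Fintype ι] (ρ : Matrix ι ι ℂ) : ℝ := ρ.trace.re

theorem isLinearMap_rtr {ι : Type} [Fintype ι] : IsLinearMap ℝ (rtr : Matrix ι ι ℂ → ℝ) where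
  map_add A B := by simp [rtr]
  map_smul r A := by simp [rtr, Matrix.trace_smul]

/-- Each instruction preserves the trace once its outcomes are summed and the coins of the key
generation are averaged. -/
theorem KeySystem.run_trace (K : KeySystem) (k : ℕ) (msk : Bits (K.mskLen k))
    (allow : ∀ d, Bits d → Bool) {n : ℕ} (is : List (Instr (K.skLen k) n))
    (h : List (Σ d, Bits d)) (ρ : Op n) :
    K.run k msk allow is h ρ (fun _ ρ => ρ.trace) = ρ.trace := by
  induction is generalizing h ρ with
  | nil => rfl
  | cons i is ih =>
    cases i with
    | gate g => exact (ih _ _).trans (trace_gate g ρ)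
    | query ctrl d pred ans =>
      simp only [KeySystem.run, ih]
      simp only [trace_write, avg_const, ite_self]
      rw [sum_trace_project, trace_projectBit_add]

theorem KeySystem.run_rtr (K : KeySystem) (k : ℕ) (msk : Bits (K.mskLen k))
    (allow : ∀ d, Bits d → Bool) {n : ℕ} (is : List (Instr (K.skLen k) n))
    (h : List (Σ d, Bits d)) (ρ : Op n) :
    K.run k msk allow is h ρ (fun _ ρ => rtr ρ) = rtr ρ := by
  have hre : IsLinearMap ℝ Complex.re := ⟨fun _ _ => rfl, fun r z => by simp⟩
  rw [rtr, ← K.run_trace k msk allow is h ρ, K.run_map k msk allow hre]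
  rfl

/-! ### Cauchy–Schwarz bounds -/

/-- `|f|² ≤ g g'`. -/
structure SqBound (f g g' : ℝ) : Prop where
  left : 0 ≤ g
  right : 0 ≤ g'
  le : |f| ≤ √g * √g'

theorem SqBound.zero : SqBound 0 0 0 := ⟨le_rfl, le_rfl, by simp⟩

/-- Cauchy–Schwarz in the form `∑ √g √g' ≤ √(∑ g) √(∑ g')`. It makes the relation stable under every
way in which branches are combined. -/
theorem SqBound.sum {ι : Type*} {s : Finset ι} {f g g' : ι → ℝ}
    (h : ∀ i, SqBound (f i) (g i) (g' i)) :
    SqBound (∑ i ∈ s, f i) (∑ i ∈ s, g i) (∑ i ∈ s, g' i) where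
  left := Finset.sum_nonneg fun i _ => (h i).left
  right := Finset.sum_nonneg fun i _ => (h i).right
  le := (Finset.abs_sum_le_sum_abs _ _).trans ((Finset.sum_le_sum fun i _ => (h i).le).trans
    (Real.sum_sqrt_mul_sqrt_le s (fun i => (h i).left) fun i => (h i).right))

theorem SqBound.add {f g g' e d d' : ℝ} (h : SqBound f g g') (h' : SqBound e d d') :
    SqBound (f + e) (g + d) (g' + d') := by
  have := SqBound.sum (s := Finset.univ) (f := fun b : Bool => if b then f else e)
    (g := fun b : Bool => if b then g else d) (g' := fun b : Bool => if b then g' else d')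
    (fun b => by cases b <;> assumption)
  simpa using this

theorem SqBound.mul {f g g' : ℝ} (h : SqBound f g g') {c : ℝ} (hc : 0 ≤ c) :
    SqBound (c * f) (c * g) (c * g') where
  left := mul_nonneg hc h.left
  right := mul_nonneg hc h.right
  le := by
    rw [abs_mul, abs_of_nonneg hc, Real.sqrt_mul hc, Real.sqrt_mul hc]
    calc c * |f| ≤ c * (√g * √g') := mul_le_mul_of_nonneg_left h.le hc
      _ = (√c * √c) * (√g * √g') := by rw [Real.mul_self_sqrt hc]
      _ = _ := by ring

theorem SqBound.avg {r : ℕ} {f g g' : Bits r → ℝ} (h : ∀ i, SqBound (f i) (g i) (g' i)) :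
    SqBound (avg f) (avg g) (avg g') :=
  (SqBound.sum h).mul (by positivity)

theorem SqBound.ite {p : Prop} [Decidable p] {f g g' : ℝ} (h : p → SqBound f g g') :
    SqBound (if p then f else 0) (if p then g else 0) (if p then g' else 0) := by
  split_ifs with hp
  · exact h hp
  · exact .zero

/-- `|F(|φ⟩⟨ψ|)|² ≤ G(|φ⟩⟨φ|) G'(|ψ⟩⟨ψ|)`. -/
def Dominated {n : ℕ} (F G G' : Op n → ℝ) : Prop :=
  ∀ φ ψ : Bits n → ℂ, SqBound (F (Matrix.vecMulVec φ (star ψ)))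
    (G (Matrix.vecMulVec φ (star φ))) (G' (Matrix.vecMulVec ψ (star ψ)))

/-- A Kraus family acts by the same maps on the left and on the right vector, hence produces
matching terms from `|φ⟩⟨ψ|`, `|φ⟩⟨φ|` and `|ψ⟩⟨ψ|`; these are bounded one by one and then summed.
-/
theorem Dominated.comp {a b : ℕ} {F G G' : Op b → ℝ} (h : Dominated F G G')
    (hF : IsLinearMap ℝ F) (hG : IsLinearMap ℝ G) (hG' : IsLinearMap ℝ G') {T : Op a → Op b}
    (hT : HasKraus T) : Dominated (fun ρ => F (T ρ)) (fun ρ => G (T ρ)) fun ρ => G' (T ρ) := by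
  obtain ⟨ι, _, f, hf⟩ := hT
  intro φ ψ
  simp only [hf, IsLinearMap.map_sum' hF, IsLinearMap.map_sum' hG, IsLinearMap.map_sum' hG']
  exact SqBound.sum fun j => h _ _

/-- Controls a run on an unphysical off-diagonal input by two runs on genuine states, each
instruction being a sum of Kraus maps. -/
theorem KeySystem.run_dominated (K : KeySystem) (k : ℕ) (msk : Bits (K.mskLen k))
    (allow : ∀ d, Bits d → Bool) {n : ℕ} (is : List (Instr (K.skLen k) n))
    (h : List (Σ d, Bits d)) {F G G' : List (Σ d, Bits d) → Op n → ℝ}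
    (hD : ∀ h, Dominated (F h) (G h) (G' h)) (hF : ∀ h, IsLinearMap ℝ (F h))
    (hG : ∀ h, IsLinearMap ℝ (G h)) (hG' : ∀ h, IsLinearMap ℝ (G' h)) :
    Dominated (fun ρ => K.run k msk allow is h ρ F) (fun ρ => K.run k msk allow is h ρ G)
      fun ρ => K.run k msk allow is h ρ G' := by
  induction is generalizing h with
  | nil => exact hD h
  | cons i is ih =>
    have lin : ∀ (h : List (Σ d, Bits d)) {F : List (Σ d, Bits d) → Op n → ℝ},
        (∀ h, IsLinearMap ℝ (F h)) → IsLinearMap ℝ fun ρ => K.run k msk allow is h ρ F :=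
      fun h _ hF => K.isLinearMap_run k msk allow is h hF
    cases i with
    | gate g => exact (ih h).comp (lin h hF) (lin h hG) (lin h hG') (hasKraus_gate g)
    | query ctrl d pred ans =>
      have hw : ∀ s P, HasKraus fun ρ : Op n =>
          write ans s (project pred P (projectBit ctrl true ρ)) := fun s P =>
        (hasKraus_write ans s).comp (isLinearMap_load ans (basisOp s))
          ((hasKraus_project _ _).comp (isLinearMap_project _ _) (hasKraus_project _ _))
      intro φ ψ
      simp only [KeySystem.run]
      refine SqBound.add ((ih h).comp (lin h hF) (lin h hG) (lin h hG')
        (hasKraus_project _ _) φ ψ) (SqBound.sum fun P => ?_)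
      split_ifs
      · exact SqBound.avg fun c => (ih _).comp (lin _ hF) (lin _ hG) (lin _ hG') (hw _ _) φ ψ
      · exact (ih _).comp (lin _ hF) (lin _ hG) (lin _ hG') (hw _ _) φ ψ

/-- A functional that is bounded by the trace. -/
structure Contractive {n : ℕ} (f : Op n → ℝ) : Prop where
  linear : IsLinearMap ℝ f
  dominated : Dominated f rtr rtr

theorem rtr_vecMulVec {n : ℕ} (φ : Bits n → ℂ) :
    rtr (Matrix.vecMulVec φ (star φ)) = ∑ y, ‖φ y‖ ^ 2 := by
  simp only [rtr, Matrix.trace, Matrix.diag, Matrix.vecMulVec_apply, Complex.re_sum, Pi.star_apply]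
  refine Finset.sum_congr rfl fun y _ => ?_
  rw [Complex.star_def, Complex.mul_conj, Complex.ofReal_re, Complex.normSq_eq_norm_sq]

theorem sum_norm_mul_le {ι : Type*} [Fintype ι] (φ ψ : ι → ℂ) :
    ∑ y, ‖φ y‖ * ‖ψ y‖ ≤ √(∑ y, ‖φ y‖ ^ 2) * √(∑ y, ‖ψ y‖ ^ 2) :=
  Real.sum_mul_le_sqrt_mul_sqrt _ _ _

theorem rtr_project {ι : Type} [Fintype ι] {n : ℕ} (w : ι → Fin n) (t : ι → Bool) (ρ : Op n) :
    rtr (project w t ρ) = ∑ y, if y ∘ w = t then (ρ y y).re else 0 := by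
  rw [rtr, trace_project, Complex.re_sum]
  exact Finset.sum_congr rfl fun y _ => by split_ifs <;> simp

theorem contractive_rtr {n : ℕ} : Contractive (rtr : Op n → ℝ) where
  linear := isLinearMap_rtr
  dominated φ ψ := by
    rw [rtr_vecMulVec, rtr_vecMulVec]
    refine ⟨by positivity, by positivity, ?_⟩
    refine (Complex.abs_re_le_norm _).trans ((norm_sum_le _ _).trans ?_)
    refine le_trans (le_of_eq ?_) (sum_norm_mul_le φ ψ)
    exact Finset.sum_congr rfl fun y _ => by simp [Matrix.vecMulVec_apply]

theorem contractive_probOne {n : ℕ} (i : Fin n) : Contractive (probOne i) where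
  linear := IsLinearMap.comp' (G := rtr) (F := projectBit i true) isLinearMap_rtr
    (isLinearMap_real_of_complex (isLinearMap_project _ _))
  dominated φ ψ := by
    rw [rtr_vecMulVec, rtr_vecMulVec]
    refine ⟨by positivity, by positivity, ?_⟩
    refine (Complex.abs_re_le_norm _).trans ?_
    rw [trace_projectBit]
    refine (norm_sum_le _ _).trans (le_trans ?_ (sum_norm_mul_le φ ψ))
    refine Finset.sum_le_sum fun y _ => ?_
    split_ifs
    · simp [Matrix.vecMulVec_apply]
    · simp; positivity

/-- The dominating functional is the trace, which a run preserves; hence an interactive phase of any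
length before a contractive functional leaves it contractive. -/
theorem KeySystem.run_contractive (K : KeySystem) (k : ℕ) (msk : Bits (K.mskLen k))
    (allow : ∀ d, Bits d → Bool) {n : ℕ} (is : List (Instr (K.skLen k) n))
    (h : List (Σ d, Bits d)) {f : Op n → ℝ} (hf : Contractive f) :
    Contractive fun ρ => K.run k msk allow is h ρ fun _ => f where
  linear := K.isLinearMap_run k msk allow is h fun _ => hf.linear
  dominated φ ψ := by
    have := K.run_dominated k msk allow is h (F := fun _ => f) (G := fun _ => rtr)
      (G' := fun _ => rtr) (fun _ => hf.dominated) (fun _ => hf.linear) (fun _ => isLinearMap_rtr)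
      (fun _ => isLinearMap_rtr) φ ψ
    simpa only [K.run_rtr] using this

theorem Contractive.comp {a b : ℕ} {f : Op b → ℝ} (hf : Contractive f) {T : Op a → Op b}
    (hT : HasKraus T) (hTl : IsLinearMap ℂ T) (htr : ∀ ρ, (T ρ).trace = ρ.trace) :
    Contractive fun ρ => f (T ρ) where
  linear := IsLinearMap.comp' hf.linear (isLinearMap_real_of_complex hTl)
  dominated φ ψ := by
    have := hf.dominated.comp hf.linear isLinearMap_rtr isLinearMap_rtr hT φ ψ
    simpa only [rtr, htr] using this

/-! ### Machines on a part of a larger register -/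

def Loc.map {n n' : ℕ} (f : Fin n ↪ Fin n') (loc : Loc n) : Loc n' where
  ctrl := loc.ctrl.map f
  tgt := f loc.tgt
  card_le := by rw [Finset.card_map]; exact loc.card_le
  notMem := by simpa using loc.notMem

def Gate.map {n n' : ℕ} (f : Fin n ↪ Fin n') : Gate n → Gate n'
  | .unitary u loc => .unitary u (loc.map f)
  | .measure i => .measure (f i)
  | .reset i => .reset (f i)

def Instr.map {skLen : ℕ → ℕ} {n n' : ℕ} (f : Fin n ↪ Fin n') : Instr skLen n → Instr skLen n'
  | .gate g => .gate (g.map f)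
  | .query ctrl d pred ans => .query (f ctrl) d (pred.trans f) (ans.trans f)

/-- The embedding of the first `a` wires. -/
def fstWires (a b : ℕ) : Fin a ↪ Fin (a + b) := Fin.castAddEmb b

/-- The embedding of the last `b` wires. -/
def sndWires (a b : ℕ) : Fin b ↪ Fin (a + b) := Fin.natAddEmb a

theorem tensor_apply {a b : ℕ} (A : Op a) (B : Op b) (y z : Bits (a + b)) :
    tensor A B y z = A (y ∘ fstWires a b) (z ∘ fstWires a b) *
      B (y ∘ sndWires a b) (z ∘ sndWires a b) := rfl

theorem sum_append {V : Type*} [AddCommMonoid V] {a b : ℕ} (f : Bits a → Bits b → V) :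
    ∑ y : Bits (a + b), f (y ∘ fstWires a b) (y ∘ sndWires a b) = ∑ s, ∑ t, f s t := by
  rw [← Fintype.sum_prod_type']
  refine (Fintype.sum_equiv (Fin.appendEquiv a b) _ _ fun p => ?_).symm
  congr 1
  · funext i; simp [fstWires, Fin.appendEquiv]
  · funext i; simp [sndWires, Fin.appendEquiv]

theorem wires_ext {α : Type*} {a b : ℕ} {y z : Fin (a + b) → α}
    (h1 : y ∘ fstWires a b = z ∘ fstWires a b) (h2 : y ∘ sndWires a b = z ∘ sndWires a b) :
    y = z := by
  funext i
  refine Fin.addCases (fun i => congrFun h1 i) (fun i => congrFun h2 i) i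

theorem fstWires_ne_sndWires {a b : ℕ} (i : Fin a) (j : Fin b) :
    fstWires a b i ≠ sndWires a b j := by
  intro h
  have := congrArg Fin.val h
  simp [fstWires, sndWires] at this
  omega

theorem tensor_mul {a b : ℕ} (A C : Op a) (B D : Op b) :
    tensor A B * tensor C D = tensor (A * C) (B * D) := by
  ext y z
  simp only [Matrix.mul_apply, tensor_apply]
  rw [Finset.sum_mul_sum, ← sum_append fun s t => A (y ∘ fstWires a b) s * C s (z ∘ fstWires a b) *
    (B (y ∘ sndWires a b) t * D t (z ∘ sndWires a b))]
  exact Finset.sum_congr rfl fun x _ => by ring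

theorem tensor_conjTranspose {a b : ℕ} (A : Op a) (B : Op b) :
    (tensor A B).conjTranspose = tensor A.conjTranspose B.conjTranspose := by
  ext y z
  simp [Matrix.conjTranspose_apply, tensor_apply]

theorem trace_tensor {a b : ℕ} (A : Op a) (B : Op b) :
    (tensor A B).trace = A.trace * B.trace := by
  simp only [Matrix.trace, Matrix.diag, tensor_apply]
  rw [Finset.sum_mul_sum, ← sum_append fun s t => A s s * B t t]

theorem matAt_map_fst {a b : ℕ} (u : Gate1) (loc : Loc a) :
    u.matAt (loc.map (fstWires a b)) = tensor (u.matAt loc) 1 := by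
  ext y z
  simp only [tensor_apply, Gate1.matAt_apply, Loc.map, Matrix.one_apply]
  have h1 : (∀ c ∈ loc.ctrl.map (fstWires a b), z c = true) ↔
      ∀ c ∈ loc.ctrl, (z ∘ fstWires a b) c = true := by simp
  have h2 : (∀ i, i ≠ fstWires a b loc.tgt → y i = z i) ↔
      (∀ i, i ≠ loc.tgt → (y ∘ fstWires a b) i = (z ∘ fstWires a b) i) ∧
        y ∘ sndWires a b = z ∘ sndWires a b := by
    constructor
    · intro h
      exact ⟨fun i hi => h _ fun he => hi ((fstWires a b).injective he),
        funext fun j => h _ (fstWires_ne_sndWires _ _).symm⟩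
    · rintro ⟨h3, h4⟩ i
      refine Fin.addCases (fun i hi => h3 i fun he => hi (by rw [he]; rfl))
        (fun i _ => congrFun h4 i) i
  simp only [h2, Gate1.entry, h1, Function.comp_apply]
  split_ifs <;> simp_all

theorem project_tensor {a b : ℕ} {ι : Type} [Fintype ι] (w : ι → Fin a) (t : ι → Bool)
    (ρ : Op a) (τ : Op b) :
    project (fun i => fstWires a b (w i)) t (tensor ρ τ) = tensor (project w t ρ) τ := by
  ext y z
  simp only [project, Matrix.of_apply, tensor_apply, ite_mul, zero_mul]
  rfl

theorem project_tensor_snd {a b : ℕ} {ι : Type} [Fintype ι] (w : ι → Fin b) (t : ι → Bool)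
    (ρ : Op a) (τ : Op b) :
    project (fun i => sndWires a b (w i)) t (tensor ρ τ) = tensor ρ (project w t τ) := by
  ext y z
  simp only [project, Matrix.of_apply, tensor_apply, mul_ite, mul_zero]
  rfl

theorem extend_trans_fst {a b m : ℕ} (w : Fin m ↪ Fin a) (t : Bits m) (y : Bits (a + b)) :
    Function.extend (w.trans (fstWires a b)) t y ∘ fstWires a b =
      Function.extend w t (y ∘ fstWires a b) := by
  funext i
  by_cases h : ∃ j, w j = i
  · obtain ⟨j, rfl⟩ := h
    rw [w.injective.extend_apply]
    exact (w.trans (fstWires a b)).injective.extend_apply t y j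
  · rw [Function.extend_apply' _ _ _ h, Function.comp_apply, Function.extend_apply']
    · rfl
    · rintro ⟨j, hj⟩; exact h ⟨j, (fstWires a b).injective hj⟩

theorem extend_trans_snd {a b m : ℕ} (w : Fin m ↪ Fin a) (t : Bits m) (y : Bits (a + b)) :
    Function.extend (w.trans (fstWires a b)) t y ∘ sndWires a b = y ∘ sndWires a b := by
  funext i
  rw [Function.comp_apply, Function.extend_apply']
  · rfl
  · rintro ⟨j, hj⟩; exact fstWires_ne_sndWires _ _ hj

theorem load_tensor {a b m : ℕ} (w : Fin m ↪ Fin a) (σ : Op m) (ρ : Op a) (τ : Op b) :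
    load (w.trans (fstWires a b)) σ (tensor ρ τ) = tensor (load w σ ρ) τ := by
  ext y z
  simp only [load, Matrix.of_apply, tensor_apply, extend_trans_fst, extend_trans_snd,
    ← Finset.sum_mul, mul_assoc]
  rfl

theorem gate_tensor {a b : ℕ} (g : Gate a) (ρ : Op a) (τ : Op b) :
    (g.map (fstWires a b)).apply (tensor ρ τ) = tensor (g.apply ρ) τ := by
  cases g with
  | unitary u loc =>
    simp only [Gate.map, Gate.apply, matAt_map_fst, tensor_conjTranspose, tensor_mul, one_mul,
      Matrix.conjTranspose_one, mul_one]
  | measure i =>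
    simp only [Gate.map, Gate.apply]
    rw [(isLinearMap_tensor_left τ).map_add]
    exact congrArg₂ (· + ·) (project_tensor _ _ _ _) (project_tensor _ _ _ _)
  | reset i =>
    simp only [Gate.map, Gate.apply, writeBit_eq_write]
    exact load_tensor (wire i) _ _ _

/-- Wires added by a reduction are spectators while the embedded adversary runs, so the product form
persists in every branch. -/
theorem KeySystem.run_tensor (K : KeySystem) (k : ℕ) (msk : Bits (K.mskLen k))
    (allow : ∀ d, Bits d → Bool) {V : Type} [AddCommMonoid V] [Module ℝ V] {a b : ℕ}
    (is : List (Instr (K.skLen k) a)) (h : List (Σ d, Bits d)) (ρ : Op a) (τ : Op b)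
    (final : List (Σ d, Bits d) → Op (a + b) → V) :
    K.run k msk allow (is.map (Instr.map (fstWires a b))) h (tensor ρ τ) final =
      K.run k msk allow is h ρ fun h ρ => final h (tensor ρ τ) := by
  induction is generalizing h ρ with
  | nil => rfl
  | cons i is ih =>
    cases i with
    | gate g =>
      simp only [List.map_cons, Instr.map, KeySystem.run]
      rw [gate_tensor, ih]
    | query ctrl d pred ans =>
      simp only [List.map_cons, Instr.map, KeySystem.run]
      have h1 : ∀ c, projectBit (fstWires a b ctrl) c (tensor ρ τ) =
          tensor (projectBit ctrl c ρ) τ := fun c => project_tensor _ _ _ _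
      have h2 : ∀ (P : Bits d) σ, project (pred.trans (fstWires a b)) P (tensor σ τ) =
          tensor (project pred P σ) τ := fun P σ => project_tensor _ _ _ _
      simp only [h1, h2, write, load_tensor, ih]

/-! ### Loading product states -/

theorem extend_at {ι κ α : Type*} (w : ι ↪ κ) (t : ι → α) (y : κ → α) (i : ι) :
    Function.extend w t y (w i) = t i := w.injective.extend_apply t y i

theorem extend_off {ι κ α : Type*} (w : ι ↪ κ) (t : ι → α) (y : κ → α) {j : κ}
    (h : ∀ i, w i ≠ j) : Function.extend w t y j = y j :=
  Function.extend_apply' _ _ _ fun ⟨i, hi⟩ => h i hi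

theorem extend_comp_of_ne {ι ι' κ α : Type*} (v : ι ↪ κ) (w : ι' → κ)
    (h : ∀ i j, v i ≠ w j) (s : ι → α) (y : κ → α) : Function.extend v s y ∘ w = y ∘ w := by
  funext j
  rw [Function.comp_apply, Function.extend_apply']
  · rfl
  · rintro ⟨i, hi⟩; exact h i j hi

theorem extend_split {a b n : ℕ} (w : Fin (a + b) ↪ Fin n) (t : Bits (a + b)) (y : Bits n) :
    Function.extend w t y =
      Function.extend ((fstWires a b).trans w) (t ∘ fstWires a b)
        (Function.extend ((sndWires a b).trans w) (t ∘ sndWires a b) y) := by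
  funext j
  by_cases h : ∃ i, w i = j
  · obtain ⟨i, rfl⟩ := h
    rw [w.injective.extend_apply]
    refine Fin.addCases (fun i => ?_) (fun i => ?_) i
    · exact (extend_at ((fstWires a b).trans w) (t ∘ fstWires a b) _ i).symm
    · rw [Function.extend_apply']
      · exact (extend_at ((sndWires a b).trans w) (t ∘ sndWires a b) _ i).symm
      · rintro ⟨j, hj⟩; exact fstWires_ne_sndWires _ _ (w.injective hj)
  · rw [Function.extend_apply' _ _ _ h, Function.extend_apply', Function.extend_apply']
    · rintro ⟨i, hi⟩; exact h ⟨_, hi⟩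
    · rintro ⟨i, hi⟩; exact h ⟨_, hi⟩

theorem extend_extend_comm {a b n : ℕ} (v : Fin a ↪ Fin n) (w : Fin b ↪ Fin n)
    (h : ∀ i j, v i ≠ w j) (s : Bits a) (t : Bits b) (y : Bits n) :
    Function.extend v s (Function.extend w t y) = Function.extend w t (Function.extend v s y) := by
  funext j
  by_cases h1 : ∃ i, v i = j
  · obtain ⟨i, rfl⟩ := h1
    rw [extend_at, extend_off w _ _ fun j => (h i j).symm, extend_at]
  · rw [extend_off v _ _ fun i hi => h1 ⟨i, hi⟩]
    by_cases h2 : ∃ i, w i = j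
    · obtain ⟨i, rfl⟩ := h2
      rw [extend_at, extend_at]
    · rw [extend_off w _ _ fun i hi => h2 ⟨i, hi⟩, extend_off w _ _ fun i hi => h2 ⟨i, hi⟩,
        extend_off v _ _ fun i hi => h1 ⟨i, hi⟩]

theorem load_comm {a b n : ℕ} (v : Fin a ↪ Fin n) (w : Fin b ↪ Fin n)
    (h : ∀ i j, v i ≠ w j) (σ : Op a) (τ : Op b) (ρ : Op n) :
    load v σ (load w τ ρ) = load w τ (load v σ ρ) := by
  ext y z
  simp only [load, Matrix.of_apply, extend_comp_of_ne v w h,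
    extend_comp_of_ne w v fun i j => (h j i).symm, ← Finset.mul_sum]
  rw [mul_left_comm, Finset.sum_comm]
  simp only [extend_extend_comm v w h]

/-- Lets a reduction assemble a ciphertext from two sources: the classical part comes from the
challenger, the quantum part is prepared by the reduction itself. -/
theorem load_tensor_eq {a b n : ℕ} (w : Fin (a + b) ↪ Fin n) (σ : Op a) (τ : Op b) (ρ : Op n) :
    load ((fstWires a b).trans w) σ (load ((sndWires a b).trans w) τ ρ) =
      load w (tensor σ τ) ρ := by
  ext y z
  simp only [load, Matrix.of_apply, tensor_apply]
  have hne : ∀ i j, ((fstWires a b).trans w) i ≠ ((sndWires a b).trans w) j :=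
    fun i j he => fstWires_ne_sndWires _ _ (w.injective he)
  have h1 : ∀ (t : Bits a) (y : Bits n), Function.extend ((fstWires a b).trans w) t y ∘
      ((sndWires a b).trans w) = y ∘ ((sndWires a b).trans w) := fun t y =>
    extend_comp_of_ne _ _ hne t y
  simp only [h1, ← Finset.mul_sum, extend_split w]
  rw [← mul_assoc]
  congr 1
  rw [sum_append fun s t => ρ (Function.extend ((fstWires a b).trans w) s
    (Function.extend ((sndWires a b).trans w) t y)) (Function.extend ((fstWires a b).trans w) s
    (Function.extend ((sndWires a b).trans w) t z))]
  simp only [extend_extend_comm _ _ hne]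

/-! ### Single-qubit gates -/

theorem matAt_mul_apply {n : ℕ} (u : Gate1) (loc : Loc n) (M : Op n) (y z : Bits n) :
    (u.matAt loc * M) y z = ∑ b, u.entry (∀ c ∈ loc.ctrl, y c = true) (y loc.tgt) b *
      M (Function.update y loc.tgt b) z := by
  rw [Matrix.mul_apply]
  have h1 : ∀ x, u.matAt loc y x * M x z = if ∀ i, i ≠ loc.tgt → x i = y i then
      u.entry (∀ c ∈ loc.ctrl, x c = true) (y loc.tgt) (x loc.tgt) * M x z else 0 := fun x => by
    rw [Gate1.matAt_apply, ite_mul, zero_mul]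
    simp only [eq_comm]
  simp only [h1]
  rw [sum_agree]
  simp only [Function.update_self, Gate1.entry, Loc.ctrl_update]

theorem unitary_apply {n : ℕ} (u : Gate1) (loc : Loc n) (ρ : Op n) (y z : Bits n) :
    (Gate.unitary u loc).apply ρ y z = ∑ b, ∑ b',
      u.entry (∀ c ∈ loc.ctrl, y c = true) (y loc.tgt) b *
      star (u.entry (∀ c ∈ loc.ctrl, z c = true) (z loc.tgt) b') *
      ρ (Function.update y loc.tgt b) (Function.update z loc.tgt b') := by
  have h : ∀ (M : Op n), (M * (u.matAt loc).conjTranspose) y z =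
      star ((u.matAt loc * M.conjTranspose) z y) := fun M => by
    rw [← Matrix.conjTranspose_apply, Matrix.conjTranspose_mul, Matrix.conjTranspose_conjTranspose]
  simp only [Gate.apply, h]
  rw [matAt_mul_apply, star_sum, Finset.sum_comm]
  refine Finset.sum_congr rfl fun b' _ => ?_
  rw [star_mul', Matrix.conjTranspose_apply, star_star, matAt_mul_apply, Finset.mul_sum]
  refine Finset.sum_congr rfl fun b _ => ?_
  ring

/-- A location without controls. -/
def Loc.free {n : ℕ} (i : Fin n) : Loc n := ⟨∅, i, by simp, by simp⟩

theorem unitary_load_wire {n : ℕ} (u : Gate1) (i : Fin n) (v : Bits 1 → ℂ) (ρ : Op n) :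
    (Gate.unitary u (Loc.free i)).apply (load (wire i) (ketbra v) ρ) =
      load (wire i) (ketbra fun s => ∑ b, u.mat (s 0) b * v fun _ => b) ρ := by
  ext y z
  rw [unitary_apply]
  have h1 : ∀ (y : Bits n) b, Function.update y i b ∘ wire i = fun _ => b := fun y b => by
    funext j; exact Function.update_self i b y
  have h2 : ∀ (y : Bits n) b t, Function.extend (wire i) t (Function.update y i b) =
      Function.extend (wire i) t y := fun y b t => by
    simp [extend_wire]
  have h3 : ∀ (y : Bits n), (y ∘ wire i) 0 = y i := fun _ => rfl
  simp only [Loc.free, load, Matrix.of_apply, h1, h2, ketbra, Matrix.vecMulVec_apply,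
    Pi.star_apply, h3, star_sum, star_mul']
  rw [Finset.sum_mul_sum, Finset.sum_mul]
  refine Finset.sum_congr rfl fun b _ => ?_
  rw [Finset.sum_mul]
  refine Finset.sum_congr rfl fun b' _ => ?_
  simp [Gate1.entry]
  ring

/-- The concatenation of circuits that are indexed by `Fin k`. -/
def sweep {α : Type*} {k : ℕ} (C : Fin k → List α) : List α := (List.ofFn C).flatten

theorem sweep_zero {α : Type*} (C : Fin 0 → List α) : sweep C = [] := by simp [sweep]

theorem sweep_succ {α : Type*} {k : ℕ} (C : Fin (k + 1) → List α) :
    sweep C = sweep (fun i => C i.castSucc) ++ C (Fin.last k) := by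
  rw [sweep, List.ofFn_succ', List.concat_eq_append, List.flatten_append]
  simp [sweep]

theorem length_sweep_le {α : Type*} {k m : ℕ} (C : Fin k → List α) (h : ∀ i, (C i).length ≤ m) :
    (sweep C).length ≤ k * m := by
  induction k with
  | zero => simp [sweep_zero]
  | succ k ih =>
    rw [sweep_succ, List.length_append]
    have := ih (fun i => C i.castSucc) fun i => h _
    have := h (Fin.last k)
    linarith

/-! ### Preparation of BB84 states. -/

/-- Prepare one qubit in the state `|x⟩_θ`. -/
def prepBit {n : ℕ} (i : Fin n) (x θ : Bool) : List (Gate n) :=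
  Gate.reset i :: ((if x then [Gate.unitary .X (Loc.free i)] else []) ++
    if θ then [Gate.unitary .H (Loc.free i)] else [])

/-- Prepare the state `|x⟩_θ` on the wires `w`. -/
def prep {n k : ℕ} (w : Fin k → Fin n) (x θ : Bits k) : List (Gate n) :=
  sweep fun i => prepBit (w i) (x i) (θ i)

theorem length_prep_le {n k : ℕ} (w : Fin k → Fin n) (x θ : Bits k) :
    (prep w x θ).length ≤ k * 3 :=
  length_sweep_le _ fun i => by
    simp only [prepBit, List.length_cons, List.length_append]
    split_ifs <;> simp

theorem applyCircuit_prepBit {n : ℕ} (i : Fin n) (x θ : Bool) (ρ : Op n) :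
    applyCircuit (prepBit i x θ) ρ =
      load (wire i) (ketbra (bb84 (fun _ => x) fun _ => θ)) ρ := by
  have h0 : (Gate.reset i).apply ρ = load (wire i) (ketbra (Pi.single (fun _ => false) 1)) ρ := by
    simp only [Gate.apply, writeBit_eq_write, write, basisOp_eq_vecMulVec, ketbra]
  have h1 : ∀ (v v' : Bits 1 → ℂ), (∀ b, v (fun _ => b) = v' fun _ => b) → v = v' :=
    fun v v' h => funext fun s => by
      have : s = fun _ => s 0 := funext fun j => by rw [Subsingleton.elim j 0]
      rw [this]; exact h _
  have h3 : ∀ b : Bool, ((fun _ : Fin 1 => b) = fun _ => false) ↔ b = false := fun b =>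
    ⟨fun h => congrFun h 0, fun h => by rw [h]⟩
  rw [prepBit, applyCircuit_cons, h0, applyCircuit_append]
  cases x <;> cases θ <;>
    simp only [if_true, if_false, applyCircuit_nil, applyCircuit_cons, unitary_load_wire,
      Bool.false_eq_true] <;> congr 2 <;> refine h1 _ _ fun b => ?_ <;> cases b <;>
    simp [bb84, Gate1.mat, Pi.single_apply, h3]

theorem bb84_succ {k : ℕ} (x θ z : Bits (k + 1)) :
    bb84 x θ z = bb84 (x ∘ Fin.castSucc) (θ ∘ Fin.castSucc) (z ∘ Fin.castSucc) *
      bb84 (fun _ : Fin 1 => x (Fin.last k)) (fun _ => θ (Fin.last k))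
        (fun _ => z (Fin.last k)) := by
  simp only [bb84, Fin.prod_univ_castSucc]
  simp

theorem ketbra_bb84_succ {k : ℕ} (x θ : Bits (k + 1)) :
    ketbra (bb84 x θ) = tensor (ketbra (bb84 (x ∘ Fin.castSucc) (θ ∘ Fin.castSucc)))
      (ketbra (bb84 (fun _ : Fin 1 => x (Fin.last k)) fun _ => θ (Fin.last k))) := by
  ext y z
  have h : ∀ y : Bits (k + 1), y ∘ sndWires k 1 = fun _ => y (Fin.last k) := fun y => by
    funext j
    rw [Subsingleton.elim j 0]; rfl
  rw [tensor_apply, h, h]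
  simp only [ketbra, Matrix.vecMulVec_apply, Pi.star_apply]
  rw [bb84_succ x θ y, bb84_succ x θ z, star_mul']
  have h' : ∀ y : Bits (k + 1), y ∘ fstWires k 1 = y ∘ Fin.castSucc := fun y => rfl
  rw [h', h']; ring

theorem applyCircuit_prep {n k : ℕ} (w : Fin k ↪ Fin n) (x θ : Bits k) (ρ : Op n) :
    applyCircuit (prep w x θ) ρ = load w (ketbra (bb84 x θ)) ρ := by
  induction k with
  | zero =>
    ext y z
    have : ∀ (t : Bits 0) (y : Bits n), Function.extend w t y = y := fun t y => by
      funext j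
      rw [Function.extend_apply']
      rintro ⟨i, _⟩; exact i.elim0
    simp [prep, sweep_zero, applyCircuit_nil, load, ketbra, Matrix.vecMulVec_apply, bb84, this]
  | succ k ih =>
    rw [prep, sweep_succ, applyCircuit_append, applyCircuit_prepBit]
    have := ih ((fstWires k 1).trans w) (x ∘ Fin.castSucc) (θ ∘ Fin.castSucc)
    simp only [prep] at this
    erw [this]
    rw [ketbra_bb84_succ x θ, ← load_tensor_eq w]
    have hw : (sndWires k 1).trans w = wire (w (Fin.last k)) := by
      ext j
      rw [Subsingleton.elim j 0]; rfl
    rw [hw, load_comm]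
    intro i j he
    exact (Fin.castSucc_lt_last j).ne' (w.injective he)

/-! ### Classical circuits as quantum circuits -/

/-- The quantum circuit of a classical circuit. -/
def quantum {n : ℕ} (C : List (Loc n)) : List (Gate n) := C.map (Gate.unitary .X)

theorem applyClassical_cons {n : ℕ} (g : Loc n) (C : List (Loc n)) (y : Bits n) :
    applyClassical (g :: C) y = applyClassical C (g.flip y) := rfl

theorem applyClassical_nil {n : ℕ} (y : Bits n) : applyClassical [] y = y := rfl

theorem applyClassical_append {n : ℕ} (C D : List (Loc n)) (y : Bits n) :
    applyClassical (C ++ D) y = applyClassical D (applyClassical C y) := by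
  simp [applyClassical, List.foldl_append]

theorem Loc.flip_flip {n : ℕ} (g : Loc n) (y : Bits n) : g.flip (g.flip y) = y := by
  by_cases h : ∀ c ∈ g.ctrl, y c = true
  · have h1 : g.flip y = Function.update y g.tgt (!y g.tgt) := if_pos h
    rw [h1, Loc.flip, if_pos ((g.ctrl_update y _).mpr h)]
    simp
  · have h1 : g.flip y = y := if_neg h
    rw [h1, h1]

/-- A controlled NOT is a real permutation matrix for the involution `flip`, so conjugation by it
only relabels rows and columns. -/
theorem unitary_X_apply {n : ℕ} (g : Loc n) (ρ : Op n) (y z : Bits n) :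
    (Gate.unitary .X g).apply ρ y z = ρ (g.flip y) (g.flip z) := by
  rw [unitary_apply]
  have h : ∀ (y : Bits n) (f : Bits n → ℂ), ∑ b, Gate1.X.entry (∀ c ∈ g.ctrl, y c = true)
      (y g.tgt) b * f (Function.update y g.tgt b) = f (g.flip y) := fun y f => by
    by_cases hc : ∀ c ∈ g.ctrl, y c = true
    · rw [Loc.flip, if_pos hc]
      simp only [Gate1.entry, if_pos hc, Gate1.mat, Matrix.of_apply]
      cases y g.tgt <;> simp
    · rw [Loc.flip, if_neg hc]
      simp only [Gate1.entry, if_neg hc]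
      simp
  have hs : ∀ (p : Prop) [Decidable p] a b, star (Gate1.X.entry p a b) = Gate1.X.entry p a b := by
    intro p _ a b
    simp only [Gate1.entry, Gate1.mat, Matrix.of_apply]
    split_ifs <;> simp
  simp only [hs, mul_assoc, ← Finset.mul_sum]
  simp only [h z, h y fun x => ρ x (g.flip z)]

/-- The operator `|P⟩⟨Q|`. -/
abbrev dyad {n : ℕ} (P Q : Bits n) : Op n := Matrix.single P Q 1

theorem dyad_apply {n : ℕ} (P Q y z : Bits n) :
    dyad P Q y z = if P = y ∧ Q = z then 1 else 0 := rfl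

theorem applyCircuit_quantum_dyad {n : ℕ} (C : List (Loc n)) (P Q : Bits n) :
    applyCircuit (quantum C) (dyad P Q) = dyad (applyClassical C P) (applyClassical C Q) := by
  induction C generalizing P Q with
  | nil => rfl
  | cons g C ih =>
    rw [quantum, List.map_cons, applyCircuit_cons, applyClassical_cons, applyClassical_cons]
    have : (Gate.unitary .X g).apply (dyad P Q) = dyad (g.flip P) (g.flip Q) := by
      ext y z
      rw [unitary_X_apply, dyad_apply, dyad_apply]
      have h : ∀ P y : Bits n, P = g.flip y ↔ g.flip P = y := fun P y =>
        ⟨fun h => by rw [h, g.flip_flip], fun h => by rw [← h, g.flip_flip]⟩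
      simp only [h]
    rw [this]; exact ih _ _

/-- The circuit is moved from the state to the observable `f`: each gate permutes the basis by an
involution, and the diagonal sum is reindexed by it. -/
theorem sum_diag_quantum {n : ℕ} (C : List (Loc n)) (ρ : Op n) (f : Bits n → ℝ) :
    ∑ y, f y * (applyCircuit (quantum C) ρ y y).re = ∑ y, f (applyClassical C y) * (ρ y y).re := by
  induction C generalizing ρ with
  | nil => rfl
  | cons g C ih =>
    rw [quantum, List.map_cons, applyCircuit_cons]
    refine (ih _).trans ?_
    simp only [unitary_X_apply, applyClassical_cons]
    refine Fintype.sum_equiv (Function.Involutive.toPerm g.flip g.flip_flip) _ _ fun y => ?_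
    change _ = f (applyClassical C (g.flip (g.flip y))) * _
    rw [g.flip_flip]; rfl

/-- NOT controlled by the wire `a`. -/
def Loc.cnot {n : ℕ} (a t : Fin n) : Loc n where
  ctrl := Finset.erase {a} t
  tgt := t
  card_le := (Finset.card_le_card (Finset.erase_subset _ _)).trans (by simp)
  notMem := by simp

/-- NOT controlled by the wires `a` and `b`. -/
def Loc.toffoli {n : ℕ} (a b t : Fin n) : Loc n where
  ctrl := Finset.erase {a, b} t
  tgt := t
  card_le := (Finset.card_le_card (Finset.erase_subset _ _)).trans Finset.card_le_two
  notMem := by simp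

theorem Loc.flip_free {n : ℕ} (t : Fin n) (y : Bits n) :
    (Loc.free t).flip y = Function.update y t (!y t) := by
  simp [Loc.flip, Loc.free]

/-- For `a ≠ t` the erasure of `t` from the controls, which makes `Loc.cnot` total, removes nothing.
-/
theorem Loc.flip_cnot {n : ℕ} {a t : Fin n} (h : a ≠ t) (y : Bits n) :
    (Loc.cnot a t).flip y = Function.update y t (y t ^^ y a) := by
  have h1 : (∀ c ∈ (Loc.cnot a t).ctrl, y c = true) ↔ y a = true := by
    simp only [Loc.cnot, Finset.erase_eq_of_notMem (show t ∉ ({a} : Finset (Fin n)) by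
      simpa using h.symm)]
    simp
  simp only [Loc.flip, h1]
  cases ha : y a <;> simp [Loc.cnot]

theorem Loc.flip_toffoli {n : ℕ} {a b t : Fin n} (ha : a ≠ t) (hb : b ≠ t) (y : Bits n) :
    (Loc.toffoli a b t).flip y = Function.update y t (y t ^^ (y a && y b)) := by
  have h1 : (∀ c ∈ (Loc.toffoli a b t).ctrl, y c = true) ↔ (y a && y b) = true := by
    simp only [Loc.toffoli, Finset.erase_eq_of_notMem (show t ∉ ({a, b} : Finset (Fin n)) by
      simp [ha.symm, hb.symm])]
    simp
  simp only [Loc.flip, h1]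
  cases hab : (y a && y b) <;> simp [Loc.toffoli]

/-! ### Signs and parity characters. -/

/-- `-1` for `true` and `1` for `false`. -/
def sgn (b : Bool) : ℝ := if b then -1 else 1

theorem sgn_xor (a b : Bool) : sgn (a ^^ b) = sgn a * sgn b := by
  cases a <;> cases b <;> simp [sgn]

theorem sgn_injective : Function.Injective sgn := by
  intro a b h
  cases a <;> cases b <;> simp [sgn] at h ⊢ <;> norm_num at h

theorem abs_sgn (b : Bool) : |sgn b| = 1 := by cases b <;> simp [sgn]

/-- The parity character `t ↦ (-1) ^ (S · t)`. -/
def chi {k : ℕ} (S t : Bits k) : ℝ := ∏ i, sgn (S i && t i)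

/-- The sign of the mask is a product over positions, so that signed sums over `x` factor qubit by
qubit. -/
theorem sgn_parity {k : ℕ} (x θ : Bits k) : sgn (parity x θ) = ∏ i, sgn (!θ i && x i) := by
  rw [parity]
  have h : ∀ m : ℕ, sgn (decide (Odd m)) = (-1) ^ m := fun m => by
    by_cases hm : Odd m
    · simp [sgn, hm, hm.neg_one_pow]
    · simp [sgn, hm, (Nat.not_odd_iff_even.mp hm).neg_one_pow]
  rw [h, ← Finset.prod_const, Finset.prod_filter]
  refine Finset.prod_congr rfl fun i _ => ?_
  cases θ i <;> cases x i <;> simp [sgn]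

/-- A sequence of circuits, each of which flips the wire `t` according to a function of the wires
other than `t`. -/
theorem applyClassical_sweep_flip {n k : ℕ} (t : Fin n) (C : Fin k → List (Loc n))
    (f : Fin k → Bits n → Bool)
    (hC : ∀ i y, applyClassical (C i) y = Function.update y t (y t ^^ f i y))
    (hf : ∀ i y b, f i (Function.update y t b) = f i y) (y : Bits n) :
    ∃ b, applyClassical (sweep C) y = Function.update y t b ∧
      sgn b = sgn (y t) * ∏ i, sgn (f i y) := by
  induction k with
  | zero => exact ⟨y t, by simp [sweep_zero, applyClassical_nil]⟩
  | succ k ih =>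
    obtain ⟨b, hb, hs⟩ := ih (fun i => C i.castSucc) (fun i => f i.castSucc) (fun i => hC _)
      fun i => hf _
    refine ⟨b ^^ f (Fin.last k) y, ?_, ?_⟩
    · rw [sweep_succ, applyClassical_append, hb, hC, hf]
      simp
    · rw [sgn_xor, hs, Fin.prod_univ_castSucc, mul_assoc]

/-- Compute a parity of the wires `w` into the wire `t`. -/
def parityCircuit {n k : ℕ} (w : Fin k → Fin n) (t : Fin n) (S : Bits k) : List (Loc n) :=
  sweep fun i => if S i then [Loc.cnot (w i) t] else []

theorem length_parityCircuit_le {n k : ℕ} (w : Fin k → Fin n) (t : Fin n) (S : Bits k) :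
    (parityCircuit w t S).length ≤ k * 1 :=
  length_sweep_le _ fun i => by split_ifs <;> simp

theorem applyClassical_parityCircuit {n k : ℕ} (w : Fin k → Fin n) (t : Fin n)
    (hw : ∀ i, w i ≠ t) (S : Bits k) (y : Bits n) :
    sgn (applyClassical (parityCircuit w t S) y t) = sgn (y t) * chi S (y ∘ w) := by
  obtain ⟨b, hb, hs⟩ := applyClassical_sweep_flip t
    (fun i => if S i then [Loc.cnot (w i) t] else []) (fun i y => S i && y (w i))
    (fun i y => by
      cases hS : S i
      · simp [applyClassical_nil]
      · simp [applyClassical_cons, applyClassical_nil, Loc.flip_cnot (hw i)])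
    (fun i y b => by rw [Function.update_of_ne (hw i)]) y
  rw [parityCircuit, hb, Function.update_self, hs, chi]
  rfl

theorem probOne_eq {n : ℕ} (i : Fin n) (ρ : Op n) :
    probOne i ρ = ∑ y, (1 - sgn (y i)) / 2 * (ρ y y).re := by
  rw [probOne, trace_projectBit, Complex.re_sum]
  refine Finset.sum_congr rfl fun y _ => ?_
  cases y i <;> simp [sgn]

/-- Summing a function of measurement outcomes. -/
theorem sum_mul_rtr_project {n k : ℕ} (w : Fin k → Fin n) (f : Bits k → ℝ) (ρ : Op n) :
    ∑ t, f t * rtr (project w t ρ) = ∑ y, f (y ∘ w) * (ρ y y).re := by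
  simp only [rtr_project, Finset.mul_sum]
  rw [Finset.sum_comm]
  refine Finset.sum_congr rfl fun y _ => ?_
  simp

/-- The output bit `s` has indicator `(1 - (-1)^s)/2`, so the output probability is affine in one
Fourier coefficient of the distribution of the measured string. -/
theorem probOne_parityCircuit {a b k : ℕ} (w : Fin k ↪ Fin a) (j : Fin b) (S : Bits k) (ρ : Op a)
    (s : Bits b) (hs : s j = false) :
    probOne (sndWires a b j) (applyCircuit
      (quantum (parityCircuit (w.trans (fstWires a b)) (sndWires a b j) S))
        (tensor ρ (basisOp s))) = ∑ t, (1 - chi S t) / 2 * rtr (project w t ρ) := by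
  rw [probOne_eq, sum_diag_quantum _ _ fun y => (1 - sgn (y (sndWires a b j))) / 2]
  simp only [applyClassical_parityCircuit (w.trans (fstWires a b)) (sndWires a b j)
    (fun i => fstWires_ne_sndWires _ _), sum_mul_rtr_project w fun t => (1 - chi S t) / 2,
    tensor_apply]
  refine (sum_append fun y z => (1 - sgn (z j) * chi S (y ∘ w)) / 2 *
    (ρ y y * basisOp s z z).re).trans ?_
  refine Finset.sum_congr rfl fun y _ => ?_
  rw [Finset.sum_eq_single s]
  · simp [basisOp, hs, sgn]
  · intro z _ hz
    simp [basisOp, hz.symm]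
  · simp

theorem probOne_tensor {a b : ℕ} (i : Fin a) (ρ : Op a) (s : Bits b) :
    probOne (fstWires a b i) (tensor ρ (basisOp s)) = probOne i ρ := by
  rw [probOne, probOne]
  have : projectBit (fstWires a b i) true (tensor ρ (basisOp s)) =
    tensor (projectBit i true ρ) (basisOp s) := project_tensor _ _ _ _
  rw [this, trace_tensor, trace_basisOp, mul_one]

/-! ### Measurement of a whole family of wires. -/

/-- Measure the wires `w`. -/
def measureAll {n k : ℕ} (w : Fin k → Fin n) : List (Gate n) := sweep fun i => [Gate.measure (w i)]

theorem applyCircuit_measureAll_apply {n k : ℕ} (w : Fin k → Fin n) (ρ : Op n) (y z : Bits n) :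
    applyCircuit (measureAll w) ρ y z = if y ∘ w = z ∘ w then ρ y z else 0 := by
  induction k with
  | zero =>
    rw [if_pos (Subsingleton.elim _ _), measureAll, sweep_zero, applyCircuit_nil]
  | succ k ih =>
    rw [measureAll, sweep_succ, applyCircuit_append, applyCircuit_cons, applyCircuit_nil]
    have := ih fun i => w i.castSucc
    simp only [measureAll] at this
    have h1 : ∀ σ : Op n, (Gate.measure (w (Fin.last k))).apply σ y z =
        if y (w (Fin.last k)) = z (w (Fin.last k)) then σ y z else 0 := fun σ => by
      have h2 : ∀ (y : Bits n) b, (y ∘ (fun _ : Unit => w (Fin.last k)) = fun _ => b) ↔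
          y (w (Fin.last k)) = b := fun y b =>
        ⟨fun h => congrFun h (), fun h => funext fun _ => h⟩
      simp only [Gate.apply, Matrix.add_apply, projectBit, project, Matrix.of_apply, h2]
      cases y (w (Fin.last k)) <;> cases z (w (Fin.last k)) <;> simp
    rw [h1, this, ← ite_and]
    congr 1
    refine propext ⟨fun ⟨h, h'⟩ => ?_, fun h => ⟨congrFun h _, funext fun i => congrFun h i.castSucc⟩⟩
    funext i
    refine Fin.lastCases h (fun i => congrFun h' i) i

theorem applyCircuit_measureAll {n k : ℕ} (w : Fin k → Fin n) (ρ : Op n) :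
    applyCircuit (measureAll w) ρ = ∑ t, project w t ρ := by
  ext y z
  rw [applyCircuit_measureAll_apply, Matrix.sum_apply, Finset.sum_eq_single (y ∘ w)]
  · simp only [project, Matrix.of_apply, true_and, eq_comm]
  · intro t _ ht
    simp [project, ht.symm]
  · simp

/-! ### The experiments in terms of the classical challenge ciphertext -/

namespace KeySystem

variable (K : KeySystem) (k : ℕ) (msk : Bits (K.mskLen k)) (allow : ∀ d, Bits d → Bool) {n : ℕ}

theorem run_sum {ι : Type} [Fintype ι] (is : List (Instr (K.skLen k) n))
    (h : List (Σ d, Bits d)) (ρ : Op n) (c : ι → ℝ) (F : ι → List (Σ d, Bits d) → Op n → ℝ) :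
    (K.run k msk allow is h ρ fun h ρ => ∑ i, c i * F i h ρ) =
      ∑ i, c i * K.run k msk allow is h ρ (F i) := by
  have h1 : IsLinearMap ℝ fun v : ι → ℝ => ∑ i, c i * v i :=
    ⟨fun v w => by simp [mul_add, Finset.sum_add_distrib],
      fun r v => by simp [Finset.mul_sum, mul_left_comm]⟩
  -- The whole family is run once with values in `ι → ℝ`; both sides are linear images of this
  -- single run.
  rw [← K.run_map k msk allow h1 is h ρ fun h ρ i => F i h ρ]
  refine Finset.sum_congr rfl fun i _ => ?_
  have h2 : IsLinearMap ℝ fun v : ι → ℝ => v i := ⟨fun _ _ => rfl, fun _ _ => rfl⟩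
  rw [K.run_map k msk allow h2]

theorem run_add (is : List (Instr (K.skLen k) n))
    (h : List (Σ d, Bits d)) (ρ : Op n) (F G : List (Σ d, Bits d) → Op n → ℝ) :
    (K.run k msk allow is h ρ fun h ρ => F h ρ + G h ρ) =
      K.run k msk allow is h ρ F + K.run k msk allow is h ρ G := by
  have := K.run_sum k msk allow is h ρ (fun _ : Bool => 1) fun b => if b then F else G
  simpa using this

end KeySystem

theorem avg_sum {ι : Type} [Fintype ι] {r : ℕ} (c : ι → ℝ) (F : ι → Bits r → ℝ) :
    (avg fun s => ∑ i, c i * F i s) = ∑ i, c i * avg (F i) := by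
  simp only [avg, smul_eq_mul, Finset.mul_sum]
  rw [Finset.sum_comm]
  exact Finset.sum_congr rfl fun i _ => Finset.sum_congr rfl fun s _ => by ring

theorem avg_add {r : ℕ} (F G : Bits r → ℝ) : (avg fun s => F s + G s) = avg F + avg G := by
  simp only [avg, smul_eq_mul, Finset.sum_add_distrib, mul_add]

/-- The check of the certificate `t`. -/
def accepts {k : ℕ} (x θ t : Bits k) : Bool := decide (∀ i, θ i = true → x i = t i)

namespace ABE

/-- The adversaries of the deletion experiments for `E.withDeletion`, with types in terms of `E`. -/
structure Attacker (E : ABE fun k => k + 1) (k : ℕ) where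
  n : ℕ
  advice : Bits n → ℂ
  advice_norm : ∑ s, ‖advice s‖ ^ 2 = 1
  pk : Fin (E.pkLen k) ↪ Fin n
  pre : List (Instr (E.skLen k) n)
  attr : Fin (E.attrLen k) ↪ Fin n
  ct : Fin (k + E.ctLen k) ↪ Fin n
  mid : List (Instr (E.skLen k) n)
  cert : Fin k ↪ Fin n
  res : Fin n
  post : List (Instr (E.skLen k) n)
  out : Fin n

abbrev Attacker.toAdversary {E : ABE fun k => k + 1} {k : ℕ} (A : E.Attacker k) :
    E.withDeletion.Adversary k where
  n := A.n
  advice := A.advice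
  advice_norm := A.advice_norm
  pk := A.pk
  pre := A.pre
  attr := A.attr
  ct := A.ct
  mid := A.mid
  cert := A.cert
  res := A.res
  post := A.post
  out := A.out

def Attacker.size {E : ABE fun k => k + 1} {k : ℕ} (A : E.Attacker k) : ℕ :=
  A.n + A.pre.length + A.mid.length + A.post.length

variable (E : ABE fun k => k + 1) {k : ℕ} (A : E.Attacker k)

/-- The adversary of the deletion experiments receives the quantum part `σ` and an encryption of
`m`; if the experiment does not exit, `g` is applied at the end of the second phase. -/
def branch (m : Bits (k + 1)) (σ : Op k)
    (g : Bits (E.mskLen k) → Bits (E.attrLen k) → Op A.n → ℝ) : ℝ :=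
  avg fun c : Bits (E.genCoins k) =>
    E.run k (E.gen k c).2 (fun _ _ => true) A.pre [] (write A.pk (E.gen k c).1 (ketbra A.advice))
      fun h ρ => ∑ X : Bits (E.attrLen k),
        if ∀ q ∈ h, E.eval k q.1 q.2 X = false then
          avg fun c' : Bits (E.encCoins k) =>
            E.run k (E.gen k c).2 (fun d P => !E.eval k d P X) A.mid []
              (load A.ct (tensor σ (basisOp (E.enc k c' (E.gen k c).1 X m)))
                (project A.attr X ρ)) fun _ ρ' => g (E.gen k c).2 X ρ'
        else 0

/-- The contribution of the exit at the challenge. -/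
def exitPart (bot : Op A.n → ℝ) : ℝ :=
  avg fun c : Bits (E.genCoins k) =>
    E.run k (E.gen k c).2 (fun _ _ => true) A.pre [] (write A.pk (E.gen k c).1 (ketbra A.advice))
      fun h ρ => ∑ X : Bits (E.attrLen k),
        if ∀ q ∈ h, E.eval k q.1 q.2 X = false then 0 else bot (project A.attr X ρ)

/-- An exit happens before the challenge ciphertext exists, so its contribution is independent of
`b`. In the other runs the key `(x, θ)` is uniform and the ciphertext enters linearly, which turns
the experiment into an average of branches. -/
theorem deletionGame_eq (b : Bool) (bot : Op A.n → ℝ)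
    {final : Bits (E.mskLen k) → Bits (E.attrLen k) → Bool → Op A.n → ℝ}
    (hf : ∀ msk X v, IsLinearMap ℝ (final msk X v)) :
    E.withDeletion.deletionGame k A.toAdversary b bot final = E.exitPart A bot +
      ∑ p : Bits k × Bits k, ((2 : ℝ) ^ (k + k))⁻¹ *
        E.branch A (plaintext p.2 (b ^^ parity p.1 p.2)) (ketbra (bb84 p.1 p.2))
          fun msk X ρ => ∑ t, final msk X (accepts p.1 p.2 t) (project A.cert t ρ) := by
  rw [exitPart]
  simp only [branch]
  rw [← avg_sum, ← avg_add]
  refine congrArg avg (funext fun c => ?_)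
  -- The scheme is unfolded, the halves of the verification key being read as `x` and `θ`.
  change E.run k (E.gen k c).2 (fun _ _ => true) A.pre []
    (write A.pk (E.gen k c).1 (ketbra A.advice)) (fun h ρ => ∑ X : Bits (E.attrLen k),
      if ∀ q ∈ h, E.eval k q.1 q.2 X = false then
        ∑ vk : Bits (k + k), E.run k (E.gen k c).2 (fun d P => !E.eval k d P X) A.mid []
          (load A.ct (((2 : ℝ) ^ (k + k))⁻¹ • avg fun c' : Bits (E.encCoins k) =>
            tensor (ketbra (bb84 (vk ∘ fstWires k k) (vk ∘ sndWires k k)))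
              (basisOp (E.enc k c' (E.gen k c).1 X (plaintext (vk ∘ sndWires k k)
                (b ^^ parity (vk ∘ fstWires k k) (vk ∘ sndWires k k))))))
            (project A.attr X ρ)) fun _ ρ' => ∑ t : Bits k, final (E.gen k c).2 X
              (accepts (vk ∘ fstWires k k) (vk ∘ sndWires k k) t) (project A.cert t ρ')
      else bot (project A.attr X ρ)) = _
  rw [← KeySystem.run_sum, ← KeySystem.run_add]
  refine congrArg (KeySystem.run _ _ _ _ _ _ _) (funext fun h => funext fun ρ => ?_)
  simp only [Finset.mul_sum]
  rw [Finset.sum_comm, ← Finset.sum_add_distrib]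
  refine Finset.sum_congr rfl fun X _ => ?_
  by_cases hX : ∀ q ∈ h, E.eval k q.1 q.2 X = false
  · simp only [if_pos hX, zero_add]
    rw [Fintype.sum_prod_type]
    rw [← sum_append (a := k) (b := k)]
    refine Finset.sum_congr rfl fun vk _ => ?_
    have hlin : IsLinearMap ℝ fun σ : Op (k + E.ctLen k) =>
        E.run k (E.gen k c).2 (fun d P => !E.eval k d P X) A.mid []
          (load A.ct σ (project A.attr X ρ)) fun _ ρ' => ∑ t, final (E.gen k c).2 X
            (accepts (vk ∘ fstWires k k) (vk ∘ sndWires k k) t) (project A.cert t ρ') := by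
      refine IsLinearMap.comp' (E.isLinearMap_run k _ _ A.mid [] fun _ => ?_)
        (isLinearMap_real_of_complex (isLinearMap_load_left A.ct (project A.attr X ρ)))
      exact isLinearMap_sum _ fun t => IsLinearMap.comp' (hf _ _ _)
        (isLinearMap_real_of_complex (isLinearMap_project _ _))
    refine (hlin.map_smul _ _).trans ?_
    rw [map_avg hlin]
    rfl
  · simp only [if_neg hX, mul_zero, Finset.sum_const_zero, add_zero]

theorem branch_sum {ι : Type} [Fintype ι] (m : Bits (k + 1)) (σ : Op k) (c : ι → ℝ)
    (g : ι → Bits (E.mskLen k) → Bits (E.attrLen k) → Op A.n → ℝ) :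
    (E.branch A m σ fun msk X ρ => ∑ i, c i * g i msk X ρ) = ∑ i, c i * E.branch A m σ (g i) := by
  simp only [branch]
  rw [← avg_sum]
  refine congrArg avg (funext fun c => ?_)
  rw [← KeySystem.run_sum]
  refine congrArg (KeySystem.run _ _ _ _ _ _ _) (funext fun h => funext fun ρ => ?_)
  simp only [Finset.mul_sum]
  rw [Finset.sum_comm]
  refine Finset.sum_congr rfl fun X _ => ?_
  split_ifs
  · rw [← avg_sum]
    refine congrArg avg (funext fun c => ?_)
    rw [← KeySystem.run_sum]
  · simp

/-! ### The reduction -/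

theorem basisOp_apply {n : ℕ} (s y z : Bits n) :
    basisOp s y z = if s = y ∧ s = z then 1 else 0 := rfl

theorem ketbra_tensor_basis {a b : ℕ} (φ : Bits a → ℂ) (s : Bits b) :
    ketbra (fun y : Bits (a + b) => φ (y ∘ fstWires a b) *
      (Pi.single s 1 : Bits b → ℂ) (y ∘ sndWires a b)) = tensor (ketbra φ) (basisOp s) := by
  rw [basisOp_eq_vecMulVec]
  ext y z
  rw [tensor_apply]
  simp only [ketbra, Matrix.vecMulVec_apply, Pi.star_apply, star_mul']
  ring

theorem project_basisOp {ι : Type} [Fintype ι] [DecidableEq ι] {n : ℕ} (w : ι → Fin n)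
    (t : ι → Bool) (s : Bits n) :
    project w t (basisOp s) = if s ∘ w = t then basisOp s else 0 := by
  ext y z
  have h : ∀ M : Op n, project w t M y z = if y ∘ w = t ∧ z ∘ w = t then M y z else 0 :=
    fun _ => rfl
  rw [h]
  by_cases hs : s ∘ w = t
  · rw [if_pos hs, basisOp_apply]
    split_ifs with h1 h2 h2
    · rfl
    · rfl
    · exact absurd ⟨by rw [← h2.1]; exact hs, by rw [← h2.2]; exact hs⟩ h1
    · rfl
  · rw [if_neg hs, basisOp_apply]
    split_ifs with h1 h2
    · exact absurd (by rw [h2.1]; exact h1.1) hs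
    all_goals rfl

/-- The adversary of the semantic security game that runs an adversary of the deletion
experiments on the quantum part `|x⟩_θ`. Its additional wires are initialized to `s`; the challenge
messages are on the additional wires `v₀` and `v₁`. -/
def reduction {e : ℕ} (s : Bits e) (v₀ v₁ : Fin (k + 1) ↪ Fin e) (x θ : Bits k)
    (tail : List (Instr (E.skLen k) (A.n + e))) (out : Fin (A.n + e)) : E.Adversary k where
  n := A.n + e
  advice y := A.advice (y ∘ fstWires A.n e) * (Pi.single s 1 : Bits e → ℂ) (y ∘ sndWires A.n e)
  advice_norm := by
    simp only [norm_mul, mul_pow]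
    refine (sum_append fun y t => ‖A.advice y‖ ^ 2 *
      ‖(Pi.single s 1 : Bits e → ℂ) t‖ ^ 2).trans ?_
    rw [← Finset.sum_mul_sum, A.advice_norm, one_mul, Finset.sum_eq_single s]
    · simp
    · intro t _ ht; simp [ht]
    · simp
  pk := A.pk.trans (fstWires A.n e)
  pre := A.pre.map (Instr.map (fstWires A.n e))
  attr := A.attr.trans (fstWires A.n e)
  msg₀ := v₀.trans (sndWires A.n e)
  msg₁ := v₁.trans (sndWires A.n e)
  -- The challenger fills only the classical part of the ciphertext; the remaining wires of `A.ct`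
  -- are filled by the preparation with which `post` begins.
  ct := ((sndWires k (E.ctLen k)).trans A.ct).trans (fstWires A.n e)
  post := (((prep ((fstWires k (E.ctLen k)).trans A.ct) x θ).map Instr.gate ++ A.mid).map
    (Instr.map (fstWires A.n e))) ++ tail
  out := out

theorem project_tensor_basis {a e m : ℕ} (v : Fin m ↪ Fin e) (s : Bits e) (t : Bits m) (σ : Op a) :
    project (v.trans (sndWires a e)) t (tensor σ (basisOp s)) =
      if t = s ∘ v then tensor σ (basisOp s) else 0 := by
  refine (project_tensor_snd _ _ _ _).trans ?_
  rw [project_basisOp]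
  by_cases h : s ∘ v = t
  · rw [if_pos h, if_pos h.symm]
  · rw [if_neg h, if_neg (Ne.symm h)]
    ext y z; simp [tensor_apply]

theorem game_mk {n : ℕ} (advice : Bits n → ℂ) (hn : ∑ s, ‖advice s‖ ^ 2 = 1)
    (pk : Fin (E.pkLen k) ↪ Fin n) (pre : List (Instr (E.skLen k) n))
    (attr : Fin (E.attrLen k) ↪ Fin n) (msg₀ msg₁ : Fin (k + 1) ↪ Fin n)
    (ct : Fin (E.ctLen k) ↪ Fin n) (post : List (Instr (E.skLen k) n)) (out : Fin n) (b : Bool) :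
    E.game k ⟨n, advice, hn, pk, pre, attr, msg₀, msg₁, ct, post, out⟩ b =
      avg fun c : Bits (E.genCoins k) =>
        E.run k (E.gen k c).2 (fun _ _ => true) pre [] (load pk (basisOp (E.gen k c).1)
          (ketbra advice)) fun h ρ =>
        ∑ X : Bits (E.attrLen k), ∑ m₀' : Bits (k + 1), ∑ m₁' : Bits (k + 1),
          if ∀ q ∈ h, E.eval k q.1 q.2 X = false then
            avg fun c' : Bits (E.encCoins k) =>
              E.run k (E.gen k c).2 (fun d P => !E.eval k d P X) post []
                (load ct (basisOp (E.enc k c' (E.gen k c).1 X (if b then m₁' else m₀')))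
                  (project msg₁ m₁' (project msg₀ m₀' (project attr X ρ))))
                fun _ ρ' => probOne out ρ'
          else 0 := rfl

/-- The message wires carry a basis state, so reading them is deterministic and all other outcomes
leave the zero state. With the prepared quantum part, the embedded adversary sees precisely the
input of a `branch`, and the game bit selects the plaintext. -/
theorem game_reduction {e : ℕ} (s : Bits e) (v₀ v₁ : Fin (k + 1) ↪ Fin e) (x θ : Bits k)
    (tail : List (Instr (E.skLen k) (A.n + e))) (out : Fin (A.n + e)) (b : Bool) :
    E.game k (E.reduction A s v₀ v₁ x θ tail out) b =
      E.branch A (if b then s ∘ v₁ else s ∘ v₀) (ketbra (bb84 x θ)) fun msk X ρ =>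
        E.run k msk (fun d P => !E.eval k d P X) tail [] (tensor ρ (basisOp s))
          fun _ ρ' => probOne out ρ' := by
  rw [reduction, game_mk, branch]
  refine congrArg avg (funext fun c => ?_)
  rw [ketbra_tensor_basis, load_tensor, KeySystem.run_tensor]
  refine congrArg (KeySystem.run _ _ _ _ _ _ _) (funext fun h => funext fun ρ => ?_)
  refine Finset.sum_congr rfl fun X _ => ?_
  have hattr : project (A.attr.trans (fstWires A.n e)) X
      (tensor ρ (basisOp s)) = tensor (project A.attr X ρ) (basisOp s) :=
    project_tensor _ _ _ _
  have hzero : ∀ (t : Bits (E.ctLen k)) (is) (al),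
      E.run k (E.gen k c).2 al is [] (load (((sndWires k (E.ctLen k)).trans A.ct).trans
        (fstWires A.n e)) (basisOp t) 0) (fun _ ρ' => probOne out ρ') = 0 :=
    fun t is al => by
      rw [(isLinearMap_load _ _).map_zero]
      exact (E.isLinearMap_run k _ _ is [] fun _ => (contractive_probOne out).linear).map_zero
  simp only [hattr]
  by_cases hX : ∀ q ∈ h, E.eval k q.1 q.2 X = false
  · simp only [if_pos hX]
    rw [Finset.sum_eq_single (s ∘ v₀), Finset.sum_eq_single (s ∘ v₁)]
    · refine congrArg avg (funext fun c' => ?_)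
      rw [project_tensor_basis, if_pos rfl, project_tensor_basis, if_pos rfl, load_tensor,
        KeySystem.run_append, KeySystem.run_tensor, KeySystem.run_append, KeySystem.run_gates,
        applyCircuit_prep, load_tensor_eq]
      refine congrArg (KeySystem.run _ _ _ _ _ _ _) (funext fun h => funext fun ρ => ?_)
      -- The tail starts with the queries of the embedded adversary already on record, which is
      -- immaterial after the challenge.
      exact KeySystem.run_history _ _ _ _ _ _ _ _ _
    · intro m _ hm
      simp only [project_tensor_basis, if_neg hm, if_pos, hzero, avg_const]
    · simp
    · intro m _ hm
      refine Finset.sum_eq_zero fun m' _ => ?_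
      have : ∀ m' : Bits (k + 1), project (v₁.trans (sndWires A.n e)) m' 0 = 0 := fun m' =>
        (isLinearMap_project _ _).map_zero
      simp only [project_tensor_basis, if_neg hm, this, hzero, avg_const]
    · simp
  · simp only [if_neg hX, Finset.sum_const_zero]

theorem size_reduction_le {e : ℕ} (s : Bits e) (v₀ v₁ : Fin (k + 1) ↪ Fin e) (x θ : Bits k)
    (tail : List (Instr (E.skLen k) (A.n + e))) (out : Fin (A.n + e)) :
    (E.reduction A s v₀ v₁ x θ tail out).size ≤ A.size + 3 * k + e + tail.length := by
  have := length_prep_le ((fstWires k (E.ctLen k)).trans A.ct) x θ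
  simp only [Adversary.size, Attacker.size, reduction, List.length_map, List.length_append]
  omega

/-- The content of the additional wires of a reduction: two messages and a blank. -/
def extra (m₀ m₁ : Bits (k + 1)) : Bits ((k + 1) + (k + 1) + 1) :=
  Fin.append (Fin.append m₀ m₁) fun _ => false

def extra₀ (k : ℕ) : Fin (k + 1) ↪ Fin ((k + 1) + (k + 1) + 1) :=
  (fstWires (k + 1) (k + 1)).trans (fstWires _ 1)

def extra₁ (k : ℕ) : Fin (k + 1) ↪ Fin ((k + 1) + (k + 1) + 1) :=
  (sndWires (k + 1) (k + 1)).trans (fstWires _ 1)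

def blank (k : ℕ) : Fin ((k + 1) + (k + 1) + 1) := sndWires _ 1 0

theorem extra_comp₀ (m₀ m₁ : Bits (k + 1)) : extra m₀ m₁ ∘ extra₀ k = m₀ := by
  funext i
  change Fin.append (Fin.append m₀ m₁) (fun _ : Fin 1 => false) (Fin.castAdd 1 (Fin.castAdd (k + 1) i)) = _
  rw [Fin.append_left, Fin.append_left]

theorem extra_comp₁ (m₀ m₁ : Bits (k + 1)) : extra m₀ m₁ ∘ extra₁ k = m₁ := by
  funext i
  change Fin.append (Fin.append m₀ m₁) (fun _ : Fin 1 => false) (Fin.castAdd 1 (Fin.natAdd (k + 1) i)) = _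
  rw [Fin.append_left, Fin.append_right]

theorem extra_blank (m₀ m₁ : Bits (k + 1)) : extra m₀ m₁ (blank k) = false := by
  change Fin.append (Fin.append m₀ m₁) (fun _ : Fin 1 => false) (Fin.natAdd _ 0) = _
  rw [Fin.append_right]

end ABE
namespace ABE

variable (E : ABE fun k => k + 1) {k : ℕ} (A : E.Attacker k)

/-! ### Estimates for the branches of the experiments -/

/-- Gives `branch` a meaning on operators that are not states, in particular on the off-diagonal
`|a⟩⟨b|`, and permits the change of basis in the sum over `x`. -/
theorem isLinearMap_branch (m : Bits (k + 1))
    {g : Bits (E.mskLen k) → Bits (E.attrLen k) → Op A.n → ℝ}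
    (hg : ∀ msk X, IsLinearMap ℝ (g msk X)) : IsLinearMap ℝ fun σ => E.branch A m σ g := by
  have hmid : ∀ (c : Bits (E.genCoins k)) X c' ρ, IsLinearMap ℝ fun σ : Op k =>
      E.run k (E.gen k c).2 (fun d P => !E.eval k d P X) A.mid []
        (load A.ct (tensor σ (basisOp (E.enc k c' (E.gen k c).1 X m))) ρ)
        fun _ ρ' => g (E.gen k c).2 X ρ' := fun c X c' ρ =>
    IsLinearMap.comp' (E.isLinearMap_run k _ _ A.mid [] fun _ => hg _ _)
      (isLinearMap_real_of_complex
        (IsLinearMap.comp' (G := fun τ => load A.ct τ ρ) (isLinearMap_load_left A.ct ρ)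
          (isLinearMap_tensor_left (basisOp (E.enc k c' (E.gen k c).1 X m)))))
  have hpre : ∀ (c : Bits (E.genCoins k)) (h : List (Σ d, Bits d)) ρ, IsLinearMap ℝ fun σ : Op k =>
      ∑ X : Bits (E.attrLen k), if ∀ q ∈ h, E.eval k q.1 q.2 X = false then
          avg fun c' : Bits (E.encCoins k) =>
            E.run k (E.gen k c).2 (fun d P => !E.eval k d P X) A.mid []
              (load A.ct (tensor σ (basisOp (E.enc k c' (E.gen k c).1 X m)))
                (project A.attr X ρ)) fun _ ρ' => g (E.gen k c).2 X ρ'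
        else 0 := fun c h ρ => isLinearMap_sum _ fun X => by
    by_cases hX : ∀ q ∈ h, E.eval k q.1 q.2 X = false
    · simp only [if_pos hX]
      exact isLinearMap_avg fun c' => hmid _ _ _ _
    · simp only [if_neg hX]
      exact isLinearMap_zero
  simp only [branch]
  refine isLinearMap_avg fun c => ⟨fun σ τ => ?_, fun r σ => ?_⟩
  · rw [← KeySystem.run_add]
    refine congrArg (KeySystem.run _ _ _ _ _ _ _) (funext fun h => funext fun ρ => ?_)
    exact (hpre c h ρ).map_add σ τ
  · have := fun F => E.run_map k (E.gen k c).2 (fun _ _ => true)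
      (⟨fun x y => mul_add r x y, fun s x => by simp only [smul_eq_mul]; ring⟩ :
        IsLinearMap ℝ fun x : ℝ => r * x) A.pre [] (write A.pk (E.gen k c).1 (ketbra A.advice)) F
    refine Eq.trans ?_ (this _).symm
    refine congrArg (KeySystem.run _ _ _ _ _ _ _) (funext fun h => funext fun ρ => ?_)
    exact (hpre c h ρ).map_smul r σ

theorem isLinearMap_challenge (m : Bits (k + 1)) (σ : Op k) (c : Bits (E.genCoins k))
    {g : Bits (E.mskLen k) → Bits (E.attrLen k) → Op A.n → ℝ}
    (hg : ∀ msk X, IsLinearMap ℝ (g msk X)) (h : List (Σ d, Bits d)) :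
    IsLinearMap ℝ fun ρ => ∑ X : Bits (E.attrLen k),
        if ∀ q ∈ h, E.eval k q.1 q.2 X = false then
          avg fun c' : Bits (E.encCoins k) =>
            E.run k (E.gen k c).2 (fun d P => !E.eval k d P X) A.mid []
              (load A.ct (tensor σ (basisOp (E.enc k c' (E.gen k c).1 X m)))
                (project A.attr X ρ)) fun _ ρ' => g (E.gen k c).2 X ρ'
        else 0 := isLinearMap_sum _ fun X => by
  by_cases hX : ∀ q ∈ h, E.eval k q.1 q.2 X = false
  · simp only [if_pos hX]
    exact isLinearMap_avg fun c' =>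
      IsLinearMap.comp' (E.isLinearMap_run k _ _ A.mid [] fun _ => hg _ _)
        (isLinearMap_real_of_complex
          (IsLinearMap.comp' (isLinearMap_load _ _) (isLinearMap_project _ _)))
  · simp only [if_neg hX]
    exact isLinearMap_zero

theorem tensor_vecMulVec_basis {a b : ℕ} (φ ψ : Bits a → ℂ) (s : Bits b) :
    tensor (Matrix.vecMulVec φ (star ψ)) (basisOp s) =
      Matrix.vecMulVec (fun y : Bits (a + b) => φ (y ∘ fstWires a b) *
        (Pi.single s 1 : Bits b → ℂ) (y ∘ sndWires a b))
        (star fun y : Bits (a + b) => ψ (y ∘ fstWires a b) *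
          (Pi.single s 1 : Bits b → ℂ) (y ∘ sndWires a b)) := by
  rw [basisOp_eq_vecMulVec]
  ext y z
  rw [tensor_apply]
  simp only [Matrix.vecMulVec_apply, Pi.star_apply, star_mul']
  ring

/-- Loading `|a⟩⟨b|` into a Kraus branch of the first phase yields rank-one terms whose left vectors
involve only `a` and whose right vectors involve only `b`. Domination of the second phase thus
passes to the challenge, and then back through the first phase, which has the same advice on both
sides. -/
theorem branch_sqBound (m : Bits (k + 1)) (a b : Bits k → ℂ)
    {F G G' : Bits (E.mskLen k) → Bits (E.attrLen k) → Op A.n → ℝ}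
    (hD : ∀ msk X, Dominated (F msk X) (G msk X) (G' msk X))
    (hF : ∀ msk X, IsLinearMap ℝ (F msk X)) (hG : ∀ msk X, IsLinearMap ℝ (G msk X))
    (hG' : ∀ msk X, IsLinearMap ℝ (G' msk X)) :
    SqBound (E.branch A m (Matrix.vecMulVec a (star b)) F)
      (E.branch A m (ketbra a) G) (E.branch A m (ketbra b) G') := by
  refine SqBound.avg fun c => ?_
  obtain ⟨ι, _, f, hf⟩ := hasKraus_write A.pk (E.gen k c).1
  have hrun := E.run_dominated k (E.gen k c).2 (fun _ _ => true) A.pre []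
    (F := fun h ρ => ∑ X : Bits (E.attrLen k),
        if ∀ q ∈ h, E.eval k q.1 q.2 X = false then
          avg fun c' : Bits (E.encCoins k) =>
            E.run k (E.gen k c).2 (fun d P => !E.eval k d P X) A.mid []
              (load A.ct (tensor (Matrix.vecMulVec a (star b))
                (basisOp (E.enc k c' (E.gen k c).1 X m)))
                (project A.attr X ρ)) fun _ ρ' => F (E.gen k c).2 X ρ'
        else 0)
    (G := fun h ρ => ∑ X : Bits (E.attrLen k),
        if ∀ q ∈ h, E.eval k q.1 q.2 X = false then
          avg fun c' : Bits (E.encCoins k) =>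
            E.run k (E.gen k c).2 (fun d P => !E.eval k d P X) A.mid []
              (load A.ct (tensor (ketbra a) (basisOp (E.enc k c' (E.gen k c).1 X m)))
                (project A.attr X ρ)) fun _ ρ' => G (E.gen k c).2 X ρ'
        else 0)
    (G' := fun h ρ => ∑ X : Bits (E.attrLen k),
        if ∀ q ∈ h, E.eval k q.1 q.2 X = false then
          avg fun c' : Bits (E.encCoins k) =>
            E.run k (E.gen k c).2 (fun d P => !E.eval k d P X) A.mid []
              (load A.ct (tensor (ketbra b) (basisOp (E.enc k c' (E.gen k c).1 X m)))
                (project A.attr X ρ)) fun _ ρ' => G' (E.gen k c).2 X ρ'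
        else 0) ?_ (E.isLinearMap_challenge A m _ c hF) (E.isLinearMap_challenge A m _ c hG)
    (E.isLinearMap_challenge A m _ c hG')
  · exact hrun.comp (E.isLinearMap_run k _ _ _ _ (E.isLinearMap_challenge A m _ c hF))
      (E.isLinearMap_run k _ _ _ _ (E.isLinearMap_challenge A m _ c hG))
      (E.isLinearMap_run k _ _ _ _ (E.isLinearMap_challenge A m _ c hG'))
      (hasKraus_write A.pk (E.gen k c).1) A.advice A.advice
  · intro h φ ψ
    refine SqBound.sum fun X => SqBound.ite fun _ => SqBound.avg fun c' => ?_
    have hmid := E.run_dominated k (E.gen k c).2 (fun d P => !E.eval k d P X) A.mid []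
      (F := fun _ => F (E.gen k c).2 X) (G := fun _ => G (E.gen k c).2 X)
      (G' := fun _ => G' (E.gen k c).2 X) (fun _ => hD _ _) (fun _ => hF _ _) (fun _ => hG _ _)
      (fun _ => hG' _ _)
    obtain ⟨κ, _, f, hf⟩ := hasKraus_project A.attr X
    simp only [ketbra, tensor_vecMulVec_basis, hf,
      IsLinearMap.map_sum' (isLinearMap_load A.ct _), load_vecMulVec]
    have l1 := E.isLinearMap_run k (E.gen k c).2 (fun d P => !E.eval k d P X) A.mid []
      (final := fun _ => F (E.gen k c).2 X) fun _ => hF _ _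
    have l2 := E.isLinearMap_run k (E.gen k c).2 (fun d P => !E.eval k d P X) A.mid []
      (final := fun _ => G (E.gen k c).2 X) fun _ => hG _ _
    have l3 := E.isLinearMap_run k (E.gen k c).2 (fun d P => !E.eval k d P X) A.mid []
      (final := fun _ => G' (E.gen k c).2 X) fun _ => hG' _ _
    have e1 := fun v : κ → Bits (k + E.ctLen k) → Op A.n =>
      (IsLinearMap.map_sum' l1 Finset.univ fun i => ∑ t, v i t).trans
        (Finset.sum_congr rfl fun i _ => IsLinearMap.map_sum' l1 Finset.univ (v i))
    have e2 := fun v : κ → Bits (k + E.ctLen k) → Op A.n =>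
      (IsLinearMap.map_sum' l2 Finset.univ fun i => ∑ t, v i t).trans
        (Finset.sum_congr rfl fun i _ => IsLinearMap.map_sum' l2 Finset.univ (v i))
    have e3 := fun v : κ → Bits (k + E.ctLen k) → Op A.n =>
      (IsLinearMap.map_sum' l3 Finset.univ fun i => ∑ t, v i t).trans
        (Finset.sum_congr rfl fun i _ => IsLinearMap.map_sum' l3 Finset.univ (v i))
    rw [e1, e2, e3]
    exact SqBound.sum fun j => SqBound.sum fun t => hmid _ _

/-- The functional `φ ∘ trace` is insensitive to the ciphertext. -/
theorem branch_trace (m m' : Bits (k + 1)) {σ σ' : Op k} (hσ : σ.trace = 1) (hσ' : σ'.trace = 1)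
    {φ : Bits (E.mskLen k) → Bits (E.attrLen k) → ℂ → ℝ} (hφ : ∀ msk X, IsLinearMap ℝ (φ msk X)) :
    E.branch A m σ (fun msk X ρ => φ msk X ρ.trace) =
      E.branch A m' σ' fun msk X ρ => φ msk X ρ.trace := by
  have hmid : ∀ (m : Bits (k + 1)) {σ : Op k}, σ.trace = 1 → ∀ (c : Bits (E.genCoins k)) X c' ρ,
      E.run k (E.gen k c).2 (fun d P => !E.eval k d P X) A.mid []
        (load A.ct (tensor σ (basisOp (E.enc k c' (E.gen k c).1 X m))) ρ)
        (fun _ ρ' => φ (E.gen k c).2 X ρ'.trace) = φ (E.gen k c).2 X ρ.trace := by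
    intro m σ hσ c X c' ρ
    rw [← E.run_map k _ _ (hφ (E.gen k c).2 X), E.run_trace, trace_load, trace_tensor,
      trace_basisOp, hσ, one_mul, one_mul]
  simp only [branch, hmid m hσ, hmid m' hσ']

/-- With the exits included the total weight is `1`; `branch` omits the exits, and their weight is
nonnegative. -/
theorem branch_rtr_le_one (m : Bits (k + 1)) (a : Bits k → ℂ) (ha : (ketbra a).trace = 1) :
    E.branch A m (ketbra a) (fun _ _ ρ => rtr ρ) ≤ 1 := by
  have hre : IsLinearMap ℝ Complex.re := ⟨fun _ _ => rfl, fun r z => by simp⟩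
  have hmid : ∀ (c : Bits (E.genCoins k)) X c' ρ,
      E.run k (E.gen k c).2 (fun d P => !E.eval k d P X) A.mid []
        (load A.ct (tensor (ketbra a) (basisOp (E.enc k c' (E.gen k c).1 X m))) ρ)
        (fun _ ρ' => rtr ρ') = rtr ρ := fun c X c' ρ => by
    rw [E.run_rtr, rtr, trace_load, trace_tensor, ha, trace_basisOp, one_mul, one_mul, rtr]
  simp only [branch, hmid, avg_const]
  have hproj : ∀ (X : Bits (E.attrLen k)), Dominated (fun ρ : Op A.n => rtr (project A.attr X ρ))
      (fun ρ => rtr (project A.attr X ρ)) fun ρ => rtr (project A.attr X ρ) := fun X =>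
    contractive_rtr.dominated.comp isLinearMap_rtr isLinearMap_rtr isLinearMap_rtr
      (hasKraus_project A.attr X)
  have hplin : ∀ (X : Bits (E.attrLen k)), IsLinearMap ℝ fun ρ : Op A.n =>
      rtr (project A.attr X ρ) := fun X =>
    IsLinearMap.comp' isLinearMap_rtr (isLinearMap_real_of_complex (isLinearMap_project _ _))
  have htot : ∀ ρ : Op A.n, ∑ X, rtr (project A.attr X ρ) = rtr ρ := fun ρ => by
    simp only [rtr]
    rw [← Complex.re_sum, sum_trace_project]
  have hadv : ∀ c : Bits (E.genCoins k), rtr (write A.pk (E.gen k c).1 (ketbra A.advice)) = 1 :=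
    fun c => by
      rw [rtr, trace_write]
      exact (rtr_vecMulVec A.advice).trans A.advice_norm
  have hone : ∀ c : Bits (E.genCoins k), E.run k (E.gen k c).2 (fun _ _ => true) A.pre []
      (write A.pk (E.gen k c).1 (ketbra A.advice)) (fun h ρ => ∑ X : Bits (E.attrLen k),
        if ∀ q ∈ h, E.eval k q.1 q.2 X = false then rtr (project A.attr X ρ) else 0) ≤ 1 := by
    intro c
    have hlin : ∀ h : List (Σ d, Bits d), IsLinearMap ℝ fun ρ : Op A.n =>
        ∑ X : Bits (E.attrLen k), if ∀ q ∈ h, E.eval k q.1 q.2 X = false then 0 else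
          rtr (project A.attr X ρ) := fun h => isLinearMap_sum _ fun X => by
      split_ifs
      · exact isLinearMap_zero
      · exact hplin X
    -- The weight of the exits is dominated by itself, and domination contains nonnegativity on
    -- `|φ⟩⟨φ|`; no separate notion of positivity is needed.
    have hnn := ((E.run_dominated k (E.gen k c).2 (fun _ _ => true) A.pre []
      (F := fun h ρ => ∑ X : Bits (E.attrLen k),
        if ∀ q ∈ h, E.eval k q.1 q.2 X = false then 0 else rtr (project A.attr X ρ))
      (G := fun h ρ => ∑ X : Bits (E.attrLen k),
        if ∀ q ∈ h, E.eval k q.1 q.2 X = false then 0 else rtr (project A.attr X ρ))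
      (G' := fun h ρ => ∑ X : Bits (E.attrLen k),
        if ∀ q ∈ h, E.eval k q.1 q.2 X = false then 0 else rtr (project A.attr X ρ))
      (fun h φ ψ => SqBound.sum fun X => by
        split_ifs
        · exact SqBound.zero
        · exact hproj X φ ψ) hlin hlin hlin).comp
        (E.isLinearMap_run k _ _ _ _ hlin) (E.isLinearMap_run k _ _ _ _ hlin)
        (E.isLinearMap_run k _ _ _ _ hlin) (hasKraus_write A.pk (E.gen k c).1)
        A.advice A.advice).left
    have hsum := E.run_add k (E.gen k c).2 (fun _ _ => true) A.pre []
      (write A.pk (E.gen k c).1 (ketbra A.advice)) (fun h ρ => ∑ X : Bits (E.attrLen k),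
        if ∀ q ∈ h, E.eval k q.1 q.2 X = false then rtr (project A.attr X ρ) else 0)
      (fun h ρ => ∑ X : Bits (E.attrLen k),
        if ∀ q ∈ h, E.eval k q.1 q.2 X = false then 0 else rtr (project A.attr X ρ))
    have hall : (fun (h : List (Σ d, Bits d)) (ρ : Op A.n) => (∑ X : Bits (E.attrLen k),
        if ∀ q ∈ h, E.eval k q.1 q.2 X = false then rtr (project A.attr X ρ) else 0) +
        ∑ X : Bits (E.attrLen k),
        if ∀ q ∈ h, E.eval k q.1 q.2 X = false then 0 else rtr (project A.attr X ρ)) =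
        fun _ ρ => rtr ρ := by
      funext h ρ
      rw [← Finset.sum_add_distrib, ← htot]
      exact Finset.sum_congr rfl fun X _ => by split_ifs <;> simp
    rw [hall, E.run_rtr, hadv] at hsum
    have : 0 ≤ E.run k (E.gen k c).2 (fun _ _ => true) A.pre []
      (write A.pk (E.gen k c).1 (ketbra A.advice)) (fun h ρ => ∑ X : Bits (E.attrLen k),
        if ∀ q ∈ h, E.eval k q.1 q.2 X = false then 0 else rtr (project A.attr X ρ)) := hnn
    linarith
  calc _ ≤ avg fun _ : Bits (E.genCoins k) => (1 : ℝ) := by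
        simp only [avg, smul_eq_mul]
        exact mul_le_mul_of_nonneg_left (Finset.sum_le_sum fun c _ => hone c) (by positivity)
    _ = 1 := avg_const _

end ABE

/-! ### The accepted branches -/

theorem sum_prod_bits {R : Type*} [CommSemiring R] {k : ℕ} (F : Fin k → Bool → R) :
    ∑ x : Bits k, ∏ i, F i (x i) = ∏ i, ∑ b, F i b := by
  rw [Finset.prod_univ_sum, Fintype.piFinset_univ]

/-- The Hadamard basis state `H|u⟩`. -/
def hadamardState {k : ℕ} (u : Bits k) : Bits k → ℂ := bb84 u fun _ => true

/-- Flip the bits of `u` at the positions with `θ i = 0`. -/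
def flipOff {k : ℕ} (θ u : Bits k) : Bits k := fun i => u i ^^ !θ i

theorem ite_accepts {k : ℕ} (x θ t : Bits k) :
    (if accepts x θ t then (1 : ℂ) else 0) = ∏ i, if θ i = true → x i = t i then 1 else 0 := by
  rw [Finset.prod_ite_zero]
  simp [accepts]

theorem inv_sqrt_two_sq : ((Real.sqrt 2 : ℂ))⁻¹ * (Real.sqrt 2 : ℂ)⁻¹ = 1 / 2 := by
  rw [← mul_inv, sqrt_two_sq]; norm_num

/-- Both sides factor over the positions. Where `θ i = 1` the sign is trivial and acceptance leaves
the single term with bit `t i`, the same on both sides. Where `θ i = 0` there is no constraint, and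
`|0⟩⟨0| - |1⟩⟨1| = |+⟩⟨-| + |-⟩⟨+|`. -/
theorem sum_signed_bb84 {k : ℕ} (θ t : Bits k) :
    ∑ x, (if accepts x θ t then sgn (parity x θ) else 0) • ketbra (bb84 x θ) =
      ∑ u, (if accepts u θ t then (1 : ℝ) else 0) •
        Matrix.vecMulVec (hadamardState u) (star (hadamardState (flipOff θ u))) := by
  ext y z
  simp only [Matrix.sum_apply, Matrix.smul_apply, ketbra, Matrix.vecMulVec_apply, Pi.star_apply]
  have hl : ∀ x : Bits k, (if accepts x θ t then sgn (parity x θ) else 0) •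
      (bb84 x θ y * star (bb84 x θ z)) = ∏ i, (if θ i = true → x i = t i then (1 : ℂ) else 0) *
        (sgn (!θ i && x i) : ℂ) *
        ((if θ i then hadamard (y i) (x i) else if y i = x i then 1 else 0) *
        star (if θ i then hadamard (z i) (x i) else if z i = x i then 1 else 0)) := fun x => by
    rw [Finset.prod_mul_distrib, Finset.prod_mul_distrib, Finset.prod_mul_distrib, ← ite_accepts,
      ← Complex.ofReal_prod, ← sgn_parity, bb84, bb84, star_prod]
    split_ifs <;> simp
  have hr : ∀ u : Bits k, (if accepts u θ t then (1 : ℝ) else 0) •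
      (hadamardState u y * star (hadamardState (flipOff θ u) z)) =
      ∏ i, (if θ i = true → u i = t i then (1 : ℂ) else 0) *
        (hadamard (y i) (u i) * star (hadamard (z i) (u i ^^ !θ i))) := fun u => by
    rw [Finset.prod_mul_distrib, Finset.prod_mul_distrib, ← ite_accepts, hadamardState,
      hadamardState, bb84, bb84, star_prod]
    cases accepts u θ t <;> simp [flipOff]
  simp only [hl, hr]
  rw [sum_prod_bits fun i b => (if θ i = true → b = t i then (1 : ℂ) else 0) *
        (sgn (!θ i && b) : ℂ) *
        ((if θ i then hadamard (y i) b else if y i = b then 1 else 0) *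
        star (if θ i then hadamard (z i) b else if z i = b then 1 else 0)),
    sum_prod_bits fun i b => (if θ i = true → b = t i then (1 : ℂ) else 0) *
        (hadamard (y i) b * star (hadamard (z i) (b ^^ !θ i)))]
  refine Finset.prod_congr rfl fun i _ => ?_
  simp only [Complex.star_def, hadamard_star, apply_ite (starRingEnd ℂ), map_one, map_zero]
  cases θ i
  · cases y i <;> cases z i <;> simp [sgn, hadamard, div_eq_mul_inv, inv_sqrt_two_sq] <;> norm_num
  · cases t i <;> simp [sgn]

/-! ### Orthonormality of the BB84 states. -/

/-- The amplitudes of one qubit. -/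
def qubit (x θ z : Bool) : ℂ := if θ then hadamard z x else if z = x then 1 else 0

theorem qubit_star (x θ z : Bool) : star (qubit x θ z) = qubit x θ z := by
  cases θ
  · cases x <;> cases z <;> simp [qubit]
  · exact hadamard_star _ _

theorem qubit_orth (x x' θ : Bool) :
    ∑ z, qubit x θ z * qubit x' θ z = if x = x' then 1 else 0 := by
  cases θ
  · cases x <;> cases x' <;> simp [qubit]
  · exact hadamard_orth x x'

theorem bb84_eq {k : ℕ} (x θ z : Bits k) : bb84 x θ z = ∏ i, qubit (x i) (θ i) (z i) := rfl

theorem bb84_star {k : ℕ} (x θ z : Bits k) : star (bb84 x θ z) = bb84 x θ z := by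
  rw [bb84_eq, star_prod]
  exact Finset.prod_congr rfl fun i _ => qubit_star _ _ _

theorem bb84_orth {k : ℕ} (x x' θ : Bits k) :
    ∑ z, bb84 x θ z * bb84 x' θ z = if x = x' then 1 else 0 := by
  simp only [bb84_eq, ← Finset.prod_mul_distrib]
  rw [sum_prod_bits fun i b => qubit (x i) (θ i) b * qubit (x' i) (θ i) b]
  simp only [qubit_orth, Finset.prod_ite_zero, Finset.prod_const_one, Finset.mem_univ,
    forall_const, funext_iff]

theorem trace_ketbra_bb84 {k : ℕ} (x θ : Bits k) : (ketbra (bb84 x θ)).trace = 1 := by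
  have h := bb84_orth x x θ
  rw [if_pos rfl] at h
  rw [← h]
  simp only [ketbra, Matrix.trace, Matrix.diag, Matrix.vecMulVec_apply, Pi.star_apply, bb84_star]

namespace ABE

variable (E : ABE fun k => k + 1) {k : ℕ} (A : E.Attacker k)

/-- The probability that the adversary outputs the certificate `t` when it is given the state
`H|u⟩` and an encryption of `m`. -/
def certProb (m : Bits (k + 1)) (u t : Bits k) : ℝ :=
  E.branch A m (ketbra (hadamardState u)) fun _ _ ρ => rtr (project A.cert t ρ)

/-- The value of `f` at the end of the second phase, restricted to accepted certificates. -/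
def acceptPart (b : Bool) (f : Bits (E.mskLen k) → Bits (E.attrLen k) → Op A.n → ℝ) : ℝ :=
  ∑ p : Bits k × Bits k, ((2 : ℝ) ^ (k + k))⁻¹ *
    E.branch A (plaintext p.2 (b ^^ parity p.1 p.2)) (ketbra (bb84 p.1 p.2))
      fun msk X ρ => ∑ t, if accepts p.1 p.2 t then f msk X (project A.cert t ρ) else 0

theorem isLinearMap_project_real {ι : Type} [Fintype ι] {n : ℕ} (w : ι → Fin n) (t : ι → Bool) :
    IsLinearMap ℝ (project w t : Op n → Op n) :=
  isLinearMap_real_of_complex (isLinearMap_project w t)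

/-- A contractive `f` is bounded by the trace, and the trace that remains after the outcome `t` is
the probability of `t`. Nothing is assumed about the cost of `f`. -/
theorem certProb_bound (m : Bits (k + 1)) (u v t : Bits k)
    {f : Bits (E.mskLen k) → Bits (E.attrLen k) → Op A.n → ℝ}
    (hf : ∀ msk X, Contractive (f msk X)) :
    SqBound (E.branch A m (Matrix.vecMulVec (hadamardState u) (star (hadamardState v)))
        fun msk X ρ => f msk X (project A.cert t ρ))
      (E.certProb A m u t) (E.certProb A m v t) :=
  E.branch_sqBound A m _ _
    (fun msk X => (hf msk X).dominated.comp (hf msk X).linear isLinearMap_rtr isLinearMap_rtr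
      (hasKraus_project A.cert t))
    (fun msk X => IsLinearMap.comp' (hf msk X).linear (isLinearMap_project_real A.cert t))
    (fun _ _ => IsLinearMap.comp' isLinearMap_rtr (isLinearMap_project_real A.cert t))
    (fun _ _ => IsLinearMap.comp' isLinearMap_rtr (isLinearMap_project_real A.cert t))

theorem certProb_nonneg (m : Bits (k + 1)) (u t : Bits k) : 0 ≤ E.certProb A m u t :=
  (E.certProb_bound A m u u t (f := fun _ _ => rtr) fun _ _ => contractive_rtr).left

theorem sum_certProb (m : Bits (k + 1)) (u : Bits k) :
    ∑ t, E.certProb A m u t = E.branch A m (ketbra (hadamardState u)) fun _ _ ρ => rtr ρ := by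
  have := E.branch_sum A m (ketbra (hadamardState u)) (fun _ : Bits k => 1)
    fun t _ _ ρ => rtr (project A.cert t ρ)
  simp only [one_mul] at this
  simp only [certProb]
  rw [← this]
  congr 1
  funext msk X ρ
  simp only [rtr]
  rw [← Complex.re_sum, sum_trace_project]

theorem sum_certProb_le_one (m : Bits (k + 1)) (u : Bits k) : ∑ t, E.certProb A m u t ≤ 1 := by
  rw [sum_certProb]
  exact E.branch_rtr_le_one A m _ (trace_ketbra_bb84 _ _)

/-- The common value can be less than `1` because of exits at the challenge, but it depends only on
traces and hence not on the plaintext. -/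
theorem sum_certProb_eq (m m' : Bits (k + 1)) (u : Bits k) :
    ∑ t, E.certProb A m u t = ∑ t, E.certProb A m' u t := by
  rw [sum_certProb, sum_certProb]
  exact E.branch_trace A m m' (trace_ketbra_bb84 _ _) (trace_ketbra_bb84 _ _)
    (φ := fun _ _ z => z.re) fun _ _ => ⟨fun _ _ => rfl, fun r z => by simp⟩

/-- For given `θ` only two plaintexts occur, one for each masked bit. Collecting the strings `x` by
their parity exhibits the signed sum of BB84 states as the argument of both functionals; it is
rewritten in the Hadamard basis, and the triangle inequality bounds the two plaintexts separately.
-/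
theorem acceptPart_sub_le {f : Bits (E.mskLen k) → Bits (E.attrLen k) → Op A.n → ℝ}
    (hf : ∀ msk X, Contractive (f msk X)) :
    |E.acceptPart A false f - E.acceptPart A true f| ≤ ((2 : ℝ) ^ (k + k))⁻¹ *
      ∑ θ, ∑ b, ∑ u, ∑ t, if accepts u θ t then √(E.certProb A (plaintext θ b) u t) *
        √(E.certProb A (plaintext θ b) (flipOff θ u) t) else 0 := by
  set B : Bits k → Bits k → Bool → Op k → ℝ := fun θ t b σ =>
    E.branch A (plaintext θ b) σ fun msk X ρ => f msk X (project A.cert t ρ) with hB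
  have hBlin : ∀ θ t b, IsLinearMap ℝ (B θ t b) := fun θ t b =>
    E.isLinearMap_branch A _ fun msk X =>
      IsLinearMap.comp' (hf msk X).linear (isLinearMap_project_real A.cert t)
  have hacc : ∀ b, E.acceptPart A b f = ((2 : ℝ) ^ (k + k))⁻¹ * ∑ θ, ∑ t, ∑ x,
      (if accepts x θ t then (1 : ℝ) else 0) * B θ t (b ^^ parity x θ) (ketbra (bb84 x θ)) := by
    intro b
    rw [acceptPart, Fintype.sum_prod_type, Finset.mul_sum, Finset.sum_comm]
    refine Finset.sum_congr rfl fun θ _ => ?_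
    rw [← Finset.mul_sum, Finset.sum_comm]
    congr 1
    refine Finset.sum_congr rfl fun x _ => ?_
    rw [← E.branch_sum A]
    simp only [ite_mul, one_mul, zero_mul]
  -- Flipping the challenge bit exchanges the two plaintexts, so the difference retains the parity
  -- of `x` only as a sign.
  have hdiff : ∀ θ t x, (if accepts x θ t then (1 : ℝ) else 0) *
      B θ t (false ^^ parity x θ) (ketbra (bb84 x θ)) - (if accepts x θ t then (1 : ℝ) else 0) *
      B θ t (true ^^ parity x θ) (ketbra (bb84 x θ)) =
      (B θ t false ((if accepts x θ t then sgn (parity x θ) else 0) • ketbra (bb84 x θ)) -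
      B θ t true ((if accepts x θ t then sgn (parity x θ) else 0) • ketbra (bb84 x θ))) := by
    intro θ t x
    rw [(hBlin θ t false).map_smul, (hBlin θ t true).map_smul]
    split_ifs
    · cases parity x θ
      · simp [sgn]
      · simp only [sgn, Bool.true_xor, Bool.false_xor, if_true, Bool.not_true, smul_eq_mul]
        ring
    · simp
  have hsum : E.acceptPart A false f - E.acceptPart A true f = ((2 : ℝ) ^ (k + k))⁻¹ *
      ∑ θ, ∑ t, ∑ u, (if accepts u θ t then (1 : ℝ) else 0) *
        (B θ t false (Matrix.vecMulVec (hadamardState u) (star (hadamardState (flipOff θ u)))) -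
        B θ t true (Matrix.vecMulVec (hadamardState u) (star (hadamardState (flipOff θ u))))) := by
    rw [hacc, hacc, ← mul_sub]
    simp only [← Finset.sum_sub_distrib]
    congr 1
    refine Finset.sum_congr rfl fun θ _ => Finset.sum_congr rfl fun t _ => ?_
    simp only [hdiff]
    rw [Finset.sum_sub_distrib, ← IsLinearMap.map_sum' (hBlin θ t false),
      ← IsLinearMap.map_sum' (hBlin θ t true), sum_signed_bb84,
      IsLinearMap.map_sum' (hBlin θ t false), IsLinearMap.map_sum' (hBlin θ t true),
      ← Finset.sum_sub_distrib]
    refine Finset.sum_congr rfl fun u _ => ?_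
    rw [(hBlin θ t false).map_smul, (hBlin θ t true).map_smul, smul_eq_mul, smul_eq_mul, mul_sub]
  rw [hsum, abs_mul, abs_of_nonneg (by positivity : (0 : ℝ) ≤ ((2 : ℝ) ^ (k + k))⁻¹)]
  refine mul_le_mul_of_nonneg_left ?_ (by positivity)
  refine (Finset.abs_sum_le_sum_abs _ _).trans (Finset.sum_le_sum fun θ _ => ?_)
  have hswap : (∑ b, ∑ u, ∑ t, if accepts u θ t then √(E.certProb A (plaintext θ b) u t) *
        √(E.certProb A (plaintext θ b) (flipOff θ u) t) else 0) =
      ∑ t, ∑ u, ∑ b, if accepts u θ t then √(E.certProb A (plaintext θ b) u t) *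
        √(E.certProb A (plaintext θ b) (flipOff θ u) t) else 0 := by
    rw [Finset.sum_comm, Finset.sum_comm]
    rw [Finset.sum_comm]
    simp only [Fintype.sum_bool, Finset.sum_add_distrib]
    congr 1 <;> exact Finset.sum_comm
  rw [hswap]
  refine (Finset.abs_sum_le_sum_abs _ _).trans (Finset.sum_le_sum fun t _ => ?_)
  refine (Finset.abs_sum_le_sum_abs _ _).trans (Finset.sum_le_sum fun u _ => ?_)
  split_ifs
  · rw [one_mul, Fintype.sum_bool, add_comm]
    exact (abs_sub _ _).trans (add_le_add (E.certProb_bound A _ _ _ _ hf).le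
      (E.certProb_bound A _ _ _ _ hf).le)
  · simp

end ABE

/-! ### Combinatorics of bases and certificates -/

/-- The number of disagreements. -/
def dist {k : ℕ} (u t : Bits k) : ℕ := ∑ i, if u i = t i then 0 else 1

/-- The number of positions in the computational basis. -/
def zeros {k : ℕ} (θ : Bits k) : ℕ := ∑ i, if θ i then 0 else 1

/-- The fraction of disagreements. -/
def wt {k : ℕ} (u t : Bits k) : ℝ := (dist u t : ℝ) / k

theorem dist_le {k : ℕ} (u t : Bits k) : dist u t ≤ k := by
  have : dist u t ≤ ∑ _i : Fin k, 1 := Finset.sum_le_sum fun i _ => by split_ifs <;> simp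
  simpa using this

theorem wt_nonneg {k : ℕ} (u t : Bits k) : 0 ≤ wt u t := by unfold wt; positivity

theorem wt_le_one {k : ℕ} (u t : Bits k) : wt u t ≤ 1 :=
  div_le_one_of_le₀ (by exact_mod_cast dist_le u t) (by positivity)

theorem flipOff_flipOff {k : ℕ} (θ u : Bits k) : flipOff θ (flipOff θ u) = u := by
  funext i; simp [flipOff]

theorem accepts_flipOff {k : ℕ} (θ u t : Bits k) : accepts (flipOff θ u) θ t = accepts u θ t := by
  simp only [accepts, flipOff]
  congr 1
  refine propext (forall_congr' fun i => forall_congr' fun h => ?_)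
  simp [h]

/-- Where `θ i = 1` both strings agree with `t` by acceptance; where `θ i = 0` they are opposite, so
exactly one of them disagrees with `t`. -/
theorem dist_add {k : ℕ} {θ u t : Bits k} (h : accepts u θ t = true) :
    dist u t + dist (flipOff θ u) t = zeros θ := by
  simp only [accepts, decide_eq_true_eq] at h
  rw [dist, dist, zeros, ← Finset.sum_add_distrib]
  refine Finset.sum_congr rfl fun i _ => ?_
  have h' := h i
  rcases Bool.eq_false_or_eq_true (θ i) with h1 | h1 <;>
    rcases Bool.eq_false_or_eq_true (u i) with h2 | h2 <;>
    rcases Bool.eq_false_or_eq_true (t i) with h3 | h3 <;> simp_all [flipOff]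

/-- With at least `k/4` zeros in `θ`, one of the two distances is at least `k/8`. The polynomial
weight, scaled by `8 ^ c`, stands in for the indicator of that event. -/
theorem one_le_wt {k : ℕ} {θ u t : Bits k} (h : accepts u θ t = true) (hθ : ¬ 4 * zeros θ < k)
    (c : ℕ) (hk : 0 < k) : 1 ≤ 8 ^ c * (wt u t ^ c + wt (flipOff θ u) t ^ c) := by
  have h1 := dist_add h
  have h0 : (0 : ℝ) < k := by exact_mod_cast hk
  have key : ∀ a : ℕ, k ≤ 8 * a → (1 : ℝ) ≤ 8 ^ c * ((a : ℝ) / k) ^ c := fun a ha => by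
    rw [← mul_pow]
    refine one_le_pow₀ ?_
    rw [← mul_div_assoc, one_le_div h0]
    exact_mod_cast ha
  have n1 := pow_nonneg (wt_nonneg u t) c
  have n2 := pow_nonneg (wt_nonneg (flipOff θ u) t) c
  have n3 : (0 : ℝ) < 8 ^ c := by positivity
  rw [mul_add]
  by_cases ha : k ≤ 8 * dist u t
  · have := key _ ha
    have := mul_nonneg n3.le n2
    unfold wt at *; linarith
  · have := key (dist (flipOff θ u) t) (by omega)
    have := mul_nonneg n3.le n1
    unfold wt at *; linarith

/-- A Chernoff bound: the indicator is at most `(3/2)^k (2/3)^(4 zeros θ)`, where `(2/3)^4 = 16/81`,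
and each position contributes `(3/2) · (1 + 16/81)/2 = 291/324` on average. -/
theorem sum_light_le (k : ℕ) :
    ((2 : ℝ) ^ k)⁻¹ * ∑ θ : Bits k, (if 4 * zeros θ < k then (1 : ℝ) else 0) ≤
      (291 / 324 : ℝ) ^ k := by
  have h1 : ∀ θ : Bits k, (if 4 * zeros θ < k then (1 : ℝ) else 0) ≤
      (3 / 2) ^ k * ∏ i, if θ i then 1 else (16 / 81 : ℝ) := fun θ => by
    have hp : (∏ i, if θ i then 1 else (16 / 81 : ℝ)) = (2 / 3 : ℝ) ^ (4 * zeros θ) := by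
      rw [pow_mul, zeros, ← Finset.prod_pow_eq_pow_sum]
      refine Finset.prod_congr rfl fun i _ => ?_
      split_ifs <;> norm_num
    rw [hp]
    split_ifs with h
    · calc (1 : ℝ) = (3 / 2) ^ k * (2 / 3) ^ k := by rw [← mul_pow]; norm_num
        _ ≤ _ := mul_le_mul_of_nonneg_left
          (pow_le_pow_of_le_one (by norm_num) (by norm_num) h.le) (by positivity)
    · positivity
  calc _ ≤ ((2 : ℝ) ^ k)⁻¹ * ∑ θ : Bits k, (3 / 2) ^ k * ∏ i, if θ i then 1 else (16 / 81 : ℝ) :=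
        mul_le_mul_of_nonneg_left (Finset.sum_le_sum fun θ _ => h1 θ) (by positivity)
    _ = (291 / 324 : ℝ) ^ k := by
        rw [← Finset.mul_sum, sum_prod_bits fun _ b => if b then 1 else (16 / 81 : ℝ)]
        simp only [Fintype.sum_bool, Finset.prod_const, Finset.card_univ, Fintype.card_fin, if_true]
        rw [← inv_pow, ← mul_pow, ← mul_pow]
        norm_num

/-- Each disagreement of `u` and `t` has to be hidden by `θ i = 0`, which has probability `1/2`; the
other positions impose nothing. -/
theorem sum_accepts {k : ℕ} (u t : Bits k) :
    ((2 : ℝ) ^ k)⁻¹ * ∑ θ, (if accepts u θ t then (1 : ℝ) else 0) = (1 / 2) ^ dist u t := by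
  have h : ∀ θ : Bits k, (if accepts u θ t then (1 : ℝ) else 0) =
      ∏ i, if θ i = true → u i = t i then 1 else 0 := fun θ => by
    rw [Finset.prod_ite_zero]
    simp [accepts]
  simp only [h]
  rw [sum_prod_bits fun i b => if b = true → u i = t i then (1 : ℝ) else 0, dist,
    ← Finset.prod_pow_eq_pow_sum, ← inv_pow]
  have h2 : ((2 : ℝ)⁻¹) ^ k = ∏ _i : Fin k, (2 : ℝ)⁻¹ := by simp
  rw [h2, ← Finset.prod_mul_distrib]
  refine Finset.prod_congr rfl fun i _ => ?_
  by_cases hi : u i = t i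
  · simp [hi]
  · simp [hi]

theorem exists_pow_le (c : ℕ) : ∃ M : ℝ, 0 ≤ M ∧ ∀ m : ℕ, (m : ℝ) ^ c * (1 / 2) ^ m ≤ M := by
  have h := tendsto_pow_const_div_const_pow_of_one_lt c (by norm_num : (1 : ℝ) < 2)
  obtain ⟨M, hM⟩ := h.bddAbove_range
  refine ⟨max M 0, le_max_right _ _, fun m => le_trans ?_ (le_max_left _ _)⟩
  have := hM ⟨m, rfl⟩
  simpa [div_eq_mul_inv] using this

/-- The exponential `2^(-m)` absorbs the power `m ^ c`, and only the normalization of the weight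
remains. -/
theorem wt_mul_le {k : ℕ} {c : ℕ} {M : ℝ}
    (hM : ∀ m : ℕ, (m : ℝ) ^ c * (1 / 2) ^ m ≤ M) (u t : Bits k) :
    wt u t ^ c * (1 / 2) ^ dist u t ≤ M * ((k : ℝ) ^ c)⁻¹ := by
  rw [wt, div_pow, div_eq_mul_inv, mul_right_comm]
  exact mul_le_mul_of_nonneg_right (hM _) (by positivity)

theorem card_bits (k : ℕ) : Fintype.card (Bits k) = 2 ^ k := by
  simp

/-! ### The main estimate -/

/-- Sum over bases, masked bits, states and certificates. -/
def total {k : ℕ} (F : Bits k → Bool → Bits k → Bits k → ℝ) : ℝ :=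
  ((2 : ℝ) ^ (k + k))⁻¹ * ∑ θ, ∑ b, ∑ u, ∑ t, F θ b u t

theorem total_mono {k : ℕ} {F G : Bits k → Bool → Bits k → Bits k → ℝ}
    (h : ∀ θ b u t, F θ b u t ≤ G θ b u t) : total F ≤ total G :=
  mul_le_mul_of_nonneg_left (Finset.sum_le_sum fun _ _ => Finset.sum_le_sum fun _ _ =>
    Finset.sum_le_sum fun _ _ => Finset.sum_le_sum fun _ _ => h _ _ _ _) (by positivity)

theorem total_add {k : ℕ} (F G : Bits k → Bool → Bits k → Bits k → ℝ) :
    total (fun θ b u t => F θ b u t + G θ b u t) = total F + total G := by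
  simp only [total, Finset.sum_add_distrib, mul_add]

theorem total_mul {k : ℕ} (c : ℝ) (F : Bits k → Bool → Bits k → Bits k → ℝ) :
    total (fun θ b u t => c * F θ b u t) = c * total F := by
  simp only [total, ← Finset.mul_sum]; ring

theorem total_flipOff {k : ℕ} (F : Bits k → Bool → Bits k → Bits k → ℝ) :
    total (fun θ b u t => F θ b (flipOff θ u) t) = total F := by
  simp only [total]
  congr 1
  refine Finset.sum_congr rfl fun θ _ => Finset.sum_congr rfl fun b _ => ?_
  exact Fintype.sum_equiv (Function.Involutive.toPerm (flipOff θ) (flipOff_flipOff θ)) _ _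
    fun u => rfl

theorem total_cauchy_schwarz {k : ℕ} {F G : Bits k → Bool → Bits k → Bits k → ℝ}
    (hF : ∀ θ b u t, 0 ≤ F θ b u t) (hG : ∀ θ b u t, 0 ≤ G θ b u t) :
    total (fun θ b u t => √(F θ b u t) * √(G θ b u t)) ≤ √(total F) * √(total G) := by
  have h0 : (0 : ℝ) ≤ ((2 : ℝ) ^ (k + k))⁻¹ := by positivity
  have h := Real.sum_sqrt_mul_sqrt_le (Finset.univ : Finset (Bits k × Bool × Bits k × Bits k))
    (f := fun p => F p.1 p.2.1 p.2.2.1 p.2.2.2) (g := fun p => G p.1 p.2.1 p.2.2.1 p.2.2.2)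
    (fun _ => hF _ _ _ _) fun _ => hG _ _ _ _
  simp only [Fintype.sum_prod_type] at h
  simp only [total]
  rw [Real.sqrt_mul h0, Real.sqrt_mul h0]
  calc _ ≤ ((2 : ℝ) ^ (k + k))⁻¹ * (√(∑ θ, ∑ b, ∑ u, ∑ t, F θ b u t) *
        √(∑ θ, ∑ b, ∑ u, ∑ t, G θ b u t)) := mul_le_mul_of_nonneg_left h h0
    _ = (√((2 : ℝ) ^ (k + k))⁻¹ * √((2 : ℝ) ^ (k + k))⁻¹) * (√(∑ θ, ∑ b, ∑ u, ∑ t, F θ b u t) *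
        √(∑ θ, ∑ b, ∑ u, ∑ t, G θ b u t)) := by rw [Real.mul_self_sqrt h0]
    _ = _ := by ring

/-- The prefactor normalizes the sums over `θ` and `u`; the factor `2` is the unnormalized sum over
the masked bit. -/
theorem total_le_two {k : ℕ} {F : Bits k → Bool → Bits k → Bits k → ℝ} {a : ℝ}
    (h : ∀ θ b u, ∑ t, F θ b u t ≤ a) : total F ≤ 2 * a := by
  calc total F ≤ ((2 : ℝ) ^ (k + k))⁻¹ * ∑ _θ : Bits k, ∑ _b : Bool, ∑ _u : Bits k, a :=
        mul_le_mul_of_nonneg_left (Finset.sum_le_sum fun _ _ => Finset.sum_le_sum fun _ _ =>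
          Finset.sum_le_sum fun _ _ => h _ _ _) (by positivity)
    _ = 2 * a := by
        simp only [Finset.sum_const, Finset.card_univ, card_bits, Fintype.card_bool, nsmul_eq_mul]
        push_cast
        rw [pow_add]
        field_simp

/-- Bases with few zeros contribute at most their exponentially small proportion. For the others the
weights of `u` and `flipOff θ u` are inserted; they have equal totals, since the integrand is
symmetric under this exchange. Cauchy–Schwarz then leaves the weight on one of the two
probabilities, the other having total at most `2`. -/
theorem total_sqrt_le {k : ℕ} (hk : 0 < k) {Q : Bits k → Bool → Bits k → Bits k → ℝ}
    (hQ0 : ∀ θ b u t, 0 ≤ Q θ b u t) (hQ1 : ∀ θ b u, ∑ t, Q θ b u t ≤ 1) (c : ℕ) :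
    total (fun θ b u t => if accepts u θ t then √(Q θ b u t) * √(Q θ b (flipOff θ u) t) else 0) ≤
      2 * (291 / 324 : ℝ) ^ k + 2 * 8 ^ c *
        (√(total fun θ b u t => if accepts u θ t then wt u t ^ c * Q θ b u t else 0) * √2) := by
  set R : Bits k → Bool → Bits k → Bits k → ℝ :=
    fun θ b u t => √(Q θ b u t) * √(Q θ b (flipOff θ u) t) with hR
  have hR0 : ∀ θ b u t, 0 ≤ R θ b u t := fun θ b u t => by positivity
  have hpt : ∀ θ b u t, (if accepts u θ t then R θ b u t else 0) ≤
      (if 4 * zeros θ < k then R θ b u t else 0) +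
      8 ^ c * ((if accepts u θ t then wt u t ^ c * R θ b u t else 0) +
        if accepts (flipOff θ u) θ t then
          wt (flipOff θ u) t ^ c * R θ b (flipOff θ u) t else 0) := by
    intro θ b u t
    have hsymm : R θ b (flipOff θ u) t = R θ b u t := by
      simp only [hR, flipOff_flipOff]; ring
    rw [accepts_flipOff, hsymm]
    have n1 := pow_nonneg (wt_nonneg u t) c
    have n2 := pow_nonneg (wt_nonneg (flipOff θ u) t) c
    have n3 := hR0 θ b u t
    by_cases ha : accepts u θ t
    · simp only [ha, if_true]
      by_cases hl : 4 * zeros θ < k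
      · rw [if_pos hl]
        have : 0 ≤ (8 : ℝ) ^ c * (wt u t ^ c * R θ b u t +
          wt (flipOff θ u) t ^ c * R θ b u t) := by positivity
        linarith
      · rw [if_neg hl, ← add_mul, zero_add, ← mul_assoc]
        exact le_mul_of_one_le_left n3 (one_le_wt ha hl c hk)
    · simp only [ha]
      split_ifs <;> simp_all
  refine (total_mono hpt).trans ?_
  rw [total_add, total_mul, total_add,
    total_flipOff fun θ b u t => if accepts u θ t then wt u t ^ c * R θ b u t else 0]
  have t1 : total (fun θ b u t => if 4 * zeros θ < k then R θ b u t else 0) ≤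
      2 * (291 / 324 : ℝ) ^ k := by
    have hin : ∀ θ b u, ∑ t, R θ b u t ≤ 1 := fun θ b u => by
      refine (Real.sum_sqrt_mul_sqrt_le _ (fun t => hQ0 θ b u t)
        fun t => hQ0 θ b (flipOff θ u) t).trans ?_
      have a1 := Real.sqrt_le_one.mpr (hQ1 θ b u)
      have a2 := Real.sqrt_le_one.mpr (hQ1 θ b (flipOff θ u))
      exact mul_le_one₀ a1 (Real.sqrt_nonneg _) a2
    calc _ ≤ ((2 : ℝ) ^ (k + k))⁻¹ * ∑ θ : Bits k, ∑ _b : Bool, ∑ _u : Bits k,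
            (if 4 * zeros θ < k then (1 : ℝ) else 0) := by
          refine mul_le_mul_of_nonneg_left (Finset.sum_le_sum fun θ _ => Finset.sum_le_sum
            fun b _ => Finset.sum_le_sum fun u _ => ?_) (by positivity)
          by_cases hl : 4 * zeros θ < k
          · simp only [if_pos hl]; exact hin θ b u
          · simp only [if_neg hl, Finset.sum_const_zero]; exact le_rfl
      _ = 2 * (((2 : ℝ) ^ k)⁻¹ * ∑ θ : Bits k, (if 4 * zeros θ < k then (1 : ℝ) else 0)) := by
          simp only [Finset.sum_const, Finset.card_univ, card_bits, Fintype.card_bool,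
            nsmul_eq_mul, ← Finset.mul_sum]
          push_cast
          rw [pow_add]
          field_simp
      _ ≤ _ := mul_le_mul_of_nonneg_left (sum_light_le k) (by norm_num)
  have t2 : total (fun θ b u t => if accepts u θ t then wt u t ^ c * R θ b u t else 0) ≤
      √(total fun θ b u t => if accepts u θ t then wt u t ^ c * Q θ b u t else 0) * √2 := by
    -- Under the square root the weight appears squared; since `wt ≤ 1`, the square can afterwards
    -- be bounded by the weight itself.
    have e : ∀ θ b u t, (if accepts u θ t then wt u t ^ c * R θ b u t else 0) =
        √(if accepts u θ t then (wt u t ^ c) ^ 2 * Q θ b u t else 0) *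
          √(Q θ b (flipOff θ u) t) := fun θ b u t => by
      split_ifs
      · rw [Real.sqrt_mul (by positivity), Real.sqrt_sq (pow_nonneg (wt_nonneg u t) c)]
        simp only [hR]; ring
      · simp
    simp only [e]
    refine (total_cauchy_schwarz (fun θ b u t => ?_) fun θ b u t => hQ0 _ _ _ _).trans ?_
    · split_ifs
      · exact mul_nonneg (by positivity) (hQ0 _ _ _ _)
      · exact le_rfl
    refine mul_le_mul (Real.sqrt_le_sqrt (total_mono fun θ b u t => ?_))
      (Real.sqrt_le_sqrt ?_) (Real.sqrt_nonneg _) (Real.sqrt_nonneg _)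
    · split_ifs
      · refine mul_le_mul_of_nonneg_right ?_ (hQ0 _ _ _ _)
        rw [sq]
        exact mul_le_of_le_one_left (pow_nonneg (wt_nonneg u t) c)
          (pow_le_one₀ (wt_nonneg u t) (wt_le_one u t))
      · exact le_rfl
    · rw [total_flipOff]
      simpa using total_le_two hQ1
  have h8 : (0 : ℝ) < 8 ^ c := by positivity
  have := mul_le_mul_of_nonneg_left t2 h8.le
  linarith

/-- `Q'` does not depend on `θ`, so for it the sum over `θ` can be taken first and produces
`2^(-dist)`. Replacing `Q` by `Q'` costs `δ` for each value of the masked bit. -/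
theorem total_wt_le {k : ℕ} {Q : Bits k → Bool → Bits k → Bits k → ℝ}
    {Q' : Bits k → Bits k → ℝ} (hQ0 : ∀ u t, 0 ≤ Q' u t) (hQ1 : ∀ u, ∑ t, Q' u t ≤ 1) {c : ℕ}
    {M : ℝ} (hM0 : 0 ≤ M) (hM : ∀ m : ℕ, (m : ℝ) ^ c * (1 / 2) ^ m ≤ M) {δ : ℝ}
    (hδ : ∀ θ b u, |∑ t, (Q θ b u t - Q' u t) * ((if accepts u θ t then 1 else 0) * wt u t ^ c)| ≤ δ) :
    total (fun θ b u t => if accepts u θ t then wt u t ^ c * Q θ b u t else 0) ≤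
      2 * δ + 2 * (M * ((k : ℝ) ^ c)⁻¹) := by
  have e : ∀ θ b u t, (if accepts u θ t then wt u t ^ c * Q θ b u t else 0) =
      (Q θ b u t - Q' u t) * ((if accepts u θ t then 1 else 0) * wt u t ^ c) +
        (if accepts u θ t then 1 else 0) * (wt u t ^ c * Q' u t) := fun θ b u t => by
    split_ifs <;> ring
  simp only [e]
  rw [total_add]
  refine add_le_add (total_le_two fun θ b u => (le_abs_self _).trans (hδ θ b u)) ?_
  have h1 : total (fun (θ : Bits k) (_ : Bool) u t =>
      (if accepts u θ t then 1 else 0) * (wt u t ^ c * Q' u t)) =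
      2 * (((2 : ℝ) ^ k)⁻¹ * ∑ u, ∑ t, (wt u t ^ c * (((2 : ℝ) ^ k)⁻¹ *
        ∑ θ, if accepts u θ t then (1 : ℝ) else 0)) * Q' u t) := by
    have hs : (∑ θ : Bits k, ∑ u : Bits k, ∑ t : Bits k,
        (if accepts u θ t then (1 : ℝ) else 0) * (wt u t ^ c * Q' u t)) =
        ∑ u, ∑ t, (wt u t ^ c * ∑ θ, if accepts u θ t then (1 : ℝ) else 0) * Q' u t := by
      rw [Finset.sum_comm]
      refine Finset.sum_congr rfl fun u _ => ?_
      rw [Finset.sum_comm]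
      refine Finset.sum_congr rfl fun t _ => ?_
      rw [← Finset.sum_mul]; ring
    have hs' : (∑ u, ∑ t, (wt u t ^ c * (((2 : ℝ) ^ k)⁻¹ *
        ∑ θ, if accepts u θ t then (1 : ℝ) else 0)) * Q' u t) = ((2 : ℝ) ^ k)⁻¹ *
        ∑ u, ∑ t, (wt u t ^ c * ∑ θ, if accepts u θ t then (1 : ℝ) else 0) * Q' u t := by
      simp only [Finset.mul_sum]
      refine Finset.sum_congr rfl fun u _ => Finset.sum_congr rfl fun t _ => ?_
      rw [Finset.sum_mul, Finset.sum_mul, Finset.mul_sum]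
      refine Finset.sum_congr rfl fun θ _ => ?_
      ring
    rw [hs', ← hs, total]
    simp only [Finset.sum_const, Finset.card_univ, Fintype.card_bool, nsmul_eq_mul,
      ← Finset.mul_sum]
    rw [pow_add, mul_inv]
    push_cast
    ring
  rw [h1]
  refine mul_le_mul_of_nonneg_left ?_ (by norm_num)
  simp only [sum_accepts]
  have hin : ∀ u, ∑ t, wt u t ^ c * (1 / 2) ^ dist u t * Q' u t ≤ M * ((k : ℝ) ^ c)⁻¹ := fun u => by
    calc _ ≤ ∑ t, M * ((k : ℝ) ^ c)⁻¹ * Q' u t := Finset.sum_le_sum fun t _ =>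
          mul_le_mul_of_nonneg_right (wt_mul_le hM u t) (hQ0 u t)
      _ = M * ((k : ℝ) ^ c)⁻¹ * ∑ t, Q' u t := by rw [Finset.mul_sum]
      _ ≤ _ := mul_le_of_le_one_right (by positivity) (hQ1 u)
  calc _ ≤ ((2 : ℝ) ^ k)⁻¹ * ∑ _u : Bits k, M * ((k : ℝ) ^ c)⁻¹ :=
        mul_le_mul_of_nonneg_left (Finset.sum_le_sum fun u _ => hin u) (by positivity)
    _ = _ := by
        rw [Finset.sum_const, Finset.card_univ, card_bits, nsmul_eq_mul]
        push_cast
        field_simp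

/-! ### Parity tests -/

theorem chi_update {k : ℕ} (S t : Bits k) (i : Fin k) :
    chi (Function.update S i (!S i)) t = chi S t * sgn (t i) := by
  rw [chi, chi, ← Finset.mul_prod_erase _ _ (Finset.mem_univ i),
    ← Finset.mul_prod_erase (a := i) Finset.univ (fun i => sgn (S i && t i)) (Finset.mem_univ i)]
  have : ∏ x ∈ Finset.univ.erase i, sgn (Function.update S i (!S i) x && t x) =
      ∏ x ∈ Finset.univ.erase i, sgn (S x && t x) :=
    Finset.prod_congr rfl fun j hj => by rw [Function.update_of_ne (Finset.ne_of_mem_erase hj)]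
  rw [this, Function.update_self]
  cases S i <;> cases t i <;> simp [sgn]

/-- All the Fourier coefficients of `D` are bounded by `δ`. -/
def FourierBound {k : ℕ} (δ : ℝ) (D : Bits k → ℝ) : Prop := ∀ S, |∑ t, D t * chi S t| ≤ δ

theorem FourierBound.avg {k : ℕ} {δ : ℝ} {ι : Type*} (s : Finset ι) {r : ℝ} (hr : 0 ≤ r)
    (hs : r * s.card ≤ 1) (hδ : 0 ≤ δ) {D : ι → Bits k → ℝ} (h : ∀ i, FourierBound δ (D i)) :
    FourierBound δ fun t => r * ∑ i ∈ s, D i t := by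
  intro S
  have : ∑ t, (r * ∑ i ∈ s, D i t) * chi S t = r * ∑ i ∈ s, ∑ t, D i t * chi S t := by
    rw [Finset.sum_comm, Finset.mul_sum]
    refine Finset.sum_congr rfl fun t _ => ?_
    rw [mul_assoc, Finset.sum_mul]
  rw [this, abs_mul, abs_of_nonneg hr]
  calc r * |∑ i ∈ s, ∑ t, D i t * chi S t| ≤ r * ∑ _i ∈ s, δ :=
        mul_le_mul_of_nonneg_left ((Finset.abs_sum_le_sum_abs _ _).trans
          (Finset.sum_le_sum fun i _ => h i S)) hr
    _ = (r * s.card) * δ := by rw [Finset.sum_const, nsmul_eq_mul, mul_assoc]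
    _ ≤ δ := mul_le_of_le_one_left hδ hs

/-- A literal is `(1 ± sgn (t i))/2`, and multiplication by `sgn (t i)` permutes the Fourier
coefficients. Each new coefficient is half the sum or difference of two old ones. -/
theorem FourierBound.literal {k : ℕ} {δ : ℝ} {D : Bits k → ℝ} (h : FourierBound δ D) (i : Fin k)
    (v : Bool) : FourierBound δ fun t => D t * if v = t i then 1 else 0 := by
  intro S
  have e : ∀ t : Bits k, (if v = t i then (1 : ℝ) else 0) = (1 + sgn v * sgn (t i)) / 2 := fun t => by
    cases v <;> cases t i <;> norm_num [sgn]
  have : ∑ t, (D t * if v = t i then (1 : ℝ) else 0) * chi S t =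
      ((∑ t, D t * chi S t) + sgn v * ∑ t, D t * chi (Function.update S i (!S i)) t) / 2 := by
    rw [Finset.mul_sum, ← Finset.sum_add_distrib, Finset.sum_div]
    refine Finset.sum_congr rfl fun t _ => ?_
    rw [e, chi_update]; ring
  rw [this, abs_div, abs_two]
  have h1 := h S
  have h2 := h (Function.update S i (!S i))
  have h3 := abs_add_le (∑ t, D t * chi S t) (sgn v * ∑ t, D t * chi (Function.update S i (!S i)) t)
  rw [abs_mul, abs_sgn, one_mul] at h3
  rw [div_le_iff₀ (by norm_num)]
  linarith

/-- The acceptance indicator is a product of literals, one for each position with `θ i = 1`. -/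
theorem FourierBound.accepts {k : ℕ} {δ : ℝ} {D : Bits k → ℝ} (h : FourierBound δ D)
    (θ u : Bits k) : FourierBound δ fun t => D t * if accepts u θ t then 1 else 0 := by
  have e : ∀ t : Bits k, (if CertifiedDeletion.accepts u θ t then (1 : ℝ) else 0) =
      ∏ i, if θ i = true → u i = t i then 1 else 0 := fun t => by
    rw [Finset.prod_ite_zero]
    simp [CertifiedDeletion.accepts]
  simp only [e]
  induction (Finset.univ : Finset (Fin k)) using Finset.induction_on with
  | empty => simpa using h
  | insert i s hi ih =>
    have : ∀ t : Bits k, (D t * ∏ j ∈ insert i s, if θ j = true → u j = t j then (1 : ℝ) else 0) =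
        (D t * ∏ j ∈ s, if θ j = true → u j = t j then (1 : ℝ) else 0) *
          if θ i = true → u i = t i then 1 else 0 := fun t => by
      rw [Finset.prod_insert hi]; ring
    simp only [this]
    cases hθ : θ i
    · simpa [hθ] using ih
    · have := ih.literal i (u i)
      simpa [hθ] using this

/-- The weight is the average of the `k` literals that test for a disagreement, so each factor
preserves the bound. An indicator of a large distance would not have this property. -/
theorem FourierBound.wt {k : ℕ} {δ : ℝ} (hδ : 0 ≤ δ) {D : Bits k → ℝ} (h : FourierBound δ D)
    (u : Bits k) (c : ℕ) : FourierBound δ fun t => D t * wt u t ^ c := by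
  induction c with
  | zero => simpa using h
  | succ c ih =>
    have e : ∀ t : Bits k, D t * CertifiedDeletion.wt u t ^ (c + 1) =
        (k : ℝ)⁻¹ * ∑ i, (D t * CertifiedDeletion.wt u t ^ c) * if (!u i) = t i then 1 else 0 :=
      fun t => by
        have : CertifiedDeletion.wt u t = (k : ℝ)⁻¹ * ∑ i, if (!u i) = t i then 1 else 0 := by
          rw [CertifiedDeletion.wt, dist, div_eq_inv_mul]
          push_cast
          congr 1
          refine Finset.sum_congr rfl fun i _ => ?_
          cases u i <;> cases t i <;> simp
        rw [pow_succ, ← Finset.mul_sum, ← mul_assoc]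
        nth_rewrite 2 [this]
        ring
    simp only [e]
    refine FourierBound.avg Finset.univ (by positivity) ?_ hδ fun i => ih.literal i _
    rw [Finset.card_univ, Fintype.card_fin]
    -- Also valid for `k = 0`, where the inverse is `0`.
    exact inv_mul_le_one

theorem FourierBound.sum_le {k : ℕ} {δ : ℝ} {D : Bits k → ℝ} (h : FourierBound δ D) :
    |∑ t, D t| ≤ δ := by
  have := h fun _ => false
  simpa [chi, sgn] using this

/-! ### Negligible functions -/

/-- The constant is absorbed by passing to the exponent `c + 1` and to `k > C`. -/
theorem negligible_of_le_mul {f : ℕ → ℝ}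
    (h : ∀ c : ℕ, ∃ (C : ℝ) (N : ℕ), ∀ k : ℕ, N < k → f k ≤ C * ((k : ℝ) ^ c)⁻¹) :
    Negligible f := by
  intro c
  obtain ⟨C, N, hC⟩ := h (c + 1)
  obtain ⟨M, hM⟩ := exists_nat_gt C
  refine ⟨max N M, fun k hk => ?_⟩
  have hkN := (le_max_left N M).trans_lt hk
  have hkM := (le_max_right N M).trans_lt hk
  have hk0 : (0 : ℝ) < k := by exact_mod_cast (Nat.zero_le _).trans_lt hk
  refine (hC k hkN).trans_lt ?_
  rw [pow_succ, mul_inv, mul_left_comm]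
  refine mul_lt_of_lt_one_right (by positivity) ?_
  rw [← div_eq_mul_inv, div_lt_one hk0]
  exact hM.trans (by exact_mod_cast hkM)

theorem Negligible.mono {f g : ℕ → ℝ} (hg : Negligible g) (h : ∀ k, f k ≤ g k) : Negligible f :=
  fun c => (hg c).imp fun _ hN k hk => (h k).trans_lt (hN k hk)

theorem Negligible.mul {f : ℕ → ℝ} (hf : Negligible f) {C : ℝ} (hC : 0 ≤ C) :
    Negligible fun k => C * f k :=
  negligible_of_le_mul fun c => (hf c).elim fun N hN =>
    ⟨C, N, fun k hk => mul_le_mul_of_nonneg_left (hN k hk).le hC⟩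

theorem Negligible.add {f g : ℕ → ℝ} (hf : Negligible f) (hg : Negligible g) :
    Negligible fun k => f k + g k := negligible_of_le_mul fun c => by
  obtain ⟨N, hN⟩ := hf c
  obtain ⟨M, hM⟩ := hg c
  refine ⟨2, max N M, fun k hk => ?_⟩
  have := hN k ((le_max_left N M).trans_lt hk)
  have := hM k ((le_max_right N M).trans_lt hk)
  linarith

theorem PolyBounded.mono {f g : ℕ → ℕ} (hg : PolyBounded g) (h : ∀ k, f k ≤ g k) :
    PolyBounded f := hg.imp fun _ hp k => (h k).trans (hp k)

theorem PolyBounded.add {f g : ℕ → ℕ} (hf : PolyBounded f) (hg : PolyBounded g) :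
    PolyBounded fun k => f k + g k := by
  obtain ⟨p, hp⟩ := hf
  obtain ⟨q, hq⟩ := hg
  exact ⟨p + q, fun k => by rw [Polynomial.eval_add]; exact add_le_add (hp k) (hq k)⟩

theorem polyBounded_linear (a b : ℕ) : PolyBounded fun k => a * k + b :=
  ⟨Polynomial.C a * Polynomial.X + Polynomial.C b, fun k => by simp⟩

/-! ### Consequences of semantic security -/

namespace ABE

/-- Adversaries are non-uniform, so the worst member of the finite family can be chosen separately
for each `k`. This choice is itself one adversary of polynomial size, and its advantage bounds all
the others. -/
theorem Secure.uniform {E : ABE fun k => k + 1} (hE : E.Secure) {I : ℕ → Type}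
    [∀ k, Finite (I k)] [∀ k, Nonempty (I k)] (R : ∀ k, I k → E.Adversary k) {s : ℕ → ℕ}
    (hs : PolyBounded s) (hR : ∀ k i, (R k i).size ≤ s k) :
    ∃ δ : ℕ → ℝ, Negligible δ ∧ ∀ k i, |E.game k (R k i) false - E.game k (R k i) true| ≤ δ k := by
  choose i hi using fun k => Finite.exists_max fun i =>
    |E.game k (R k i) false - E.game k (R k i) true|
  exact ⟨_, hE (fun k => R k (i k)) (hs.mono fun k => hR k (i k)), fun k j => hi k j⟩

variable (E : ABE fun k => k + 1) {k : ℕ} (A : E.Attacker k)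

/-- The reduction that outputs the parity of the bits in `S` of the certificate. -/
def parityTest (m : Bits (k + 1)) (u S : Bits k) : E.Adversary k :=
  E.reduction A (extra m fun _ => false) (extra₀ k) (extra₁ k) u (fun _ => true)
    ((quantum (parityCircuit (A.cert.trans (fstWires A.n ((k + 1) + (k + 1) + 1)))
      (sndWires A.n _ (blank k)) S)).map Instr.gate) (sndWires A.n _ (blank k))

theorem game_parityTest (m : Bits (k + 1)) (u S : Bits k) (b : Bool) :
    E.game k (E.parityTest A m u S) b =
      ∑ t, (1 - chi S t) / 2 * E.certProb A (if b then fun _ => false else m) u t := by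
  rw [parityTest, game_reduction, extra_comp₀, extra_comp₁]
  simp only [KeySystem.run_gates]
  simp only [probOne_parityCircuit A.cert (blank k) S _ _ (extra_blank m _)]
  rw [E.branch_sum]
  rfl

theorem parityTest_size (m : Bits (k + 1)) (u S : Bits k) :
    (E.parityTest A m u S).size ≤ A.size + (6 * k + 3) := by
  refine (E.size_reduction_le A _ _ _ _ _ _ _).trans ?_
  have := length_parityCircuit_le (A.cert.trans (fstWires A.n ((k + 1) + (k + 1) + 1)))
    (sndWires A.n _ (blank k)) S
  simp only [quantum, List.length_map]
  omega

/-- The output probability is the sum of `(1 - chi S t)/2` against the certificate weights. Both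
plaintexts give the same total weight, so the constant terms cancel and half the Fourier coefficient
is left. -/
theorem abs_sum_certProb_le (m : Bits (k + 1)) (u S : Bits k) :
    |∑ t, (E.certProb A m u t - E.certProb A (fun _ => false) u t) * chi S t| =
      2 * |E.game k (E.parityTest A m u S) false - E.game k (E.parityTest A m u S) true| := by
  have h := E.sum_certProb_eq A m (fun _ => false) u
  rw [game_parityTest, game_parityTest, ← abs_two, ← abs_mul, ← abs_neg, abs_two]
  congr 1
  simp only [if_true, Bool.false_eq_true, if_false]
  rw [← Finset.sum_sub_distrib, Finset.mul_sum, ← Finset.sum_neg_distrib, ← sub_eq_zero,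
    ← Finset.sum_sub_distrib]
  rw [← sub_eq_zero, ← Finset.sum_sub_distrib] at h
  rw [← neg_eq_zero, ← h, ← Finset.sum_neg_distrib]
  refine Finset.sum_congr rfl fun t _ => by ring

theorem exists_fourierBound (hE : E.Secure) (A : ∀ k, E.Attacker k)
    (hA : PolyBounded fun k => (A k).size) : ∃ δ : ℕ → ℝ, Negligible δ ∧ ∀ k m u,
      FourierBound (δ k) fun t => E.certProb (A k) m u t - E.certProb (A k) (fun _ => false) u t := by
  obtain ⟨δ, hδ, h⟩ := hE.uniform (I := fun k => Bits (k + 1) × Bits k × Bits k)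
    (fun k i => E.parityTest (A k) i.1 i.2.1 i.2.2) (hA.add (polyBounded_linear 6 3))
    fun k i => E.parityTest_size (A k) _ _ _
  refine ⟨fun k => 2 * δ k, hδ.mul (by norm_num), fun k m u S => ?_⟩
  rw [abs_sum_certProb_le]
  exact mul_le_mul_of_nonneg_left (h k (m, u, S)) (by norm_num)

/-- The estimate is used with exponent `2 * c`, because the square root from Cauchy–Schwarz halves
it. -/
theorem total_certProb_le (hk : 0 < k) {δ : ℝ} (hF : ∀ m u,
      FourierBound δ fun t => E.certProb A m u t - E.certProb A (fun _ => false) u t) {c : ℕ}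
    {M : ℝ} (hM0 : 0 ≤ M) (hM : ∀ m : ℕ, (m : ℝ) ^ (2 * c) * (1 / 2) ^ m ≤ M)
    (hδ : δ ≤ ((k : ℝ) ^ (2 * c))⁻¹) :
    (total fun θ b u t => if accepts u θ t then √(E.certProb A (plaintext θ b) u t) *
      √(E.certProb A (plaintext θ b) (flipOff θ u) t) else 0) ≤
      2 * (291 / 324 : ℝ) ^ k + 2 * 8 ^ (2 * c) * (√(2 + 2 * M) * ((k : ℝ) ^ c)⁻¹ * √2) := by
  have hk1 : (0 : ℝ) < k := by exact_mod_cast hk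
  refine (total_sqrt_le (Q := fun θ b u t => E.certProb A (plaintext θ b) u t) hk
    (fun θ b u t => E.certProb_nonneg A _ _ _)
    (fun θ b u => E.sum_certProb_le_one A _ _) (2 * c)).trans ?_
  -- Any single coefficient bound forces nonnegativity; the strings are arbitrary.
  have hδ0 : 0 ≤ δ := (abs_nonneg _).trans (hF (fun _ => false) (fun _ => false) fun _ => false)
  have h2 := total_wt_le (Q := fun θ b u t => E.certProb A (plaintext θ b) u t)
    (Q' := fun u t => E.certProb A (fun _ => false) u t) (k := k)
    (fun u t => E.certProb_nonneg A _ _ _) (fun u => E.sum_certProb_le_one A _ _) hM0 hM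
    (δ := δ) fun θ b u => by
      have := (((hF (plaintext θ b) u).accepts θ u).wt hδ0 u (2 * c)).sum_le
      simpa only [mul_assoc] using this
  have h3 : √(total fun θ b u t => if accepts u θ t then
      wt u t ^ (2 * c) * E.certProb A (plaintext θ b) u t else 0) ≤
      √(2 + 2 * M) * ((k : ℝ) ^ c)⁻¹ := by
    have : √(((k : ℝ) ^ (2 * c))⁻¹) = ((k : ℝ) ^ c)⁻¹ := by
      rw [mul_comm, pow_mul, Real.sqrt_inv, Real.sqrt_sq (by positivity)]
    rw [← this, ← Real.sqrt_mul (by positivity)]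
    refine Real.sqrt_le_sqrt (h2.trans ?_)
    linarith
  gcongr

/-- The bound involves only the distribution of the certificates, so one `β` serves all contractive
functionals at once, including those that no efficient machine realizes. -/
theorem exists_acceptPart_bound (hE : E.Secure) (A : ∀ k, E.Attacker k)
    (hA : PolyBounded fun k => (A k).size) : ∃ β : ℕ → ℝ, Negligible β ∧
      ∀ k (f : Bits (E.mskLen k) → Bits (E.attrLen k) → Op (A k).n → ℝ),
        (∀ msk X, Contractive (f msk X)) →
          |E.acceptPart (A k) false f - E.acceptPart (A k) true f| ≤ β k := by
  obtain ⟨δ, hδ, hF⟩ := E.exists_fourierBound hE A hA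
  refine ⟨fun k => total fun θ b u t => if accepts u θ t then
    √(E.certProb (A k) (plaintext θ b) u t) *
      √(E.certProb (A k) (plaintext θ b) (flipOff θ u) t) else 0, ?_,
    fun k f hf => E.acceptPart_sub_le (A k) hf⟩
  refine negligible_of_le_mul fun c => ?_
  obtain ⟨M, hM0, hM⟩ := exists_pow_le (2 * c)
  obtain ⟨N, hN⟩ := hδ (2 * c)
  obtain ⟨B, hB⟩ := (tendsto_pow_const_mul_const_pow_of_lt_one c
    (by norm_num : (0 : ℝ) ≤ 291 / 324) (by norm_num)).bddAbove_range
  refine ⟨2 * B + 2 * 8 ^ (2 * c) * (√(2 + 2 * M) * √2), N, fun k hk => ?_⟩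
  have hk0 : 0 < k := (Nat.zero_le _).trans_lt hk
  have hk1 : (0 : ℝ) < k := by exact_mod_cast hk0
  have h1 : (291 / 324 : ℝ) ^ k ≤ B * ((k : ℝ) ^ c)⁻¹ := by
    rw [← div_eq_mul_inv, le_div_iff₀ (by positivity), mul_comm]
    exact hB ⟨k, rfl⟩
  refine (E.total_certProb_le (A k) hk0 (hF k) hM0 hM (hN k hk).le).trans ?_
  calc _ ≤ 2 * (B * ((k : ℝ) ^ c)⁻¹) + 2 * 8 ^ (2 * c) * (√(2 + 2 * M) * ((k : ℝ) ^ c)⁻¹ * √2) := by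
        linarith
    _ = _ := by ring

/-- The value of `f` at the end of the second phase. -/
def fullPart (b : Bool) (f : Bits (E.mskLen k) → Bits (E.attrLen k) → Op A.n → ℝ) : ℝ :=
  ∑ p : Bits k × Bits k, ((2 : ℝ) ^ (k + k))⁻¹ *
    E.branch A (plaintext p.2 (b ^^ parity p.1 p.2)) (ketbra (bb84 p.1 p.2))
      fun msk X ρ => ∑ t, f msk X (project A.cert t ρ)

/-- Rejected runs are written as all runs minus accepted ones. The part that is left to a
computational or a trace argument then no longer mentions the verification. -/
theorem deletionGame_eq_parts (b : Bool) (bot : Op A.n → ℝ)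
    {f g : Bits (E.mskLen k) → Bits (E.attrLen k) → Op A.n → ℝ}
    (hf : ∀ msk X, IsLinearMap ℝ (f msk X)) (hg : ∀ msk X, IsLinearMap ℝ (g msk X)) :
    E.withDeletion.deletionGame k A.toAdversary b bot
      (fun msk X v ρ => if v then f msk X ρ else g msk X ρ) =
      E.exitPart A bot + (E.acceptPart A b f + E.fullPart A b g - E.acceptPart A b g) := by
  refine (E.deletionGame_eq A b bot (final := fun msk X v ρ => if v then f msk X ρ else g msk X ρ)
    fun msk X v => by cases v; exacts [hg msk X, hf msk X]).trans ?_
  congr 1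
  rw [acceptPart, acceptPart, fullPart, ← Finset.sum_add_distrib, ← Finset.sum_sub_distrib]
  refine Finset.sum_congr rfl fun p _ => ?_
  rw [← mul_add, ← mul_sub]
  congr 1
  have := E.branch_sum A (plaintext p.2 (b ^^ parity p.1 p.2)) (ketbra (bb84 p.1 p.2))
    ![1, 1, -1] ![fun msk X ρ => ∑ t, if accepts p.1 p.2 t then f msk X (project A.cert t ρ) else 0,
      fun msk X ρ => ∑ t, g msk X (project A.cert t ρ),
      fun msk X ρ => ∑ t, if accepts p.1 p.2 t then g msk X (project A.cert t ρ) else 0]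
  simp only [Fin.sum_univ_three, Matrix.cons_val_zero, Matrix.cons_val_one, Matrix.cons_val,
    one_mul, neg_mul, ← sub_eq_add_neg] at this
  rw [← this]
  congr 1
  funext msk X ρ
  rw [← Finset.sum_add_distrib, ← Finset.sum_sub_distrib]
  refine Finset.sum_congr rfl fun t _ => ?_
  by_cases h : accepts p.1 p.2 t = true
  · simp only [if_pos h]; ring
  · simp only [if_neg h]; ring

theorem abs_fullPart_sub_le {f : Bits (E.mskLen k) → Bits (E.attrLen k) → Op A.n → ℝ} {δ : ℝ}
    (h : ∀ x θ : Bits k, |E.branch A (plaintext θ false) (ketbra (bb84 x θ))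
        (fun msk X ρ => ∑ t, f msk X (project A.cert t ρ)) -
      E.branch A (plaintext θ true) (ketbra (bb84 x θ))
        (fun msk X ρ => ∑ t, f msk X (project A.cert t ρ))| ≤ δ) :
    |E.fullPart A false f - E.fullPart A true f| ≤ δ := by
  rw [fullPart, fullPart, ← Finset.sum_sub_distrib]
  calc _ ≤ ∑ _p : Bits k × Bits k, ((2 : ℝ) ^ (k + k))⁻¹ * δ := by
        refine (Finset.abs_sum_le_sum_abs _ _).trans (Finset.sum_le_sum fun p _ => ?_)
        rw [← mul_sub, abs_mul, abs_of_nonneg (by positivity)]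
        refine mul_le_mul_of_nonneg_left ?_ (by positivity)
        have := h p.1 p.2
        -- For odd parity the two plaintexts are exchanged, which the absolute value does not
        -- notice.
        cases parity p.1 p.2
        · exact this
        · rwa [abs_sub_comm] at this
    _ = δ := by
        rw [Finset.sum_const, Finset.card_univ, Fintype.card_prod, card_bits, nsmul_eq_mul]
        push_cast
        rw [pow_add]
        field_simp

/-- The exits cancel; one `β` comes from `f` on the accepted runs and one from `g`, which was
subtracted there. -/
theorem abs_deletionGame_sub_le {bot : Op A.n → ℝ}
    {f g : Bits (E.mskLen k) → Bits (E.attrLen k) → Op A.n → ℝ} {β δ : ℝ}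
    (hβ : ∀ f : Bits (E.mskLen k) → Bits (E.attrLen k) → Op A.n → ℝ,
      (∀ msk X, Contractive (f msk X)) → |E.acceptPart A false f - E.acceptPart A true f| ≤ β)
    (hf : ∀ msk X, Contractive (f msk X)) (hg : ∀ msk X, Contractive (g msk X))
    (hδ : |E.fullPart A false g - E.fullPart A true g| ≤ δ) :
    |E.withDeletion.deletionGame k A.toAdversary false bot
        (fun msk X v ρ => if v then f msk X ρ else g msk X ρ) -
      E.withDeletion.deletionGame k A.toAdversary true bot
        (fun msk X v ρ => if v then f msk X ρ else g msk X ρ)| ≤ 2 * β + δ := by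
  have lf := fun msk X => (hf msk X).linear
  have lg := fun msk X => (hg msk X).linear
  rw [E.deletionGame_eq_parts A false bot lf lg, E.deletionGame_eq_parts A true bot lf lg]
  have h1 := abs_le.mp (hβ f hf)
  have h2 := abs_le.mp (hβ g hg)
  have h3 := abs_le.mp hδ
  rw [abs_le]
  constructor <;> linarith [h1.1, h1.2, h2.1, h2.2, h3.1, h3.2]

/-! ### The computational experiment -/

/-- The last phase of the computational experiment. -/
def lastPhase (v : Bool) (msk : Bits (E.mskLen k)) (X : Bits (E.attrLen k)) (ρ : Op A.n) : ℝ :=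
  E.run k msk (fun d P => !E.eval k d P X) A.post [] (writeBit A.res v ρ)
    fun _ ρ' => probOne A.out ρ'

theorem contractive_lastPhase (v : Bool) (msk : Bits (E.mskLen k)) (X : Bits (E.attrLen k)) :
    Contractive (E.lastPhase A v msk X) := by
  have h := E.run_contractive k msk (fun d P => !E.eval k d P X) A.post []
    (contractive_probOne A.out)
  have hw : (writeBit A.res v : Op A.n → Op A.n) = write (wire A.res) fun _ => v :=
    funext fun ρ => writeBit_eq_write _ _ ρ
  refine Contractive.comp (T := writeBit A.res v) h ?_ ?_ ?_
  · rw [hw]; exact hasKraus_write _ _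
  · exact isLinearMap_writeBit _ _
  · intro ρ
    rw [writeBit_eq_write, trace_write]

/-- The reduction that tells the adversary that its certificate is not accepted. -/
def rejectTest (x θ : Bits k) : E.Adversary k :=
  E.reduction A (extra (plaintext θ false) (plaintext θ true)) (extra₀ k) (extra₁ k) x θ
    (((measureAll A.cert ++ [Gate.reset A.res]).map Instr.gate ++ A.post).map
      (Instr.map (fstWires A.n _))) (fstWires A.n _ A.out)

theorem rejectTest_size (x θ : Bits k) : (E.rejectTest A x θ).size ≤ A.size + A.size +
    (6 * k + 4) := by
  refine (E.size_reduction_le A _ _ _ _ _ _ _).trans ?_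
  have h1 : (measureAll A.cert).length ≤ k * 1 := length_sweep_le _ fun i => by simp
  have h2 : A.post.length ≤ A.size := by rw [Attacker.size]; omega
  simp only [List.length_map, List.length_append, List.length_singleton]
  omega

/-- The certificate is measured but never checked: the reset writes the answer for a rejected
certificate in every run. This is exactly the functional in `fullPart`. -/
theorem game_rejectTest (x θ : Bits k) (b : Bool) : E.game k (E.rejectTest A x θ) b =
    E.branch A (plaintext θ b) (ketbra (bb84 x θ)) fun msk X ρ =>
      ∑ t, E.lastPhase A false msk X (project A.cert t ρ) := by
  rw [rejectTest, game_reduction, extra_comp₀, extra_comp₁]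
  have hb : (if b then plaintext θ true else plaintext θ false) = plaintext θ b := by
    cases b <;> rfl
  rw [hb]
  congr 1
  funext msk X ρ
  rw [KeySystem.run_tensor, KeySystem.run_append, KeySystem.run_gates]
  simp only [probOne_tensor]
  rw [← IsLinearMap.map_sum' (E.contractive_lastPhase A false msk X).linear, applyCircuit_append,
    applyCircuit_measureAll]
  rfl

theorem negligible_cExp (hE : E.Secure) (A : ∀ k, E.Attacker k)
    (hA : PolyBounded fun k => (A k).size) :
    Negligible fun k => |E.withDeletion.cExp k (A k).toAdversary false -
      E.withDeletion.cExp k (A k).toAdversary true| := by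
  obtain ⟨β, hβ, hacc⟩ := E.exists_acceptPart_bound hE A hA
  obtain ⟨δ, hδ, hrej⟩ := hE.uniform (I := fun k => Bits k × Bits k)
    (fun k i => E.rejectTest (A k) i.1 i.2) ((hA.add hA).add (polyBounded_linear 6 4))
    fun k i => E.rejectTest_size (A k) _ _
  refine ((hβ.mul (C := 2) (by norm_num)).add hδ).mono fun k => ?_
  have hc : ∀ b, E.withDeletion.cExp k (A k).toAdversary b =
      E.withDeletion.deletionGame k (A k).toAdversary b (fun _ => 0) (fun msk X v ρ =>
        if v then E.lastPhase (A k) true msk X ρ else E.lastPhase (A k) false msk X ρ) := by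
    intro b
    rw [CDABE.cExp]
    congr 1
    funext msk X v ρ
    cases v <;> rfl
  rw [hc, hc]
  refine E.abs_deletionGame_sub_le (A k) (hacc k) (E.contractive_lastPhase _ _)
    (E.contractive_lastPhase _ _) (E.abs_fullPart_sub_le (A k) fun x θ => ?_)
  have := hrej k (x, θ)
  rwa [game_rejectTest, game_rejectTest] at this

end ABE

section

open CDABE (outState outBot)

/-! ### The trace norm -/

/-- In an eigenbasis `W` is the sign of `D`, so `W * D` is the absolute value of `D`, the positive
square root of `Dᴴ * D`. -/
theorem exists_unitary_traceNorm {ι : Type} [Fintype ι] [DecidableEq ι] {D : Matrix ι ι ℂ}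
    (hD : D.IsHermitian) :
    ∃ W ∈ Matrix.unitaryGroup ι ℂ, traceNorm D = (W * D).trace.re := by
  set U : Matrix ι ι ℂ := (hD.eigenvectorUnitary : Matrix ι ι ℂ) with hU
  have hUU : star U * U = 1 := Matrix.mem_unitaryGroup_iff'.mp hD.eigenvectorUnitary.2
  have hUU' : U * star U = 1 := Matrix.mem_unitaryGroup_iff.mp hD.eigenvectorUnitary.2
  have hDU : D = U * Matrix.diagonal (fun i => (hD.eigenvalues i : ℂ)) * star U := by
    have := hD.spectral_theorem
    rw [Unitary.conjStarAlgAut_apply] at this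
    exact this
  have hmul : ∀ a b : ι → ℂ, U * Matrix.diagonal a * star U * (U * Matrix.diagonal b * star U) =
      U * Matrix.diagonal (a * b) * star U := fun a b => by
    calc _ = U * Matrix.diagonal a * (star U * U) * Matrix.diagonal b * star U := by
          simp only [Matrix.mul_assoc]
      _ = _ := by
          rw [hUU, Matrix.mul_one, Matrix.mul_assoc U, Matrix.diagonal_mul_diagonal]; rfl
  -- The sign on the kernel is `1`, not `0`, so that `W` is unitary.
  set s : ι → ℂ := fun i => if hD.eigenvalues i < 0 then -1 else 1 with hs
  have hWD : U * Matrix.diagonal s * star U * D =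
      U * Matrix.diagonal (fun i => ((|hD.eigenvalues i| : ℝ) : ℂ)) * star U := by
    conv_lhs => rw [hDU]
    rw [hmul]
    congr 3
    funext i
    simp only [hs, Pi.mul_apply]
    split_ifs with h
    · rw [abs_of_neg h]; push_cast; ring
    · rw [abs_of_nonneg (not_lt.mp h), one_mul]
  refine ⟨U * Matrix.diagonal s * star U, ?_, ?_⟩
  · rw [Matrix.mem_unitaryGroup_iff']
    have hst : star (U * Matrix.diagonal s * star U) = U * Matrix.diagonal s * star U := by
      rw [star_mul, star_mul, star_star, Matrix.mul_assoc]
      congr 2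
      rw [Matrix.star_eq_conjTranspose, Matrix.diagonal_conjTranspose]
      congr 1
      funext i
      simp only [hs, Pi.star_apply]
      split_ifs <;> simp
    rw [hst, hmul]
    have : s * s = 1 := by
      funext i
      simp only [hs, Pi.mul_apply, Pi.one_apply]
      split_ifs <;> norm_num
    rw [this]
    change U * Matrix.diagonal (fun _ => 1) * star U = 1
    rw [Matrix.diagonal_one, Matrix.mul_one, hUU']
  · rw [traceNorm, hWD]
    congr 2
    refine CFC.sqrt_unique ?_ ?_
    · rw [hD.eq]
      conv_rhs => rw [hDU]
      rw [hmul, hmul]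
      congr 3
      funext i
      simp only [Pi.mul_apply]
      rw [← Complex.ofReal_mul, abs_mul_abs_self, Complex.ofReal_mul]
    · rw [Matrix.nonneg_iff_posSemidef, Matrix.star_eq_conjTranspose]
      refine Matrix.PosSemidef.mul_mul_conjTranspose_same ?_ U
      rw [Matrix.posSemidef_diagonal_iff]
      intro i
      exact_mod_cast abs_nonneg (hD.eigenvalues i)

/-! ### Hermiticity -/

theorem conjTranspose_project {ι : Type} [Fintype ι] {n : ℕ} (w : ι → Fin n) (t : ι → Bool)
    (ρ : Op n) : (project w t ρ).conjTranspose = project w t ρ.conjTranspose := by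
  ext y z
  simp only [project, Matrix.conjTranspose_apply, Matrix.of_apply, and_comm, apply_ite star,
    star_zero]

theorem conjTranspose_load {m n : ℕ} (w : Fin m ↪ Fin n) (σ : Op m) (ρ : Op n) :
    (load w σ ρ).conjTranspose = load w σ.conjTranspose ρ.conjTranspose := by
  ext y z
  simp only [load, Matrix.conjTranspose_apply, Matrix.of_apply, star_mul', star_sum]

theorem conjTranspose_basisOp {n : ℕ} (s : Bits n) : (basisOp s).conjTranspose = basisOp s := by
  rw [basisOp, Matrix.conjTranspose_single, star_one]

theorem conjTranspose_write {m n : ℕ} (w : Fin m ↪ Fin n) (s : Bits m) (ρ : Op n) :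
    (write w s ρ).conjTranspose = write w s ρ.conjTranspose := by
  rw [write, conjTranspose_load, conjTranspose_basisOp, write]

theorem conjTranspose_ketbra {n : ℕ} (φ : Bits n → ℂ) : (ketbra φ).conjTranspose = ketbra φ := by
  rw [ketbra, Matrix.conjTranspose_vecMulVec, star_star]

theorem conjTranspose_tensor {a b : ℕ} (A : Op a) (B : Op b) :
    (tensor A B).conjTranspose = tensor A.conjTranspose B.conjTranspose := by
  ext y z
  simp only [tensor, Matrix.conjTranspose_apply, Matrix.of_apply, star_mul']

theorem conjTranspose_gate {n : ℕ} (g : Gate n) (ρ : Op n) :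
    (g.apply ρ).conjTranspose = g.apply ρ.conjTranspose := by
  cases g with
  | unitary u loc => simp only [Gate.apply, Matrix.conjTranspose_mul, Matrix.conjTranspose_conjTranspose,
      Matrix.mul_assoc]
  | measure i => simp only [Gate.apply, projectBit, Matrix.conjTranspose_add, conjTranspose_project]
  | reset i => simp only [Gate.apply, writeBit_eq_write, conjTranspose_write]

theorem isLinearMap_conjTranspose {ι : Type} :
    IsLinearMap ℝ (Matrix.conjTranspose : Matrix ι ι ℂ → Matrix ι ι ℂ) where
  map_add A B := Matrix.conjTranspose_add A B
  map_smul r A := by ext y z; simp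

theorem KeySystem.conjTranspose_run (K : KeySystem) (k : ℕ) (msk : Bits (K.mskLen k))
    (allow : ∀ d, Bits d → Bool) {n : ℕ} {ι : Type} {final : List (Σ d, Bits d) → Op n → Matrix ι ι ℂ}
    (hf : ∀ h ρ, (final h ρ).conjTranspose = final h ρ.conjTranspose)
    (is : List (Instr (K.skLen k) n)) (h : List (Σ d, Bits d)) (ρ : Op n) :
    (K.run k msk allow is h ρ final).conjTranspose =
      K.run k msk allow is h ρ.conjTranspose final := by
  induction is generalizing h ρ with
  | nil => exact hf h ρ
  | cons i is ih =>
    cases i with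
    | gate g => rw [KeySystem.run, KeySystem.run, ih, conjTranspose_gate]
    | query ctrl d pred ans =>
      rw [KeySystem.run, KeySystem.run, Matrix.conjTranspose_add, Matrix.conjTranspose_sum, ih,
        projectBit, conjTranspose_project]
      congr 1
      refine Finset.sum_congr rfl fun P _ => ?_
      split_ifs
      · rw [map_avg isLinearMap_conjTranspose]
        refine congrArg avg (funext fun c => ?_)
        rw [ih, conjTranspose_write, conjTranspose_project, projectBit, conjTranspose_project]
        rfl
      · rw [ih, conjTranspose_write, conjTranspose_project, projectBit, conjTranspose_project]
        rfl

theorem conjTranspose_outState {n : ℕ} (ρ : Op n) :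
    (outState ρ).conjTranspose = outState ρ.conjTranspose := by
  ext y z
  cases y <;> cases z <;> simp [outState, Matrix.conjTranspose_apply]

theorem conjTranspose_outBot {n : ℕ} (ρ : Op n) :
    (outBot ρ).conjTranspose = outBot ρ.conjTranspose := by
  rw [outBot, outBot, Matrix.conjTranspose_single, Matrix.trace_conjTranspose]

/-- Needed only to apply the spectral theorem to the difference of the two outputs. -/
theorem CDABE.isHermitian_deletionGame (S : CDABE)
    (hS : ∀ k pk X b vk, (S.enc k pk X b vk).IsHermitian) {k : ℕ} (A : S.Adversary k) (b : Bool)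
    {ι : Type} {bot : Op A.n → Matrix ι ι ℂ}
    {final : Bits (S.mskLen k) → Bits (S.attrLen k) → Bool → Op A.n → Matrix ι ι ℂ}
    (hbot : ∀ ρ, (bot ρ).conjTranspose = bot ρ.conjTranspose)
    (hf : ∀ msk X v ρ, (final msk X v ρ).conjTranspose = final msk X v ρ.conjTranspose) :
    (S.deletionGame k A b bot final).IsHermitian := by
  rw [Matrix.IsHermitian, CDABE.deletionGame, map_avg isLinearMap_conjTranspose]
  refine congrArg avg (funext fun c => ?_)
  rw [KeySystem.conjTranspose_run, conjTranspose_write, conjTranspose_ketbra]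
  intro h ρ
  rw [Matrix.conjTranspose_sum]
  refine Finset.sum_congr rfl fun X _ => ?_
  rw [← conjTranspose_project]
  split_ifs
  · rw [Matrix.conjTranspose_sum]
    refine Finset.sum_congr rfl fun vk _ => ?_
    rw [KeySystem.conjTranspose_run, conjTranspose_load, (hS _ _ _ _ _).eq]
    intro _ ρ'
    rw [Matrix.conjTranspose_sum]
    refine Finset.sum_congr rfl fun t _ => ?_
    rw [hf, conjTranspose_project]
  · rw [hbot]

theorem CDABE.map_deletionGame (S : CDABE) {k : ℕ} (A : S.Adversary k) (b : Bool)
    {V W : Type} [AddCommGroup V] [Module ℝ V] [AddCommGroup W] [Module ℝ W] {L : V → W}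
    (hL : IsLinearMap ℝ L) (bot : Op A.n → V)
    (final : Bits (S.mskLen k) → Bits (S.attrLen k) → Bool → Op A.n → V) :
    L (S.deletionGame k A b bot final) =
      S.deletionGame k A b (fun ρ => L (bot ρ)) fun msk X v ρ => L (final msk X v ρ) := by
  rw [CDABE.deletionGame, map_avg hL, CDABE.deletionGame]
  refine congrArg avg (funext fun c => ?_)
  rw [KeySystem.run_map _ _ _ _ hL]
  refine congrArg (KeySystem.run _ _ _ _ _ _ _) (funext fun h => funext fun ρ => ?_)
  rw [IsLinearMap.map_sum' hL]
  refine Finset.sum_congr rfl fun X _ => ?_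
  rw [apply_ite L, IsLinearMap.map_sum' hL]
  congr 1
  refine Finset.sum_congr rfl fun vk _ => ?_
  rw [KeySystem.run_map _ _ _ _ hL]
  refine congrArg (KeySystem.run _ _ _ _ _ _ _) (funext fun h => funext fun ρ => ?_)
  rw [IsLinearMap.map_sum' hL]

/-! ### Functionals given by unitary matrices -/

theorem isLinearMap_outState {n : ℕ} : IsLinearMap ℝ (outState : Op n → _) where
  map_add A B := by ext y z; cases y <;> cases z <;> simp [outState]
  map_smul r A := by ext y z; cases y <;> cases z <;> simp [outState]

theorem outState_vecMulVec {n : ℕ} (φ ψ : Bits n → ℂ) :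
    outState (Matrix.vecMulVec φ (star ψ)) = Matrix.vecMulVec (fun y : Option (Bits n) =>
      y.elim 0 φ) (star fun y : Option (Bits n) => y.elim 0 ψ) := by
  ext y z
  cases y <;> cases z <;> simp [outState, Matrix.vecMulVec_apply]

theorem isLinearMap_re_trace_mul {ι : Type} [Fintype ι] (W : Matrix ι ι ℂ) :
    IsLinearMap ℝ fun M : Matrix ι ι ℂ => (W * M).trace.re where
  map_add A B := by simp [Matrix.mul_add]
  map_smul r A := by simp [Matrix.trace_smul]

theorem sum_norm_unitary_mulVec {ι : Type} [Fintype ι] [DecidableEq ι] {W : Matrix ι ι ℂ}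
    (hW : W ∈ Matrix.unitaryGroup ι ℂ) (φ : ι → ℂ) :
    ∑ y, ‖W.mulVec φ y‖ ^ 2 = ∑ y, ‖φ y‖ ^ 2 := by
  have h : ∀ χ : ι → ℂ, ((∑ y, ‖χ y‖ ^ 2 : ℝ) : ℂ) = star χ ⬝ᵥ χ := fun χ => by
    rw [dotProduct]
    push_cast
    refine Finset.sum_congr rfl fun y _ => ?_
    rw [Pi.star_apply, Complex.star_def, ← Complex.normSq_eq_conj_mul_self,
      Complex.normSq_eq_norm_sq]
    push_cast; rfl
  have : ((∑ y, ‖W.mulVec φ y‖ ^ 2 : ℝ) : ℂ) = ((∑ y, ‖φ y‖ ^ 2 : ℝ) : ℂ) := by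
    rw [h, h, Matrix.star_mulVec, Matrix.dotProduct_mulVec, Matrix.vecMul_vecMul,
      ← Matrix.star_eq_conjTranspose, Matrix.mem_unitaryGroup_iff'.mp hW, Matrix.vecMul_one]
  exact_mod_cast this

/-- The value is an inner product of the two vectors, extended by `0` at `none`, one of them moved
by `W`; both the extension and `W` preserve norms. -/
theorem contractive_outState {n : ℕ} {W : Matrix (Option (Bits n)) (Option (Bits n)) ℂ}
    (hW : W ∈ Matrix.unitaryGroup _ ℂ) :
    Contractive fun ρ : Op n => (W * outState ρ).trace.re where
  linear := IsLinearMap.comp' (G := fun M => (W * M).trace.re) (isLinearMap_re_trace_mul W)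
    isLinearMap_outState
  dominated φ ψ := by
    rw [rtr_vecMulVec, rtr_vecMulVec]
    refine ⟨by positivity, by positivity, ?_⟩
    have h : ∀ χ : Bits n → ℂ, ∑ y, ‖χ y‖ ^ 2 = ∑ y : Option (Bits n), ‖y.elim 0 χ‖ ^ 2 := fun χ => by
      simp [Fintype.sum_option]
    beta_reduce
    rw [outState_vecMulVec, Matrix.mul_vecMulVec, Matrix.trace_vecMulVec, h φ, h ψ,
      ← sum_norm_unitary_mulVec hW]
    refine (Complex.abs_re_le_norm _).trans ((norm_sum_le _ _).trans ?_)
    refine le_trans (le_of_eq ?_) (sum_norm_mul_le _ _)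
    exact Finset.sum_congr rfl fun y _ => by rw [norm_mul, Pi.star_apply, norm_star]

theorem trace_mul_outBot {n : ℕ} (W : Matrix (Option (Bits n)) (Option (Bits n)) ℂ) (ρ : Op n) :
    (W * outBot ρ).trace = W none none * ρ.trace := by
  rw [outBot, Matrix.trace_mul_comm, Matrix.trace_single_mul, smul_eq_mul, mul_comm]

/-- Only the entry `W none none` matters, and the entries of a unitary matrix have modulus at most
`1`. -/
theorem contractive_outBot {n : ℕ} {W : Matrix (Option (Bits n)) (Option (Bits n)) ℂ}
    (hW : W ∈ Matrix.unitaryGroup _ ℂ) :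
    Contractive fun ρ : Op n => (W * outBot ρ).trace.re where
  linear := by
    simp only [trace_mul_outBot]
    exact ⟨fun A B => by simp [mul_add], fun r A => by simp [Matrix.trace_smul]; ring⟩
  dominated φ ψ := by
    beta_reduce
    rw [rtr_vecMulVec, rtr_vecMulVec, trace_mul_outBot]
    refine ⟨by positivity, by positivity, ?_⟩
    refine (Complex.abs_re_le_norm _).trans ?_
    rw [norm_mul]
    refine (mul_le_of_le_one_left (norm_nonneg _) (entry_norm_bound_of_unitary hW _ _)).trans ?_
    refine ((norm_sum_le _ _).trans ?_)
    refine le_trans (le_of_eq ?_) (sum_norm_mul_le _ _)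
    exact Finset.sum_congr rfl fun y _ => by
      rw [Matrix.diag, Matrix.vecMulVec_apply, norm_mul, Pi.star_apply, norm_star]

/-! ### The everlasting experiment -/

namespace ABE

variable (E : ABE fun k => k + 1)

theorem isHermitian_enc (k : ℕ) (pk : Bits (E.pkLen k)) (X : Bits (E.attrLen k)) (b : Bool)
    (vk : Bits (k + k)) : (E.withDeletion.enc k pk X b vk).IsHermitian := by
  refine (isLinearMap_conjTranspose.map_smul _ _).trans ?_
  refine congrArg _ ((map_avg isLinearMap_conjTranspose _).trans ?_)
  refine congrArg avg (funext fun c => ?_)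
  refine (conjTranspose_tensor _ _).trans ?_
  rw [conjTranspose_ketbra, conjTranspose_basisOp]

/-- A norming unitary turns the experiment into a scalar one. On the output `⊥` the functional
depends on the trace alone, so all runs together contribute nothing, and the factor `1/2` of the
trace distance cancels the `2` in `2 * β`. -/
theorem traceDist_evExp_le {k : ℕ} (A : E.Attacker k) {β : ℝ}
    (hβ : ∀ f : Bits (E.mskLen k) → Bits (E.attrLen k) → Op A.n → ℝ,
      (∀ msk X, Contractive (f msk X)) → |E.acceptPart A false f - E.acceptPart A true f| ≤ β) :
    traceDist (E.withDeletion.evExp k A.toAdversary false)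
      (E.withDeletion.evExp k A.toAdversary true) ≤ β := by
  have hH : ∀ b, (E.withDeletion.evExp k A.toAdversary b).IsHermitian := fun b =>
    E.withDeletion.isHermitian_deletionGame E.isHermitian_enc A.toAdversary b conjTranspose_outBot
      fun msk X v ρ => by
        cases v
        · exact conjTranspose_outBot ρ
        · exact conjTranspose_outState ρ
  obtain ⟨W, hW, h⟩ := exists_unitary_traceNorm ((hH false).sub (hH true))
  rw [traceDist, h, Matrix.mul_sub, Matrix.trace_sub, Complex.sub_re]
  have hL : ∀ b, (W * E.withDeletion.evExp k A.toAdversary b).trace.re =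
      E.withDeletion.deletionGame k A.toAdversary b (fun ρ => (W * outBot ρ).trace.re)
        fun msk X v ρ => if v then (W * outState ρ).trace.re else (W * outBot ρ).trace.re := by
    intro b
    refine (E.withDeletion.map_deletionGame A.toAdversary b (isLinearMap_re_trace_mul W) _ _).trans ?_
    congr 1
    funext msk X v ρ
    cases v <;> rfl
  rw [hL, hL]
  have key := E.abs_deletionGame_sub_le A (bot := fun ρ => (W * outBot ρ).trace.re)
    (f := fun _ _ ρ => (W * outState ρ).trace.re)
    (g := fun _ _ ρ => (W * outBot ρ).trace.re) (δ := 0) hβ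
    (fun _ _ => contractive_outState hW) (fun _ _ => contractive_outBot hW)
    (E.abs_fullPart_sub_le A fun x θ => le_of_eq ?_)
  · have := (le_abs_self _).trans key
    linarith
  · have hsum : ∀ ρ : Op A.n, ∑ t, (W * outBot (project A.cert t ρ)).trace.re =
        (W none none * ρ.trace).re := fun ρ => by
      simp only [trace_mul_outBot]
      rw [← Complex.re_sum, ← Finset.mul_sum, sum_trace_project]
    simp only [hsum]
    rw [abs_eq_zero, sub_eq_zero]
    exact E.branch_trace A _ _ (trace_ketbra_bb84 x θ) (trace_ketbra_bb84 x θ)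
      (φ := fun _ _ z => (W none none * z).re)
      fun _ _ => ⟨fun x y => by rw [mul_add, Complex.add_re], fun r z => by simp; ring⟩

theorem secure_withDeletion (hE : E.Secure) : E.withDeletion.Secure := by
  intro A hA
  -- The same machines, repackaged with the types of `withDeletion` unfolded.
  set B : ∀ k, E.Attacker k := fun k => ⟨(A k).n, (A k).advice, (A k).advice_norm, (A k).pk,
    (A k).pre, (A k).attr, (A k).ct, (A k).mid, (A k).cert, (A k).res, (A k).post, (A k).out⟩ with hB
  obtain ⟨β, hβ, hacc⟩ := E.exists_acceptPart_bound hE B hA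
  exact ⟨hβ.mono fun k => E.traceDist_evExp_le (B k) (hacc k), E.negligible_cExp hE B hA⟩

end ABE
end

/-! ### Correctness -/

theorem trace_ketbra_mul_bb84 {k : ℕ} (x θ x' θ' : Bits k) :
    (ketbra (bb84 x θ) * ketbra (bb84 x' θ')).trace = (∑ z, bb84 x θ z * bb84 x' θ' z) ^ 2 := by
  rw [ketbra, ketbra, Matrix.vecMulVec_mul_vecMulVec, Matrix.trace_vecMulVec, dotProduct_smul]
  have h : ∀ x θ : Bits k, star (bb84 x θ) = bb84 x θ := fun x θ => funext fun z => bb84_star x θ z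
  rw [h, h, sq]
  rfl

/-- BB84 amplitudes are real, so the overlap is the square of a real number. -/
theorem overlap_nonneg {k : ℕ} (x θ x' θ' : Bits k) :
    0 ≤ (ketbra (bb84 x θ) * ketbra (bb84 x' θ')).trace.re := by
  have h : star (∑ z, bb84 x θ z * bb84 x' θ' z) = ∑ z, bb84 x θ z * bb84 x' θ' z := by
    rw [star_sum]
    exact Finset.sum_congr rfl fun z _ => by rw [star_mul', bb84_star, bb84_star]
  obtain ⟨r, hr⟩ := Complex.conj_eq_iff_real.mp h
  rw [trace_ketbra_mul_bb84, hr, ← Complex.ofReal_pow, Complex.ofReal_re]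
  positivity

theorem basisOp_mul_basisOp {n : ℕ} (s t : Bits n) :
    basisOp s * basisOp t = if s = t then basisOp t else 0 := by
  by_cases h : s = t
  · rw [if_pos h, h, basisOp, Matrix.single_mul_single_same, one_mul]
  · rw [if_neg h, basisOp, basisOp, Matrix.single_mul_single_of_ne (h := h)]

theorem plaintext_castSucc {k : ℕ} (θ : Bits k) (b : Bool) :
    (fun i : Fin k => plaintext θ b i.castSucc) = θ :=
  funext fun i => Fin.snoc_castSucc (α := fun _ => Bool) b θ i

theorem plaintext_last {k : ℕ} (θ : Bits k) (b : Bool) : plaintext θ b (Fin.last k) = b :=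
  Fin.snoc_last (α := fun _ => Bool) b θ

theorem avg_mono {r : ℕ} {F G : Bits r → ℝ} (h : ∀ c, F c ≤ G c) : avg F ≤ avg G :=
  mul_le_mul_of_nonneg_left (Finset.sum_le_sum fun c _ => h c) (by positivity)

theorem isLinearMap_re_trace_mul_right {ι : Type} [Fintype ι] (W : Matrix ι ι ℂ) :
    IsLinearMap ℝ fun M : Matrix ι ι ℂ => (M * W).trace.re where
  map_add A B := by simp [Matrix.add_mul]
  map_smul r A := by simp [Matrix.trace_smul]

theorem sum_vk_const {k : ℕ} (r : ℝ) : ∑ _vk : Bits (k + k), ((2 : ℝ) ^ (k + k))⁻¹ * r = r := by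
  rw [Finset.sum_const, Finset.card_univ, card_bits, nsmul_eq_mul]
  push_cast
  rw [← mul_assoc, mul_inv_cancel₀ (by positivity), one_mul]

namespace ABE

variable (E : ABE fun k => k + 1)

/-- The decryption effects. -/
abbrev decOp (k d : ℕ) (sk : Bits (E.skLen k d)) (o : Option Bool) : Op (k + E.ctLen k) :=
  E.withDeletion.dec k d sk o

/-- The ciphertexts. -/
abbrev encOp (k : ℕ) (pk : Bits (E.pkLen k)) (X : Bits (E.attrLen k)) (b : Bool)
    (vk : Bits (k + k)) : Op (k + E.ctLen k) :=
  E.withDeletion.enc k pk X b vk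

theorem trace_tensor_mul_tensor_basis {a b : ℕ} (M N : Op a) (s t : Bits b) :
    (tensor M (basisOp s) * tensor N (basisOp t)).trace.re =
      if s = t then (M * N).trace.re else 0 := by
  rw [tensor_mul, trace_tensor, basisOp_mul_basisOp]
  split_ifs
  · rw [trace_basisOp, mul_one]
  · simp

/-- When the classical decryption is right, the measurement in the basis `θ` returns `x` with
certainty. When it is wrong, the remaining overlaps are nonnegative and may be dropped. -/
theorem le_trace_dec (k d : ℕ) (sk : Bits (E.skLen k d)) (x θ : Bits k) (b : Bool)
    (ct : Bits (E.ctLen k)) :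
    (avg fun c => if E.dec k d c sk ct = some (plaintext θ (b ^^ parity x θ)) then (1 : ℝ) else 0) ≤
      (Matrix.trace (E.decOp k d sk (some b) *
        tensor (ketbra (bb84 x θ)) (basisOp ct))).re := by
  have hL := isLinearMap_re_trace_mul_right (tensor (ketbra (bb84 x θ)) (basisOp ct))
  change _ ≤ (Matrix.trace ((∑ ct : Bits (E.ctLen k), avg fun c : Bits (E.decCoins k d) =>
      match E.dec k d c sk ct with
      | none => if some b = none then tensor 1 (basisOp ct) else (0 : Op (k + E.ctLen k))
      | some m => ∑ x : Bits k, if some b = some (m (Fin.last k) ^^ parity x fun i => m i.castSucc)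
          then tensor (ketbra (bb84 x fun i => m i.castSucc)) (basisOp ct) else 0) *
        tensor (ketbra (bb84 x θ)) (basisOp ct))).re
  refine le_trans ?_ (IsLinearMap.map_sum' hL _ _).ge
  have hmatch : ∀ ct' c, (Matrix.trace ((match E.dec k d c sk ct' with
      | none => if some b = none then tensor 1 (basisOp ct') else (0 : Op (k + E.ctLen k))
      | some m => ∑ x : Bits k, if some b = some (m (Fin.last k) ^^ parity x fun i => m i.castSucc)
          then tensor (ketbra (bb84 x fun i => m i.castSucc)) (basisOp ct') else 0) *
        tensor (ketbra (bb84 x θ)) (basisOp ct))).re = if ct' = ct then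
      (match E.dec k d c sk ct' with
      | none => 0
      | some m => ∑ x' : Bits k, if b = (m (Fin.last k) ^^ parity x' fun i => m i.castSucc)
          then (ketbra (bb84 x' fun i => m i.castSucc) * ketbra (bb84 x θ)).trace.re else 0) else 0 := by
    intro ct' c
    cases E.dec k d c sk ct' with
    | none => simp
    | some m =>
      simp only [Option.some.injEq]
      refine (IsLinearMap.map_sum' hL _ _).trans ?_
      by_cases h : ct' = ct
      · rw [if_pos h]
        refine Finset.sum_congr rfl fun x' _ => ?_
        by_cases h2 : b = (m (Fin.last k) ^^ parity x' fun i => m i.castSucc)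
        · simp only [if_pos h2]
          rw [trace_tensor_mul_tensor_basis, if_pos h]
        · simp only [if_neg h2]
          simp
      · rw [if_neg h]
        refine Finset.sum_eq_zero fun x' _ => ?_
        by_cases h2 : b = (m (Fin.last k) ^^ parity x' fun i => m i.castSucc)
        · simp only [if_pos h2]
          rw [trace_tensor_mul_tensor_basis, if_neg h]
        · simp only [if_neg h2]
          simp
  simp only [map_avg hL, hmatch]
  rw [Finset.sum_eq_single ct (fun ct' _ h => by simp only [if_neg h]; exact avg_const _) (by simp)]
  simp only [if_true]
  refine avg_mono fun c => ?_
  cases hm : E.dec k d c sk ct with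
  | none => simp
  | some m =>
    simp only [Option.some.injEq]
    have hn : ∀ x' : Bits k, 0 ≤ (if b = (m (Fin.last k) ^^ parity x' fun i => m i.castSucc)
        then (ketbra (bb84 x' fun i => m i.castSucc) * ketbra (bb84 x θ)).trace.re else 0) :=
      fun x' => by
        split_ifs
        · exact overlap_nonneg _ _ _ _
        · exact le_rfl
    split_ifs with h
    · refine le_trans (le_of_eq ?_) (Finset.single_le_sum (fun x' _ => hn x') (Finset.mem_univ x))
      subst h
      rw [plaintext_castSucc, plaintext_last, if_pos (by simp), trace_ketbra_mul_bb84, bb84_orth]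
      simp
    · exact Finset.sum_nonneg fun x' _ => hn x'

theorem trace_mul_enc (k : ℕ) (pk : Bits (E.pkLen k)) (X : Bits (E.attrLen k)) (b : Bool)
    (vk : Bits (k + k)) (M : Op (k + E.ctLen k)) :
    (Matrix.trace (M * E.encOp k pk X b vk)).re =
      ((2 : ℝ) ^ (k + k))⁻¹ * avg fun c : Bits (E.encCoins k) => (Matrix.trace (M *
        tensor (ketbra (bb84 (vk ∘ fstWires k k) (vk ∘ sndWires k k)))
          (basisOp (E.enc k c pk X (plaintext (vk ∘ sndWires k k)
            (b ^^ parity (vk ∘ fstWires k k) (vk ∘ sndWires k k))))))).re := by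
  have hL := isLinearMap_re_trace_mul M
  refine (hL.map_smul _ _).trans ?_
  rw [map_avg hL]
  rfl

theorem correct_withDeletion (hE : E.Correct) : E.withDeletion.Correct := by
  obtain ⟨ν, hν, h⟩ := hE
  refine ⟨ν, hν, fun k d P X b hP => ?_⟩
  calc 1 - ν k = ∑ _vk : Bits (k + k), ((2 : ℝ) ^ (k + k))⁻¹ * (1 - ν k) := (sum_vk_const _).symm
    _ ≤ ∑ vk : Bits (k + k), ((2 : ℝ) ^ (k + k))⁻¹ * E.decProb k d P X (plaintext (vk ∘ sndWires k k)
          (b ^^ parity (vk ∘ fstWires k k) (vk ∘ sndWires k k))) :=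
        Finset.sum_le_sum fun vk _ => mul_le_mul_of_nonneg_left (h k d P X _ hP) (by positivity)
    _ ≤ _ := ?_
  simp only [decProb]
  rw [← avg_sum]
  refine avg_mono fun c₁ => ?_
  rw [← avg_sum]
  refine avg_mono fun c₂ => Finset.sum_le_sum fun vk _ => ?_
  refine le_trans ?_ (E.trace_mul_enc k (E.gen k c₁).1 X b vk
    (E.decOp k d (E.keyGen k d c₂ (E.gen k c₁).2 P) (some b))).ge
  refine mul_le_mul_of_nonneg_left (avg_mono fun c₃ => ?_) (by positivity)
  exact E.le_trace_dec k d _ _ _ b _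

/-- Position by position: for `θ i = 1` the Hadamard measurement returns `x i`; for `θ i = 0` both
outcomes have probability `1/2` and both pass the check. -/
theorem sum_accepted_overlap {k : ℕ} (x θ : Bits k) :
    (∑ t, if accepts x θ t = true then
      (ketbra (bb84 t fun _ => true) * ketbra (bb84 x θ)).trace else 0) = 1 := by
  have h : ∀ t : Bits k, (if accepts x θ t = true then
      (ketbra (bb84 t fun _ => true) * ketbra (bb84 x θ)).trace else 0) =
      ∏ i, (if θ i = true → x i = t i then 1 else 0) *
        (∑ z, qubit (t i) true z * qubit (x i) (θ i) z) ^ 2 := fun t => by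
    rw [Finset.prod_mul_distrib, ← ite_accepts, trace_ketbra_mul_bb84, Finset.prod_pow]
    simp only [bb84_eq, ← Finset.prod_mul_distrib]
    rw [sum_prod_bits fun i b => qubit (t i) true b * qubit (x i) (θ i) b]
    split_ifs <;> simp
  simp only [h]
  rw [sum_prod_bits fun i b => (if θ i = true → x i = b then (1 : ℂ) else 0) *
        (∑ z, qubit b true z * qubit (x i) (θ i) z) ^ 2]
  refine Finset.prod_eq_one fun i _ => ?_
  cases θ i
  · cases x i <;> simp [qubit, hadamard, div_eq_mul_inv, sq, inv_sqrt_two_sq]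
  · have := qubit_orth true true true
    have := qubit_orth false false true
    cases x i <;> simp_all

theorem deletionCorrect_withDeletion : E.withDeletion.DeletionCorrect := by
  refine ⟨fun _ => 0, fun c => ⟨0, fun n hn => by positivity⟩, fun k X b => ?_⟩
  rw [sub_zero]
  have hterm : ∀ (X : Bits (E.attrLen k)) (c : Bits (E.genCoins k)) (vk : Bits (k + k)),
      (∑ t : Bits k, if accepts (vk ∘ fstWires k k) (vk ∘ sndWires k k) t = true then
        (Matrix.trace ((tensor (ketbra (bb84 t fun _ => true)) 1 : Op (k + E.ctLen k)) *
          E.encOp k (E.gen k c).1 X b vk)).re else 0) =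
      ((2 : ℝ) ^ (k + k))⁻¹ * 1 := by
    intro X c vk
    have h1 : ∀ (t : Bits k) (M : Op k) (s : Bits (E.ctLen k)), (Matrix.trace
        ((tensor (ketbra (bb84 t fun _ => true)) 1 : Op (k + E.ctLen k)) *
          tensor M (basisOp s))).re = ((ketbra (bb84 t fun _ => true)) * M).trace.re := fun t M s => by
      rw [tensor_mul, one_mul, trace_tensor, trace_basisOp, mul_one]
    simp only [trace_mul_enc, h1, avg_const]
    rw [← one_mul (∑ _t, _)]
    have h2 := congrArg Complex.re (sum_accepted_overlap (vk ∘ fstWires k k) (vk ∘ sndWires k k))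
    rw [Complex.re_sum, Complex.one_re] at h2
    rw [one_mul, ← h2, Finset.mul_sum]
    refine Finset.sum_congr rfl fun t _ => ?_
    split_ifs <;> simp
  have : E.withDeletion.delProb k X b = avg fun _ : Bits (E.genCoins k) => (1 : ℝ) := by
    refine congrArg avg (funext fun c => ?_)
    refine Eq.trans ?_ (sum_vk_const (k := k) 1)
    exact Finset.sum_congr rfl fun vk _ => hterm X c vk
  rw [this, avg_const]

end ABE

/-! ### Calculus of circuits -/

theorem extend_eq_iff {m n : ℕ} (w : Fin m ↪ Fin n) (x : Bits m) (y P : Bits n) :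
    P = Function.extend w x y ↔ x = P ∘ w ∧ Function.extend w (y ∘ w) P = y := by
  constructor
  · rintro rfl
    refine ⟨(Function.extend_comp w.injective _ _).symm, ?_⟩
    funext j
    by_cases h : ∃ i, w i = j
    · obtain ⟨i, rfl⟩ := h
      rw [extend_at]; rfl
    · rw [extend_off w _ _ fun i hi => h ⟨i, hi⟩, extend_off w _ _ fun i hi => h ⟨i, hi⟩]
  · rintro ⟨rfl, h⟩
    rw [← h]
    funext j
    by_cases h : ∃ i, w i = j
    · obtain ⟨i, rfl⟩ := h
      rw [extend_at]; rfl
    · rw [extend_off w _ _ fun i hi => h ⟨i, hi⟩, extend_off w _ _ fun i hi => h ⟨i, hi⟩]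

theorem extend_succ {m n : ℕ} (w : Fin (m + 1) ↪ Fin n) (x : Bits (m + 1)) (y : Bits n) :
    Function.extend w x y = Function.extend ((Fin.castSuccEmb).trans w) (x ∘ Fin.castSucc)
      (Function.update y (w (Fin.last m)) (x (Fin.last m))) := by
  funext j
  by_cases h : ∃ i, w i = j
  · obtain ⟨i, rfl⟩ := h
    rw [extend_at]
    refine Fin.lastCases ?_ (fun i => ?_) i
    · rw [extend_off, Function.update_self]
      exact fun i hi => (Fin.castSucc_lt_last i).ne (w.injective hi)
    · exact (extend_at (Fin.castSuccEmb.trans w) (x ∘ Fin.castSucc) _ i).symm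
  · have h' : ∀ i, (Fin.castSuccEmb.trans w) i ≠ j := fun i hi => h ⟨_, hi⟩
    rw [extend_off w _ _ fun i hi => h ⟨i, hi⟩, extend_off _ _ _ h',
      Function.update_of_ne fun hj => h ⟨_, hj.symm⟩]

theorem sum_bits_succ {V : Type*} [AddCommMonoid V] {k : ℕ} (f : Bits (k + 1) → V) :
    ∑ x, f x = ∑ b, ∑ x : Bits k, f (Fin.snoc x b) := by
  rw [← Fintype.sum_prod_type']
  exact (Fintype.sum_equiv (Fin.snocEquiv fun _ => Bool) _ _ fun p => rfl).symm

theorem bb84_snoc {k : ℕ} (x : Bits k) (b : Bool) (θ z : Bits (k + 1)) :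
    bb84 (Fin.snoc x b : Bits (k + 1)) θ z = bb84 x (θ ∘ Fin.castSucc) (z ∘ Fin.castSucc) *
      qubit b (θ (Fin.last k)) (z (Fin.last k)) := by
  rw [bb84_eq, Fin.prod_univ_castSucc, bb84_eq]
  simp

/-- A sequence of circuits that change the bases of the qubits `w` according to `θ`. -/
theorem applyCircuit_sweep_qubit {n k : ℕ} (w : Fin k ↪ Fin n) (C : Fin k → List (Gate n))
    (θ : Fin k → Bits n → Bool)
    (hC : ∀ i ρ y z, applyCircuit (C i) ρ y z = ∑ b, ∑ b', qubit b (θ i y) (y (w i)) *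
      qubit b' (θ i z) (z (w i)) * ρ (Function.update y (w i) b) (Function.update z (w i) b'))
    (hθ : ∀ i j y b, θ i (Function.update y (w j) b) = θ i y) (ρ : Op n) (y z : Bits n) :
    applyCircuit (sweep C) ρ y z = ∑ x, ∑ x', bb84 x (fun i => θ i y) (y ∘ w) *
      bb84 x' (fun i => θ i z) (z ∘ w) * ρ (Function.extend w x y) (Function.extend w x' z) := by
  induction k generalizing ρ y z with
  | zero =>
    have h : ∀ (x : Bits 0) (y : Bits n), Function.extend w x y = y := fun x y =>
      funext fun j => extend_off w _ _ fun i => i.elim0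
    simp [sweep_zero, applyCircuit_nil, bb84, h]
  | succ k ih =>
    rw [sweep_succ, applyCircuit_append, hC, sum_bits_succ]
    refine Finset.sum_congr rfl fun b _ => ?_
    rw [Finset.sum_comm, sum_bits_succ]
    refine Finset.sum_congr rfl fun b' _ => ?_
    rw [ih (Fin.castSuccEmb.trans w) (fun i => C i.castSucc) (fun i => θ i.castSucc)
      (fun i => hC _) (fun i j => hθ _ _), Finset.sum_comm, Finset.mul_sum]
    refine Finset.sum_congr rfl fun x' _ => ?_
    rw [Finset.mul_sum]
    refine Finset.sum_congr rfl fun x _ => ?_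
    have h1 : ∀ (y : Bits n) b, Function.update y (w (Fin.last k)) b ∘ (Fin.castSuccEmb.trans w) =
        (y ∘ w) ∘ Fin.castSucc := fun y b => funext fun i =>
      Function.update_of_ne (fun h => (Fin.castSucc_lt_last i).ne (w.injective h)) _ _
    have h2 : ∀ (y : Bits n) (x : Bits k) b, Function.extend w (Fin.snoc x b : Bits (k + 1)) y =
        Function.extend (Fin.castSuccEmb.trans w) x
          (Function.update y (w (Fin.last k)) b) := fun y x b => by
      rw [extend_succ, Fin.snoc_last]
      congr 1
      funext i; simp
    simp only [h1, h2, hθ, bb84_snoc]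
    simp only [Function.comp_def]
    ring

/-- Hadamard gates on the wires `w`, controlled by the wires `c`. -/
def controlledH {n k : ℕ} (c w : Fin k → Fin n) : List (Gate n) :=
  sweep fun i => [Gate.unitary .H (Loc.cnot (c i) (w i))]

/-- Hadamard gates on the wires `w`. -/
def allH {n k : ℕ} (w : Fin k → Fin n) : List (Gate n) :=
  sweep fun i => [Gate.unitary .H (Loc.free (w i))]

theorem applyCircuit_controlledH {n k : ℕ} (c : Fin k → Fin n) (w : Fin k ↪ Fin n)
    (h : ∀ i j, c i ≠ w j) (ρ : Op n) (y z : Bits n) :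
    applyCircuit (controlledH c w) ρ y z = ∑ x, ∑ x', bb84 x (y ∘ c) (y ∘ w) *
      bb84 x' (z ∘ c) (z ∘ w) * ρ (Function.extend w x y) (Function.extend w x' z) := by
  refine applyCircuit_sweep_qubit w _ (fun i y => y (c i)) (fun i ρ y z => ?_)
    (fun i j y b => Function.update_of_ne (h i j) _ _) ρ y z
  rw [applyCircuit_cons, applyCircuit_nil, unitary_apply]
  have he : ∀ (y : Bits n) b, Gate1.H.entry (∀ a ∈ (Loc.cnot (c i) (w i)).ctrl, y a = true)
      (y (Loc.cnot (c i) (w i)).tgt) b = qubit b (y (c i)) (y (w i)) := fun y b => by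
    have h1 : (∀ a ∈ (Loc.cnot (c i) (w i)).ctrl, y a = true) ↔ y (c i) = true := by
      simp only [Loc.cnot, Finset.erase_eq_of_notMem (show w i ∉ ({c i} : Finset (Fin n)) by
        simpa using (h i i).symm)]
      simp
    simp only [Gate1.entry, h1]; rfl
  simp only [he, qubit_star]
  rfl

theorem applyCircuit_allH {n k : ℕ} (w : Fin k ↪ Fin n) (ρ : Op n) (y z : Bits n) :
    applyCircuit (allH w) ρ y z = ∑ x, ∑ x', hadamardState x (y ∘ w) *
      hadamardState x' (z ∘ w) * ρ (Function.extend w x y) (Function.extend w x' z) := by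
  refine applyCircuit_sweep_qubit w _ (fun _ _ => true) (fun i ρ y z => ?_)
    (fun i j y b => rfl) ρ y z
  rw [applyCircuit_cons, applyCircuit_nil, unitary_apply]
  have he : ∀ (y : Bits n) b, Gate1.H.entry (∀ a ∈ (Loc.free (w i)).ctrl, y a = true)
      (y (Loc.free (w i)).tgt) b = qubit b true (y (w i)) := fun y b => by
    simp [Gate1.entry, Loc.free, qubit, Gate1.mat]
  simp only [he, qubit_star]
  rfl

theorem applyCircuit_controlledH_dyad {n k : ℕ} (c : Fin k → Fin n) (w : Fin k ↪ Fin n)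
    (h : ∀ i j, c i ≠ w j) (P Q y z : Bits n) :
    applyCircuit (controlledH c w) (dyad P Q) y z =
      if Function.extend w (y ∘ w) P = y ∧ Function.extend w (z ∘ w) Q = z then
        bb84 (P ∘ w) (P ∘ c) (y ∘ w) * bb84 (Q ∘ w) (Q ∘ c) (z ∘ w) else 0 := by
  rw [applyCircuit_controlledH c w h]
  simp only [dyad_apply, extend_eq_iff w]
  rw [Finset.sum_eq_single (P ∘ w), Finset.sum_eq_single (Q ∘ w)]
  · have hc : ∀ (P y : Bits n), Function.extend w (y ∘ w) P = y → y ∘ c = P ∘ c := fun P y hy =>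
      funext fun i => by
        rw [← hy]; exact extend_off w _ _ fun j => (h i j).symm
    simp only [true_and]
    split_ifs with h1
    · rw [hc P y h1.1, hc Q z h1.2, mul_one]
    · rw [mul_zero]
  · intro x _ hx; simp [hx]
  · simp
  · intro x _ hx; simp [hx]
  · simp

/-- Random bits on the wires `w`. -/
def coins {n r : ℕ} (w : Fin r → Fin n) : List (Gate n) := allH w ++ measureAll w

theorem hadamardState_mul_self {k : ℕ} (x z : Bits k) :
    hadamardState x z * hadamardState x z = ((2 : ℂ) ^ k)⁻¹ := by
  rw [hadamardState, bb84_eq, ← Finset.prod_mul_distrib]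
  have : ∀ i : Fin k, qubit (x i) true (z i) * qubit (x i) true (z i) = 2⁻¹ := fun i => by
    cases x i <;> cases z i <;> simp [qubit, hadamard, div_eq_mul_inv, inv_sqrt_two_sq]
  simp only [this]
  simp

/-- The measurement removes the terms that differ on `w`. Because `P` and `Q` agree on `w`, the
Hadamard signs in the surviving terms cancel and each has weight `2^(-r)`. -/
theorem applyCircuit_coins {n r : ℕ} (w : Fin r ↪ Fin n) {P Q : Bits n} (h : P ∘ w = Q ∘ w) :
    applyCircuit (coins w) (dyad P Q) =
      avg fun s => dyad (Function.extend w s P) (Function.extend w s Q) := by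
  ext y z
  rw [coins, applyCircuit_append, applyCircuit_measureAll_apply, applyCircuit_allH, avg,
    Matrix.smul_apply, Matrix.sum_apply]
  simp only [dyad_apply, extend_eq_iff w]
  have hs : ∀ (s : Bits r) (P y : Bits n), Function.extend w s P = y ↔
      y ∘ w = s ∧ Function.extend w (y ∘ w) P = y := fun s P y => by
    constructor
    · rintro rfl
      rw [Function.extend_comp w.injective]
      exact ⟨rfl, rfl⟩
    · rintro ⟨rfl, h⟩; exact h
  rw [Finset.sum_congr rfl fun s (_ : s ∈ Finset.univ) =>
    if_congr (and_congr (hs s P y) (hs s Q z)) (rfl : (1 : ℂ) = 1) (rfl : (0 : ℂ) = 0)]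
  rw [Finset.sum_eq_single (P ∘ w), Finset.sum_eq_single (Q ∘ w),
    Finset.sum_eq_single (y ∘ w)]
  · by_cases hyz : y ∘ w = z ∘ w
    · rw [if_pos hyz, h, hyz, hadamardState_mul_self]
      simp only [true_and]
      split_ifs
      · simp
      · simp
    · rw [if_neg hyz]
      simp [Ne.symm hyz]
  · intro s _ hs'; simp [hs'.symm]
  · simp
  · intro x _ hx; simp [hx]
  · simp
  · intro x _ hx; simp [hx]
  · simp

theorem applyCircuit_measureAll_dyad {n k : ℕ} (w : Fin k → Fin n) (P Q : Bits n) :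
    applyCircuit (measureAll w) (dyad P Q) = if P ∘ w = Q ∘ w then dyad P Q else 0 := by
  ext y z
  rw [applyCircuit_measureAll_apply, dyad_apply]
  by_cases h : P ∘ w = Q ∘ w
  · rw [if_pos h, dyad_apply]
    by_cases hPQ : P = y ∧ Q = z
    · obtain ⟨rfl, rfl⟩ := hPQ
      rw [if_pos h]
    · rw [if_neg hPQ, ite_self]
  · rw [if_neg h]
    by_cases hPQ : P = y ∧ Q = z
    · obtain ⟨rfl, rfl⟩ := hPQ
      rw [if_neg h]; rfl
    · rw [if_neg hPQ, ite_self]; rfl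

theorem Loc.flip_map {n n' : ℕ} (f : Fin n ↪ Fin n') (g : Loc n) (P : Bits n') :
    (g.map f).flip P = Function.extend f (g.flip (P ∘ f)) P := by
  have h1 : (∀ c ∈ (g.map f).ctrl, P c = true) ↔ ∀ c ∈ g.ctrl, (P ∘ f) c = true := by
    simp [Loc.map]
  by_cases h : ∀ c ∈ g.ctrl, (P ∘ f) c = true
  · rw [Loc.flip, if_pos (h1.mpr h), Loc.flip, if_pos h]
    funext j
    by_cases hj : ∃ i, f i = j
    · obtain ⟨i, rfl⟩ := hj
      rw [extend_at]
      by_cases hi : i = g.tgt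
      · subst hi
        rw [Function.update_self]
        exact Function.update_self _ _ _
      · rw [Function.update_of_ne hi]
        exact Function.update_of_ne (fun h => hi (f.injective h)) _ _
    · rw [extend_off f _ _ fun i hi => hj ⟨i, hi⟩]
      exact Function.update_of_ne (fun h => hj ⟨_, h.symm⟩) _ _
  · rw [Loc.flip, if_neg (h1.not.mpr h), Loc.flip, if_neg h, extend_comp_eq]

theorem applyClassical_map {n n' : ℕ} (f : Fin n ↪ Fin n') (C : List (Loc n)) (P : Bits n') :
    applyClassical (C.map (Loc.map f)) P = Function.extend f (applyClassical C (P ∘ f)) P := by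
  induction C generalizing P with
  | nil => exact (extend_comp_eq f P).symm
  | cons g C ih =>
    rw [List.map_cons, applyClassical_cons, ih, Loc.flip_map, Function.extend_comp f.injective,
      applyClassical_cons]
    funext j
    by_cases hj : ∃ i, f i = j
    · obtain ⟨i, rfl⟩ := hj
      rw [extend_at, extend_at]
    · rw [extend_off f _ _ fun i hi => hj ⟨i, hi⟩, extend_off f _ _ fun i hi => hj ⟨i, hi⟩,
        extend_off f _ _ fun i hi => hj ⟨i, hi⟩]

/-- Add the bits on the wires `a` to the wires `b`. -/
def copyCircuit {n k : ℕ} (a b : Fin k → Fin n) : List (Loc n) :=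
  sweep fun i => [Loc.cnot (a i) (b i)]

theorem applyClassical_copyCircuit {n k : ℕ} (a : Fin k → Fin n) (b : Fin k ↪ Fin n)
    (h : ∀ i j, a i ≠ b j) (P : Bits n) :
    applyClassical (copyCircuit a b) P = Function.extend b (fun i => P (b i) ^^ P (a i)) P := by
  induction k with
  | zero =>
    rw [copyCircuit, sweep_zero, applyClassical_nil]
    exact funext fun j => (extend_off b _ _ fun i => i.elim0).symm
  | succ k ih =>
    have := ih (fun i => a i.castSucc) (Fin.castSuccEmb.trans b) fun i j => h _ _
    rw [copyCircuit] at this ⊢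
    rw [sweep_succ, applyClassical_append]
    refine (congrArg _ this).trans ?_
    rw [applyClassical_cons, applyClassical_nil, Loc.flip_cnot (h _ _)]
    have h1 : ∀ i : Fin k, (Fin.castSuccEmb.trans b) i ≠ b (Fin.last k) := fun i hi =>
      (Fin.castSucc_lt_last i).ne (b.injective hi)
    have h2 : ∀ i : Fin k, (Fin.castSuccEmb.trans b) i ≠ a (Fin.last k) := fun i => (h _ _).symm
    rw [extend_off _ _ _ h1, extend_off _ _ _ h2]
    funext j
    by_cases hj : j = b (Fin.last k)
    · subst hj
      rw [Function.update_self, extend_at]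
    · rw [Function.update_of_ne hj, extend_succ]
      by_cases hi : ∃ i, (Fin.castSuccEmb.trans b) i = j
      · obtain ⟨i, rfl⟩ := hi
        rw [extend_at, extend_at]; rfl
      · rw [extend_off _ _ _ fun i h => hi ⟨i, h⟩, extend_off _ _ _ fun i h => hi ⟨i, h⟩,
          Function.update_of_ne hj]

/-- Add to the wire `t` the parity of the bits `x` at the positions where the bit `θ` is `0`. -/
def maskedParity {n k : ℕ} (θ x : Fin k → Fin n) (t : Fin n) : List (Loc n) :=
  sweep fun i => [Loc.free (θ i), Loc.toffoli (θ i) (x i) t, Loc.free (θ i)]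

/-- The first NOT on `θ i` makes the Toffoli gate act when the bit is `0`; the second one restores
it. -/
theorem applyClassical_maskedParity {n k : ℕ} (θ x : Fin k → Fin n) (t : Fin n)
    (hθ : ∀ i, θ i ≠ t) (hx : ∀ i, x i ≠ t) (hθx : ∀ i, θ i ≠ x i) (P : Bits n) :
    applyClassical (maskedParity θ x t) P =
      Function.update P t (P t ^^ parity (P ∘ x) (P ∘ θ)) := by
  obtain ⟨b, hb, hs⟩ := applyClassical_sweep_flip t
    (fun i => [Loc.free (θ i), Loc.toffoli (θ i) (x i) t, Loc.free (θ i)])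
    (fun i P => !P (θ i) && P (x i)) (fun i P => by
      simp only [applyClassical_cons, applyClassical_nil, Loc.flip_free,
        Loc.flip_toffoli (hθ i) (hx i)]
      funext j
      by_cases h1 : j = θ i
      · subst h1
        rw [Function.update_self, Function.update_of_ne (hθ i), Function.update_self,
          Function.update_of_ne (hθ i), Bool.not_not]
      · rw [Function.update_of_ne h1]
        by_cases h2 : j = t
        · subst h2
          rw [Function.update_self, Function.update_self, Function.update_of_ne (hθ i).symm,
            Function.update_self, Function.update_of_ne (hθx i).symm]
        · rw [Function.update_of_ne h2, Function.update_of_ne h1, Function.update_of_ne h2])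
    (fun i P b => by rw [Function.update_of_ne (hθ i), Function.update_of_ne (hx i)]) P
  rw [maskedParity, hb]
  congr 1
  apply sgn_injective
  rw [hs, sgn_xor, sgn_parity]
  rfl

/-! ### Wirings -/

theorem extend_trans_comp {ι ι' κ α : Type*} (u : ι ↪ ι') (f : ι' ↪ κ) (x : ι → α) (P : κ → α) :
    Function.extend (u.trans f) x P ∘ f = Function.extend u x (P ∘ f) := by
  funext j
  by_cases h : ∃ i, u i = j
  · obtain ⟨i, rfl⟩ := h
    rw [extend_at]; exact extend_at (u.trans f) x P i
  · rw [extend_off u _ _ fun i hi => h ⟨i, hi⟩]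
    exact extend_off (u.trans f) _ _ fun i hi => h ⟨i, f.injective hi⟩

theorem extend_trans_extend {ι ι' κ α : Type*} (u : ι ↪ ι') (w : ι' ↪ κ) (x : ι → α) (s : ι' → α)
    (P : κ → α) : Function.extend (u.trans w) x (Function.extend w s P) =
      Function.extend w (Function.extend u x s) P := by
  funext j
  by_cases h : ∃ i, w i = j
  · obtain ⟨i, rfl⟩ := h
    have := congrFun (extend_trans_comp u w x (Function.extend w s P)) i
    rw [Function.extend_comp w.injective] at this
    rw [extend_at]; exact this
  · rw [extend_off w (Function.extend u x s) _ fun i hi => h ⟨i, hi⟩]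
    exact (extend_off (u.trans w) _ _ fun i hi => h ⟨_, hi⟩).trans
      (extend_off w _ _ fun i hi => h ⟨i, hi⟩)

theorem extend_const {ι κ α : Type*} (w : ι ↪ κ) (a : α) :
    (fun _ : κ => a) = Function.extend w (fun _ => a) fun _ => a := by
  funext j
  by_cases h : ∃ i, w i = j
  · obtain ⟨i, rfl⟩ := h
    rw [extend_at]
  · rw [extend_off w _ _ fun i hi => h ⟨i, hi⟩]

theorem update_comp_emb {ι κ α : Type*} [DecidableEq ι] [DecidableEq κ] (f : ι ↪ κ) (P : κ → α)
    (i : ι) (b : α) : Function.update P (f i) b ∘ f = Function.update (P ∘ f) i b := by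
  funext j
  by_cases h : j = i
  · subst h; simp
  · rw [Function.update_of_ne h]
    exact Function.update_of_ne (fun h' => h (f.injective h')) _ _

theorem update_comp_of_ne {ι κ α : Type*} [DecidableEq κ] (f : ι → κ) (P : κ → α)
    {j : κ} (h : ∀ i, f i ≠ j) (b : α) : Function.update P j b ∘ f = P ∘ f :=
  funext fun i => Function.update_of_ne (h i) _ _

theorem update_extend {ι κ α : Type*} [DecidableEq ι] [DecidableEq κ] (w : ι ↪ κ) (s : ι → α)
    (P : κ → α) (i : ι) (b : α) :
    Function.update (Function.extend w s P) (w i) b = Function.extend w (Function.update s i b) P := by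
  funext j
  by_cases h : ∃ i, w i = j
  · obtain ⟨l, rfl⟩ := h
    rw [extend_at]
    by_cases hl : l = i
    · subst hl; simp
    · rw [Function.update_of_ne hl, Function.update_of_ne fun h => hl (w.injective h), extend_at]
  · rw [Function.update_of_ne fun hj => h ⟨_, hj.symm⟩, extend_off w _ _ fun i hi => h ⟨i, hi⟩,
      extend_off w _ _ fun i hi => h ⟨i, hi⟩]

/-- Two disjoint families of wires as one. -/
def joinWires {a b n : ℕ} (u : Fin a ↪ Fin n) (v : Fin b ↪ Fin n) (h : ∀ i j, u i ≠ v j) :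
    Fin (a + b) ↪ Fin n where
  toFun := Fin.addCases u v
  inj' := by
    intro i j
    refine Fin.addCases (fun i => ?_) (fun i => ?_) i <;>
      refine Fin.addCases (fun j => ?_) (fun j => ?_) j <;> intro hij
    · simp only [Fin.addCases_left] at hij
      rw [u.injective hij]
    · simp only [Fin.addCases_left, Fin.addCases_right] at hij
      exact absurd hij (h _ _)
    · simp only [Fin.addCases_left, Fin.addCases_right] at hij
      exact absurd hij.symm (h _ _)
    · simp only [Fin.addCases_right] at hij
      rw [v.injective hij]

theorem joinWires_castAdd {a b n : ℕ} (u : Fin a ↪ Fin n) (v : Fin b ↪ Fin n)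
    (h : ∀ i j, u i ≠ v j) (i : Fin a) : joinWires u v h (Fin.castAdd b i) = u i :=
  Fin.addCases_left (motive := fun _ => Fin n) i

theorem joinWires_natAdd {a b n : ℕ} (u : Fin a ↪ Fin n) (v : Fin b ↪ Fin n)
    (h : ∀ i j, u i ≠ v j) (i : Fin b) : joinWires u v h (Fin.natAdd a i) = v i :=
  Fin.addCases_right (motive := fun _ => Fin n) i

theorem fst_joinWires {a b n : ℕ} (u : Fin a ↪ Fin n) (v : Fin b ↪ Fin n) (h : ∀ i j, u i ≠ v j) :
    (fstWires a b).trans (joinWires u v h) = u := by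
  ext i
  exact congrArg Fin.val (joinWires_castAdd u v h i)

theorem snd_joinWires {a b n : ℕ} (u : Fin a ↪ Fin n) (v : Fin b ↪ Fin n) (h : ∀ i j, u i ≠ v j) :
    (sndWires a b).trans (joinWires u v h) = v := by
  ext i
  exact congrArg Fin.val (joinWires_natAdd u v h i)

theorem comp_joinWires_eq_iff {a b n : ℕ} (u : Fin a ↪ Fin n) (v : Fin b ↪ Fin n)
    (h : ∀ i j, u i ≠ v j) (y : Bits n) (s : Bits (a + b)) :
    y ∘ joinWires u v h = s ↔ y ∘ u = s ∘ fstWires a b ∧ y ∘ v = s ∘ sndWires a b := by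
  have h1 : (y ∘ joinWires u v h) ∘ fstWires a b = y ∘ u := by
    conv_rhs => rw [← fst_joinWires u v h]
    rfl
  have h2 : (y ∘ joinWires u v h) ∘ sndWires a b = y ∘ v := by
    conv_rhs => rw [← snd_joinWires u v h]
    rfl
  refine ⟨?_, fun h' => wires_ext (h1.trans h'.1) (h2.trans h'.2)⟩
  rintro rfl
  exact ⟨h1.symm, h2.symm⟩

theorem extend_joinWires {a b n : ℕ} (u : Fin a ↪ Fin n) (v : Fin b ↪ Fin n)
    (h : ∀ i j, u i ≠ v j) (s : Bits (a + b)) (y : Bits n) :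
    Function.extend (joinWires u v h) s y =
      Function.extend u (s ∘ fstWires a b) (Function.extend v (s ∘ sndWires a b) y) := by
  rw [extend_split, fst_joinWires, snd_joinWires]

/-! ### The encryption circuit -/

/-- The controlled Hadamard gates put only the wires `w` into superposition. All the others stay in
a basis state and can be read, kept or traced out independently. -/
theorem reduce_controlledH {n k l m : ℕ} (c : Fin k → Fin n) (w : Fin k ↪ Fin n)
    (e : Fin l ↪ Fin n) (v : Fin m ↪ Fin n) (hc : ∀ i j, c i ≠ w j) (hwe : ∀ i j, w i ≠ e j)
    (hvw : ∀ i j, v i ≠ w j) (hve : ∀ i j, v i ≠ e j) (P : Bits n) (t : Bits m) :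
    reduce (joinWires w e hwe) (project v t (applyCircuit (controlledH c w) (dyad P P))) =
      if P ∘ v = t then tensor (ketbra (bb84 (P ∘ w) (P ∘ c))) (basisOp (P ∘ e)) else 0 := by
  ext s s'
  have hp : ∀ (M : Op n) y z, project v t M y z = if y ∘ v = t ∧ z ∘ v = t then M y z else 0 :=
    fun _ _ _ => rfl
  have hr : ∀ M : Op n, reduce (joinWires w e hwe) M s s' = ∑ y : Bits n,
      if y ∘ joinWires w e hwe = s then M y (Function.extend (joinWires w e hwe) s' y) else 0 :=
    fun _ => rfl
  rw [hr]
  simp only [comp_joinWires_eq_iff, hp, applyCircuit_controlledH_dyad c w hc]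
  have hoff : ∀ (x : Bits k) (y : Bits n), Function.extend w x y ∘ e = y ∘ e := fun x y =>
    extend_comp_of_ne w e hwe x y
  have hoffv : ∀ (x : Bits k) (y : Bits n), Function.extend w x y ∘ v = y ∘ v := fun x y =>
    extend_comp_of_ne w v (fun i j => (hvw j i).symm) x y
  have hat : ∀ (x : Bits k) (y : Bits n), Function.extend w x y ∘ w = x := fun x y =>
    Function.extend_comp w.injective _ _
  rw [Finset.sum_eq_single (Function.extend w (s ∘ fstWires k l) P)]
  · rw [hat, hoff, hoffv]
    by_cases h1 : P ∘ e = s ∘ sndWires k l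
    · rw [if_pos ⟨rfl, h1⟩, extend_joinWires, hat, hoffv,
        extend_comp_of_ne e v (fun i j => (hve j i).symm), hoffv]
      by_cases h2 : P ∘ v = t
      · rw [if_pos ⟨h2, h2⟩, if_pos h2, tensor_apply, ABE.basisOp_apply]
        have h3 : Function.extend w (s' ∘ fstWires k l) P = Function.extend w (s' ∘ fstWires k l)
            (Function.extend e (s' ∘ sndWires k l) (Function.extend w (s ∘ fstWires k l) P)) ↔
            P ∘ e = s' ∘ sndWires k l := by
          constructor
          · intro h
            have := congrArg (fun y => y ∘ e) h
            simp only [hoff] at this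
            rw [this, Function.extend_comp e.injective]
          · intro h
            rw [← h, ← hoff (s ∘ fstWires k l) P, extend_comp_eq]
            refine (extend_eq_iff w _ _ _).mpr ⟨(hat _ _).symm, ?_⟩
            rw [hat]
            funext j
            by_cases hj : ∃ i, w i = j
            · obtain ⟨i, rfl⟩ := hj
              rw [extend_at, extend_at]
            · rw [extend_off w _ _ fun i hi => hj ⟨i, hi⟩,
                extend_off w _ _ fun i hi => hj ⟨i, hi⟩, extend_off w _ _ fun i hi => hj ⟨i, hi⟩]
        simp only [true_and, h3, h1, ketbra, Matrix.vecMulVec_apply, Pi.star_apply, bb84_star]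
        split_ifs <;> simp
      · rw [if_neg fun h => h2 h.1, if_neg h2]; rfl
    · rw [if_neg fun h => h1 h.2]
      split_ifs
      · rw [tensor_apply, ABE.basisOp_apply, if_neg fun h => h1 h.1, mul_zero]
      · rfl
  · intro y _ hy
    split_ifs with h1 h2 h3
    · exact absurd (by rw [← h1.1]; exact h3.1.symm) hy
    all_goals rfl
  · simp

theorem isLinearMap_reduce {m n : ℕ} (w : Fin m ↪ Fin n) :
    IsLinearMap ℝ (reduce w : Op n → Op m) where
  map_add A B := by
    ext s t
    simp only [reduce, Matrix.of_apply, Matrix.add_apply, ← Finset.sum_add_distrib]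
    exact Finset.sum_congr rfl fun y _ => by split_ifs <;> simp
  map_smul r A := by
    ext s t
    simp only [reduce, Matrix.of_apply, Matrix.smul_apply, Finset.smul_sum]
    exact Finset.sum_congr rfl fun y _ => by split_ifs <;> simp

/-- The inputs of the encryption algorithm with certified deletion as inputs of the underlying
encryption algorithm. -/
def encInput (r a t k : ℕ) : Fin a ⊕ Fin t ⊕ Unit ↪ Fin r ⊕ Fin a ⊕ Fin t ⊕ Fin (k + 1) :=
  ((Function.Embedding.refl _).sumMap ((Function.Embedding.refl _).sumMap
    ⟨fun _ => Fin.last k, fun _ _ _ => rfl⟩)).trans Function.Embedding.inr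

/-- The circuit draws `(x, θ)` and the encryption coins, copies `θ` to the message wires and `x` to
the qubits, adds the masked parity to the wire that holds the input bit, runs the given encryption
circuit, and finally rotates the qubits by Hadamard gates controlled by `θ`. -/
theorem quantumPrepares_enc {S r a t k l : ℕ}
    {enc : Bits r → Bits a → Bits t → Bits (k + 1) → Bits l}
    (h : ClassicalComputable S fun s : Fin r ⊕ Fin a ⊕ Fin t ⊕ Fin (k + 1) → Bool =>
        enc (fun i => s (.inl i)) (fun i => s (.inr (.inl i)))
          (fun i => s (.inr (.inr (.inl i)))) (fun i => s (.inr (.inr (.inr i))))) :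
    QuantumPrepares (4 * S + 11 * k) fun (s : Fin a ⊕ Fin t ⊕ Unit → Bool) (v : Bits (k + k)) =>
      ((2 : ℝ) ^ (k + k))⁻¹ • avg fun c : Bits r =>
        tensor (ketbra (bb84 (v ∘ fstWires k k) (v ∘ sndWires k k)))
          (basisOp (enc c (fun i => s (.inl i)) (fun i => s (.inr (.inl i)))
            (plaintext (v ∘ sndWires k k)
              (s (.inr (.inr ())) ^^ parity (v ∘ fstWires k k) (v ∘ sndWires k k))))) := by
  obtain ⟨N, C, inp, out, hN, hC, hcomp⟩ := h
  set f : Fin N ↪ Fin (N + ((k + k) + k)) := fstWires N ((k + k) + k) with hf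
  set vw : Fin (k + k) ↪ Fin (N + ((k + k) + k)) :=
    (fstWires (k + k) k).trans (sndWires N ((k + k) + k)) with hvw
  set qw : Fin k ↪ Fin (N + ((k + k) + k)) :=
    (sndWires (k + k) k).trans (sndWires N ((k + k) + k)) with hqw
  set xw : Fin k ↪ Fin (N + ((k + k) + k)) := (fstWires k k).trans vw with hxw
  set θw : Fin k ↪ Fin (N + ((k + k) + k)) := (sndWires k k).trans vw with hθw
  set cw : Fin r ↪ Fin (N + ((k + k) + k)) := (Function.Embedding.inl.trans inp).trans f with hcw
  set me : Fin k ↪ Fin r ⊕ Fin a ⊕ Fin t ⊕ Fin (k + 1) := Fin.castSuccEmb.trans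
    (Function.Embedding.inr.trans (Function.Embedding.inr.trans Function.Embedding.inr)) with hme
  set mw : Fin k ↪ Fin (N + ((k + k) + k)) := (me.trans inp).trans f with hmw
  set tw : Fin (N + ((k + k) + k)) := f (inp (.inr (.inr (.inr (Fin.last k))))) with htw
  have hfv : ∀ i j, f i ≠ vw j := fun i j => fstWires_ne_sndWires _ _
  have hfq : ∀ i j, f i ≠ qw j := fun i j => fstWires_ne_sndWires _ _
  have hvq : ∀ i j, vw i ≠ qw j := fun i j h =>
    fstWires_ne_sndWires _ _ ((sndWires N ((k + k) + k)).injective h)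
  have hxθ : ∀ i j, θw i ≠ xw j := fun i j h => fstWires_ne_sndWires _ _ (vw.injective h).symm
  set Q : List (Loc (N + ((k + k) + k))) := copyCircuit θw mw ++ (copyCircuit xw qw ++
    (maskedParity θw xw tw ++ C.map (Loc.map f))) with hQ
  -- The coins occupy input wires of the given circuit, so their number is covered by the size
  -- bound.
  have hr : r ≤ N := by simpa using Fintype.card_le_of_embedding (Function.Embedding.inl.trans inp)
  refine ⟨N + ((k + k) + k), coins vw ++ (coins cw ++ (quantum Q ++ controlledH θw qw)),
    ((encInput r a t k).trans inp).trans f, vw,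
    joinWires qw (out.trans f) fun i j => (hfq _ _).symm, by omega, ?_, ?_, fun s v => ?_⟩
  · have l1 : ∀ {r : ℕ} (w : Fin r → Fin (N + ((k + k) + k))), (coins w).length ≤ r * 1 + r * 1 := by
      intro r w
      rw [coins, List.length_append]
      exact add_le_add (length_sweep_le _ fun i => by simp) (length_sweep_le _ fun i => by simp)
    have l2 : ∀ a b : Fin k → Fin (N + ((k + k) + k)), (copyCircuit a b).length ≤ k * 1 :=
      fun a b => length_sweep_le _ fun i => by simp
    have l3 : (maskedParity θw xw tw).length ≤ k * 3 := length_sweep_le _ fun i => by simp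
    have l4 : (controlledH θw qw).length ≤ k * 1 := length_sweep_le _ fun i => by simp
    have := l1 vw
    have := l1 cw
    have := l2 θw mw
    have := l2 xw qw
    simp only [List.length_append, quantum, List.length_map, hQ]
    omega
  · intro i j
    refine Fin.addCases (fun j => ?_) (fun j => ?_) j
    · exact ne_of_ne_of_eq (hvq i j) (joinWires_castAdd _ _ _ j).symm
    · exact fun h => hfv (out j) i (h.trans (joinWires_natAdd qw (out.trans f) _ j)).symm
  set P₀ : Bits (N + ((k + k) + k)) :=
    Function.extend (((encInput r a t k).trans inp).trans f) s fun _ => false with hP₀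
  have f₀ : P₀ ∘ f = Function.extend inp (Function.extend (encInput r a t k) s fun _ => false)
      fun _ => false := by
    rw [hP₀, extend_trans_comp]
    exact (congrArg _ (extend_const inp false)).trans (extend_trans_extend _ _ _ _ _)
  have q₀ : P₀ ∘ qw = fun _ => false := 
    extend_comp_of_ne (((encInput r a t k).trans inp).trans f) qw (fun i j => hfq _ _) _ _
  have key : ∀ (u : Bits (k + k)) (c : Bits r),
      applyClassical Q (Function.extend cw c (Function.extend vw u P₀)) ∘ vw = u ∧
      applyClassical Q (Function.extend cw c (Function.extend vw u P₀)) ∘ qw = u ∘ fstWires k k ∧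
      applyClassical Q (Function.extend cw c (Function.extend vw u P₀)) ∘ (out.trans f) =
        enc c (fun i => s (.inl i)) (fun i => s (.inr (.inl i))) (plaintext (u ∘ sndWires k k)
              (s (.inr (.inr ())) ^^ parity (u ∘ fstWires k k) (u ∘ sndWires k k))) := by
    intro u c
    set S₁ : Fin r ⊕ Fin a ⊕ Fin t ⊕ Fin (k + 1) → Bool := Function.extend Function.Embedding.inl c
      (Function.extend (encInput r a t k) s fun _ => false) with hS₁
    set P₁ := Function.extend cw c (Function.extend vw u P₀) with hP₁
    have v₁ : P₁ ∘ vw = u := (extend_comp_of_ne cw vw (fun i j => hfv _ _) _ _).trans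
      (Function.extend_comp vw.injective _ _)
    have q₁ : P₁ ∘ qw = fun _ => false := (extend_comp_of_ne cw qw (fun i j => hfq _ _) _ _).trans
      ((extend_comp_of_ne vw qw hvq _ _).trans q₀)
    have f₁ : P₁ ∘ f = Function.extend inp S₁ fun _ => false := by
      rw [hP₁, extend_trans_comp, extend_comp_of_ne vw f fun i j => (hfv j i).symm, f₀]
      exact extend_trans_extend _ _ _ _ _
    have m₁ : ∀ i, P₁ (mw i) = false := fun i => by
      refine (congrFun f₁ (inp (me i))).trans ?_
      rw [extend_at, hS₁, extend_off, extend_off]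
      · rintro (i' | i' | i') <;> simp [encInput, me]
        exact (Fin.castSucc_lt_last i).ne'
      · intro i'; simp [me]
    have θ₁ : (fun i => P₁ (mw i) ^^ P₁ (θw i)) = u ∘ sndWires k k := funext fun i => by
      rw [m₁, Bool.false_xor]
      exact congrFun v₁ (sndWires k k i)
    set P₂ := Function.extend mw (u ∘ sndWires k k) P₁ with hP₂
    have v₂ : P₂ ∘ vw = u := (extend_comp_of_ne mw vw (fun i j => hfv _ _) _ _).trans v₁
    have q₂ : P₂ ∘ qw = fun _ => false := (extend_comp_of_ne mw qw (fun i j => hfq _ _) _ _).trans q₁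
    have f₂ : P₂ ∘ f = Function.extend inp (Function.extend me (u ∘ sndWires k k) S₁)
        fun _ => false := by
      rw [hP₂, extend_trans_comp, f₁]
      exact extend_trans_extend _ _ _ _ _
    have x₂ : (fun i => P₂ (qw i) ^^ P₂ (xw i)) = u ∘ fstWires k k := funext fun i => by
      rw [show P₂ (qw i) = false from congrFun q₂ i, Bool.false_xor]
      exact congrFun v₂ (fstWires k k i)
    set P₃ := Function.extend qw (u ∘ fstWires k k) P₂ with hP₃
    have v₃ : P₃ ∘ vw = u :=
      (extend_comp_of_ne qw vw (fun i j => (hvq j i).symm) _ _).trans v₂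
    have q₃ : P₃ ∘ qw = u ∘ fstWires k k := Function.extend_comp qw.injective _ _
    have f₃ : P₃ ∘ f = Function.extend inp (Function.extend me (u ∘ sndWires k k) S₁)
        fun _ => false := (extend_comp_of_ne qw f (fun i j => (hfq j i).symm) _ _).trans f₂
    have t₃ : P₃ tw = s (.inr (.inr ())) := by
      refine (congrFun f₃ _).trans ?_
      rw [extend_at, extend_off, hS₁, extend_off]
      · exact extend_at (encInput r a t k) s _ (.inr (.inr ()))
      · intro i'; simp
      · intro i'; simp [me]
    have px : P₃ ∘ xw = u ∘ fstWires k k := congrArg (fun y => y ∘ fstWires k k) v₃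
    have pθ : P₃ ∘ θw = u ∘ sndWires k k := congrArg (fun y => y ∘ sndWires k k) v₃
    set b := s (.inr (.inr ())) ^^ parity (u ∘ fstWires k k) (u ∘ sndWires k k) with hb
    have hrun : applyClassical Q P₁ = Function.extend f
        (applyClassical C (Function.update P₃ tw b ∘ f)) (Function.update P₃ tw b) := by
      rw [hQ, applyClassical_append, applyClassical_append, applyClassical_append,
        applyClassical_copyCircuit θw mw fun i j => (hfv _ _).symm, θ₁, ← hP₂,
        applyClassical_copyCircuit xw qw fun i j => hvq _ _, x₂, ← hP₃,
        applyClassical_maskedParity θw xw tw (fun i => (hfv _ _).symm) (fun i => (hfv _ _).symm)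
          (fun i => hxθ i i), t₃, px, pθ, applyClassical_map]
    have f₄ : Function.update P₃ tw b ∘ f = Function.extend inp (Function.update
        (Function.extend me (u ∘ sndWires k k) S₁) (.inr (.inr (.inr (Fin.last k)))) b)
        fun _ => false := by
      rw [htw, update_comp_emb, f₃, update_extend]
    rw [hrun]
    refine ⟨?_, ?_, ?_⟩
    · rw [extend_comp_of_ne f vw hfv, update_comp_of_ne vw P₃ fun i => (hfv _ i).symm, v₃]
    · rw [extend_comp_of_ne f qw hfq, update_comp_of_ne qw P₃ fun i => (hfq _ i).symm, q₃]
    · have e1 : ∀ (y : Bits N) (P : Bits (N + ((k + k) + k))),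
          Function.extend f y P ∘ (out.trans f) = y ∘ out := fun y P => funext fun i => extend_at f y P _
      rw [e1, f₄, hcomp]
      have h1 : ∀ i, S₁ (.inl i) = c i := fun i => extend_at Function.Embedding.inl c _ i
      have h2 : ∀ i, S₁ (.inr (.inl i)) = s (.inl i) := fun i =>
        (extend_off Function.Embedding.inl c _ fun _ => by simp).trans
          (extend_at (encInput r a t k) s _ (.inl i))
      have h3 : ∀ i, S₁ (.inr (.inr (.inl i))) = s (.inr (.inl i)) := fun i =>
        (extend_off Function.Embedding.inl c _ fun _ => by simp).trans
          (extend_at (encInput r a t k) s _ (.inr (.inl i)))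
      have g : ∀ (x : Bits k) z, (∀ i, me i ≠ z) → Function.extend me x S₁ z = S₁ z :=
        fun x z hz => extend_off me x S₁ hz
      have h4 : (fun i => Function.update (Function.extend me (u ∘ sndWires k k) S₁)
          (.inr (.inr (.inr (Fin.last k)))) b (.inr (.inr (.inr i)))) =
          plaintext (u ∘ sndWires k k) b := by
        funext i
        refine Fin.lastCases ?_ (fun i => ?_) i
        · rw [Function.update_self, plaintext_last]
        · rw [Function.update_of_ne (by simp [(Fin.castSucc_lt_last i).ne])]
          exact (extend_at me _ _ i).trans (congrFun (plaintext_castSucc (u ∘ sndWires k k) b) i).symm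
      beta_reduce
      rw [h4]
      congr 1
      · funext i
        rw [Function.update_of_ne (by simp), g _ _ (by simp [me]), h1]
      · funext i
        rw [Function.update_of_ne (by simp), g _ _ (by simp [me]), h2]
      · funext i
        rw [Function.update_of_ne (by simp), g _ _ (by simp [me]), h3]
  have hlin : ∀ D : List (Gate (N + ((k + k) + k))), IsLinearMap ℝ (applyCircuit D) := fun D =>
    isLinearMap_real_of_complex (isLinearMap_circuit D)
  have hproj : IsLinearMap ℝ (project vw v : Op (N + ((k + k) + k)) → _) :=
    ABE.isLinearMap_project_real _ _
  rw [applyCircuit_append, applyCircuit_append, applyCircuit_append]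
  change reduce _ (project vw v (applyCircuit _ (applyCircuit _ (applyCircuit _
    (applyCircuit _ (dyad P₀ P₀)))))) = _
  rw [applyCircuit_coins vw rfl, map_avg (hlin _), map_avg (hlin _), map_avg (hlin _),
    map_avg hproj, map_avg (isLinearMap_reduce _)]
  -- The key wires are never changed after they have been drawn, so the outcome `v` singles out the
  -- draw `u = v`, whose weight is the prefactor.
  have hterm : ∀ u : Bits (k + k), reduce (joinWires qw (out.trans f) fun i j => (hfq _ _).symm)
      (project vw v (applyCircuit (controlledH θw qw) (applyCircuit (quantum Q)
        (applyCircuit (coins cw) (dyad (Function.extend vw u P₀) (Function.extend vw u P₀)))))) =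
      if u = v then avg fun c : Bits r =>
        tensor (ketbra (bb84 (v ∘ fstWires k k) (v ∘ sndWires k k)))
          (basisOp (enc c (fun i => s (.inl i)) (fun i => s (.inr (.inl i)))
            (plaintext (v ∘ sndWires k k)
              (s (.inr (.inr ())) ^^ parity (v ∘ fstWires k k) (v ∘ sndWires k k))))) else 0 := by
    intro u
    rw [applyCircuit_coins cw rfl, map_avg (hlin _), map_avg (hlin _), map_avg hproj,
      map_avg (isLinearMap_reduce _)]
    have hc : ∀ c : Bits r, _ = _ := fun c => reduce_controlledH θw qw (out.trans f) vw
      (fun i j => hvq _ _) (fun i j => (hfq _ _).symm) hvq (fun i j => (hfv _ _).symm)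
      (applyClassical Q (Function.extend cw c (Function.extend vw u P₀))) v
    simp only [applyCircuit_quantum_dyad, hc]
    by_cases huv : u = v
    · subst huv
      rw [if_pos rfl]
      refine congrArg avg (funext fun c => ?_)
      obtain ⟨k1, k2, k3⟩ := key u c
      have k4 : applyClassical Q (Function.extend cw c (Function.extend vw u P₀)) ∘ θw =
          u ∘ sndWires k k := congrArg (fun y => y ∘ sndWires k k) k1
      rw [if_pos k1, k2, k3, k4]
    · rw [if_neg huv]
      have : ∀ c, ¬ applyClassical Q (Function.extend cw c (Function.extend vw u P₀)) ∘ vw = v :=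
        fun c h => huv ((key u c).1.symm.trans h)
      simp only [if_neg (this _)]
      exact avg_const _
  simp only [hterm]
  rw [avg, Finset.sum_ite_eq' Finset.univ v, if_pos (Finset.mem_univ _)]

/-! ### The decryption circuit -/

theorem linear_ext_dyad {q : ℕ} {F G : Op q → ℂ} (hF : IsLinearMap ℂ F) (hG : IsLinearMap ℂ G)
    (h : ∀ A B, F (dyad A B) = G (dyad A B)) (σ : Op q) : F σ = G σ := by
  have hs : ∀ A B (c : ℂ), (Matrix.single A B c : Op q) = c • dyad A B := fun A B c => by
    rw [dyad, Matrix.smul_single, smul_eq_mul, mul_one]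
  rw [Matrix.matrix_eq_sum_single σ, IsLinearMap.map_sum' hF, IsLinearMap.map_sum' hG]
  refine Finset.sum_congr rfl fun A _ => ?_
  rw [IsLinearMap.map_sum' hF, IsLinearMap.map_sum' hG]
  refine Finset.sum_congr rfl fun B _ => ?_
  rw [hs, hF.map_smul, hG.map_smul, h]

theorem load_dyad {m n : ℕ} (w : Fin m ↪ Fin n) (A B : Bits m) (P : Bits n) :
    load w (dyad A B) (basisOp P) = dyad (Function.extend w A P) (Function.extend w B P) := by
  ext y z
  rw [dyad_apply]
  change dyad A B (y ∘ w) (z ∘ w) * ∑ t, basisOp P (Function.extend w t y) (Function.extend w t z) = _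
  simp only [dyad_apply, ABE.basisOp_apply]
  have hb : ∀ t : Bits m, (P = Function.extend w t y ∧ P = Function.extend w t z) ↔
      t = P ∘ w ∧ Function.extend w (y ∘ w) P = y ∧ Function.extend w (z ∘ w) P = z := fun t => by
    rw [extend_eq_iff w t y P, extend_eq_iff w t z P]
    tauto
  have hA : ∀ (A : Bits m) (y : Bits n), Function.extend w A P = y ↔
      A = y ∘ w ∧ Function.extend w (y ∘ w) P = y := fun A y => by
    constructor
    · rintro rfl
      rw [Function.extend_comp w.injective]
      exact ⟨rfl, rfl⟩
    · rintro ⟨rfl, h⟩; exact h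
  rw [Finset.sum_congr rfl fun t (_ : t ∈ Finset.univ) =>
    if_congr (hb t) (rfl : (1 : ℂ) = 1) (rfl : (0 : ℂ) = 0), if_congr (and_congr (hA A y) (hA B z)) rfl rfl]
  rw [Finset.sum_eq_single (P ∘ w) (fun t _ ht => if_neg fun h => ht h.1) (by simp)]
  simp only [true_and]
  by_cases h1 : A = y ∘ w ∧ B = z ∘ w
  · rw [if_pos h1, one_mul]
    exact if_congr (by tauto) rfl rfl
  · rw [if_neg h1, zero_mul, if_neg fun h => h1 ⟨h.1.1, h.2.1⟩]

theorem sum_mul_diag_quantum {n : ℕ} (C : List (Loc n)) (ρ : Op n) (f : Bits n → ℂ) :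
    ∑ y, f y * applyCircuit (quantum C) ρ y y = ∑ y, f (applyClassical C y) * ρ y y := by
  induction C generalizing ρ with
  | nil => rfl
  | cons g C ih =>
    rw [quantum, List.map_cons, applyCircuit_cons]
    refine (ih _).trans ?_
    simp only [unitary_X_apply, applyClassical_cons]
    refine Fintype.sum_equiv (Function.Involutive.toPerm g.flip g.flip_flip) _ _ fun y => ?_
    change _ = f (applyClassical C (g.flip (g.flip y))) * _
    rw [g.flip_flip]; rfl

/-- The hypothesis on `P` and `Q` says that they differ at most on `w`; so they have the same
controls, and the diagonal entries run over the contents of `w`. -/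
theorem sum_mul_diag_controlledH {n k : ℕ} (c : Fin k → Fin n) (w : Fin k ↪ Fin n)
    (h : ∀ i j, c i ≠ w j) {P Q : Bits n} (hPQ : ∀ x, Function.extend w x P = Function.extend w x Q)
    (f : Bits n → ℂ) :
    ∑ y, f y * applyCircuit (controlledH c w) (dyad P Q) y y =
      ∑ z, bb84 (P ∘ w) (P ∘ c) z * bb84 (Q ∘ w) (P ∘ c) z * f (Function.extend w z P) := by
  have hc : Q ∘ c = P ∘ c := by
    rw [← extend_comp_of_ne w c (fun i j => (h j i).symm) (P ∘ w) P, hPQ,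
      extend_comp_of_ne w c fun i j => (h j i).symm]
  simp only [applyCircuit_controlledH_dyad c w h, ← hPQ, and_self, hc, mul_ite, mul_zero]
  rw [← Finset.sum_filter]
  refine Finset.sum_bij' (fun y _ => y ∘ w) (fun z _ => Function.extend w z P) (by simp) ?_ ?_ ?_ ?_
  · intro z _
    simp [extend_comp_self]
  · intro y hy
    exact (Finset.mem_filter.mp hy).2
  · intro z _
    exact extend_comp_self _ _ _
  · intro y hy
    rw [(Finset.mem_filter.mp hy).2, mul_comm]

/-- The effect of the decryption on the quantum part of a ciphertext, if `d` is the result of the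
decryption of its classical part. -/
def decEffect {k : ℕ} (d : Option (Bits (k + 1))) (o : Option Bool) : Op k :=
  match d with
  | none => if o = none then 1 else 0
  | some m => ∑ x : Bits k, if o = some (m (Fin.last k) ^^ parity x fun i => m i.castSucc) then
      ketbra (bb84 x fun i => m i.castSucc) else 0

theorem bb84_comm {k : ℕ} (x θ z : Bits k) : bb84 x θ z = bb84 z θ x := by
  rw [bb84_eq, bb84_eq]
  refine Finset.prod_congr rfl fun i _ => ?_
  simp only [qubit, hadamard_comm (z i), eq_comm (a := z i)]

/-- If decryption fails, the all-zero code of `⊥` makes the basis computational and the flag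
suppresses the parity, and orthonormality turns the sum into the identity effect. Otherwise the sum
over `z` is the measurement in the decrypted basis, by symmetry of the amplitudes in `x` and `z`. -/
theorem sum_decEffect {k : ℕ} (d : Option (Bits (k + 1))) (t : Bits (1 + 1)) (A B : Bits k) :
    (∑ o : Option Bool, if optBits (o.map fun b => (fun _ => b : Bits 1)) = t then
      decEffect d o B A else 0) =
    ∑ z, bb84 A (fun i => optBits d i.castSucc.succ) z * bb84 B (fun i => optBits d i.castSucc.succ) z *
      if optBits d 0 = t 0 ∧ (optBits d 0 && (optBits d (Fin.last k).succ ^^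
        parity z fun i => optBits d i.castSucc.succ)) = t 1 then 1 else 0 := by
  cases d with
  | none =>
    have h0 : ∀ i, optBits (none : Option (Bits (k + 1))) i = false := fun _ => rfl
    simp only [h0, Bool.false_and, ← Finset.sum_mul, bb84_orth]
    rw [Finset.sum_eq_single none (by
      intro o _ ho
      simp only [decEffect, if_neg ho, Matrix.zero_apply, ite_self]) (by simp)]
    have ht : (optBits (Option.map (fun b => (fun _ => b : Bits 1)) none) = t) ↔
        false = t 0 ∧ false = t 1 := by
      rw [funext_iff]; exact Fin.forall_fin_two
    rw [if_congr ht rfl rfl, decEffect, if_pos rfl, Matrix.one_apply]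
    split_ifs <;> simp_all
  | some m =>
    have h1 : ∀ i, optBits (some m) (Fin.succ i) = m i := fun _ => rfl
    have h0 : optBits (some m) 0 = true := rfl
    simp only [h0, h1, Bool.true_and]
    have ht : ∀ b : Bool, (optBits ((some b).map fun b => (fun _ => b : Bits 1)) = t) ↔
        true = t 0 ∧ b = t 1 := fun b => by
      rw [funext_iff]; exact Fin.forall_fin_two
    have he : ∀ o : Option Bool, (if optBits (o.map fun b => (fun _ => b : Bits 1)) = t then
        decEffect (some m) o B A else 0) = ∑ x : Bits k,
          if o = some (m (Fin.last k) ^^ parity x fun i => m i.castSucc) then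
            (if optBits (o.map fun b => (fun _ => b : Bits 1)) = t then
              bb84 x (fun i => m i.castSucc) B * bb84 x (fun i => m i.castSucc) A else 0) else 0 := by
      intro o
      by_cases ho : optBits (o.map fun b => (fun _ => b : Bits 1)) = t
      · simp only [if_pos ho, decEffect, Matrix.sum_apply]
        refine Finset.sum_congr rfl fun x _ => ?_
        split_ifs
        · rw [ketbra, Matrix.vecMulVec_apply, Pi.star_apply, bb84_star]
        · rfl
      · simp only [if_neg ho, ite_self, Finset.sum_const_zero]
    simp only [he]
    rw [Finset.sum_comm]
    refine Finset.sum_congr rfl fun x _ => ?_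
    rw [Finset.sum_ite_eq' Finset.univ, if_pos (Finset.mem_univ _), if_congr (ht _) rfl rfl,
      bb84_comm x, bb84_comm x _ A]
    split_ifs <;> ring

/-- Two wires. -/
def pairWires {n : ℕ} (a b : Fin n) (h : a ≠ b) : Fin (1 + 1) ↪ Fin n where
  toFun := ![a, b]
  inj' i j hij := by
    fin_cases i <;> fin_cases j
    · rfl
    · exact absurd hij h
    · exact absurd hij h.symm
    · rfl

theorem comp_pairWires_eq_iff {n : ℕ} (a b : Fin n) (h : a ≠ b) (y : Bits n) (t : Bits (1 + 1)) :
    y ∘ pairWires a b h = t ↔ y a = t 0 ∧ y b = t 1 := by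
  rw [funext_iff]; exact Fin.forall_fin_two

theorem tensor_decEffect_apply {k l : ℕ} (M : Op k) (ct : Bits l) (y z : Bits (k + l)) :
    tensor M (basisOp ct) y z = if ct = y ∘ sndWires k l then
      (if y ∘ sndWires k l = z ∘ sndWires k l then M (y ∘ fstWires k l) (z ∘ fstWires k l) else 0)
      else 0 := by
  rw [tensor_apply, ABE.basisOp_apply]
  by_cases h1 : ct = y ∘ sndWires k l
  · by_cases h2 : y ∘ sndWires k l = z ∘ sndWires k l
    · rw [if_pos ⟨h1, h1.trans h2⟩, if_pos h1, if_pos h2, mul_one]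
    · rw [if_neg fun h => h2 (h.1.symm.trans h.2), if_neg h2, ite_self, mul_zero]
  · rw [if_neg fun h => h1 h.1, if_neg h1, mul_zero]

/-- The final Toffoli gate multiplies the decrypted bit by the success flag, so that a failure is
reported as `00`, the code of `⊥`, whatever the parity is. -/
theorem trace_decCircuit {n k : ℕ} (θw : Fin k → Fin n) (qw : Fin k ↪ Fin n) (bw fw rw : Fin n)
    (hθq : ∀ i j, θw i ≠ qw j) (hqb : ∀ i, qw i ≠ bw) (hθb : ∀ i, θw i ≠ bw) (hqf : ∀ i, qw i ≠ fw)
    (hqr : ∀ i, qw i ≠ rw) (hfb : fw ≠ bw) (hfr : fw ≠ rw) (hbr : bw ≠ rw) {P Q : Bits n}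
    (hPQ : ∀ x, Function.extend qw x P = Function.extend qw x Q) (hr : P rw = false)
    (t : Bits (1 + 1)) :
    (project (pairWires fw rw hfr) t (applyCircuit (quantum (maskedParity θw qw bw ++
      [Loc.toffoli fw bw rw])) (applyCircuit (controlledH θw qw) (dyad P Q)))).trace =
    ∑ z, bb84 (P ∘ qw) (P ∘ θw) z * bb84 (Q ∘ qw) (P ∘ θw) z *
      if P fw = t 0 ∧ (P fw && (P bw ^^ parity z (P ∘ θw))) = t 1 then 1 else 0 := by
  rw [trace_project]
  have h1 : ∀ M : Op n, (∑ y, if y ∘ pairWires fw rw hfr = t then M y y else 0) =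
      ∑ y, (if y ∘ pairWires fw rw hfr = t then 1 else 0) * M y y := fun M =>
    Finset.sum_congr rfl fun y _ => by split_ifs <;> simp
  rw [h1, sum_mul_diag_quantum _ _ fun y => if y ∘ pairWires fw rw hfr = t then (1 : ℂ) else 0,
    sum_mul_diag_controlledH θw qw hθq hPQ]
  refine Finset.sum_congr rfl fun z _ => ?_
  congr 1
  refine if_congr ?_ rfl rfl
  rw [applyClassical_append, applyClassical_maskedParity θw qw bw hθb hqb (fun i => hθq i i),
    applyClassical_cons, applyClassical_nil, Loc.flip_toffoli hfr hbr, comp_pairWires_eq_iff,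
    Function.update_of_ne hfr, Function.update_self, Function.update_of_ne hfb,
    Function.update_of_ne hbr.symm, Function.update_self, extend_off qw _ _ hqf,
    extend_off qw _ _ hqr, extend_off qw _ _ hqb, hr, Bool.false_xor, extend_comp_self,
    extend_comp_of_ne qw θw fun i j => (hθq j i).symm]

/-- The received register is arbitrary, so its classical part is measured first; the effects are
diagonal there. Then the coins are drawn, the decryption circuit is run, and the qubits are read in
the decrypted basis. By linearity the comparison is made on matrix units. -/
theorem quantumMeasures_dec {S r a l k : ℕ} {dec : Bits r → Bits a → Bits l → Option (Bits (k + 1))}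
    (h : ClassicalComputable S fun s : Fin r ⊕ Fin a ⊕ Fin l → Bool =>
        optBits (dec (fun i => s (.inl i)) (fun i => s (.inr (.inl i)))
          (fun i => s (.inr (.inr i))))) :
    QuantumMeasures (4 * S + 4 * k + 1) (fun o : Option Bool => optBits (o.map fun b => (fun _ => b : Bits 1)))
      fun (s : Bits a) o => ∑ ct : Bits l, avg fun c : Bits r =>
        tensor (decEffect (dec c s ct) o) (basisOp ct) := by
  obtain ⟨N, C, inp, out, hN, hC, hcomp⟩ := h
  set f : Fin N ↪ Fin (N + (k + 1)) := fstWires N (k + 1) with hf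
  set qw : Fin k ↪ Fin (N + (k + 1)) := (fstWires k 1).trans (sndWires N (k + 1)) with hqw
  set rw : Fin (N + (k + 1)) := sndWires N (k + 1) (sndWires k 1 0) with hrw
  set cw : Fin r ↪ Fin (N + (k + 1)) := (Function.Embedding.inl.trans inp).trans f with hcw
  set ei : Fin a ↪ Fin r ⊕ Fin a ⊕ Fin l :=
    Function.Embedding.inl.trans Function.Embedding.inr with hei
  set el : Fin l ↪ Fin r ⊕ Fin a ⊕ Fin l :=
    Function.Embedding.inr.trans Function.Embedding.inr with hel
  set tw : Fin l ↪ Fin (N + (k + 1)) := (el.trans inp).trans f with htw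
  have hfq : ∀ i j, f i ≠ qw j := fun i j => fstWires_ne_sndWires _ _
  have hfr : ∀ i, f i ≠ rw := fun i => fstWires_ne_sndWires _ _
  have hqr : ∀ i, qw i ≠ rw := fun i h =>
    fstWires_ne_sndWires _ _ ((sndWires N (k + 1)).injective h)
  set θw : Fin k → Fin (N + (k + 1)) := fun i => f (out i.castSucc.succ) with hθw
  have hout : ∀ {i j}, i ≠ j → f (out i) ≠ f (out j) := fun h h' => h (out.injective (f.injective h'))
  have hr : r ≤ N := by simpa using Fintype.card_le_of_embedding (Function.Embedding.inl.trans inp)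
  have hl : l ≤ N := by simpa using Fintype.card_le_of_embedding (el.trans inp)
  have hqt : ∀ i j, qw i ≠ tw j := fun i j => (hfq _ _).symm
  have hinQ : ∀ (s : Bits (k + l)) y, Function.extend (joinWires qw tw hqt) s y =
      Function.extend qw (s ∘ fstWires k l) (Function.extend tw (s ∘ sndWires k l) y) :=
    fun s y => extend_joinWires qw tw hqt s y
  refine ⟨N + (k + 1), measureAll tw ++ (coins cw ++ (quantum (C.map (Loc.map f)) ++
    (controlledH θw qw ++ quantum (maskedParity θw qw (f (out (Fin.last k).succ)) ++
      [Loc.toffoli (f (out 0)) (f (out (Fin.last k).succ)) rw])))),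
    (ei.trans inp).trans f, joinWires qw tw hqt, pairWires (f (out 0)) rw (hfr _), by omega, ?_, ?_,
    fun s σ t => ?_⟩
  · have l0 : (measureAll tw).length ≤ l * 1 := length_sweep_le _ fun i => by simp
    have l1 : (coins cw).length ≤ r * 1 + r * 1 := by
      rw [coins, List.length_append]
      exact add_le_add (length_sweep_le _ fun i => by simp) (length_sweep_le _ fun i => by simp)
    have l3 : (maskedParity θw qw (f (out (Fin.last k).succ))).length ≤ k * 3 :=
      length_sweep_le _ fun i => by simp
    have l4 : (controlledH θw qw).length ≤ k * 1 := length_sweep_le _ fun i => by simp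
    simp only [List.length_append, quantum, List.length_map, List.length_singleton]
    omega
  · intro i j
    refine Fin.addCases (fun j => ?_) (fun j => ?_) j
    · exact fun h => hfq (inp (ei i)) j (h.trans (joinWires_castAdd qw tw hqt j))
    · exact fun h => by
        have := inp.injective (f.injective (h.trans (joinWires_natAdd qw tw hqt j)))
        simp [ei, el] at this
  set P₀ : Bits (N + (k + 1)) := Function.extend ((ei.trans inp).trans f) s fun _ => false with hP₀
  set D := measureAll tw ++ (coins cw ++ (quantum (C.map (Loc.map f)) ++
    (controlledH θw qw ++ quantum (maskedParity θw qw (f (out (Fin.last k).succ)) ++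
      [Loc.toffoli (f (out 0)) (f (out (Fin.last k).succ)) rw])))) with hD
  have hT : IsLinearMap ℂ fun M : Op (N + (k + 1)) =>
      (project (pairWires (f (out 0)) rw (hfr _)) t M).trace :=
    IsLinearMap.comp' (Matrix.traceLinearMap _ ℂ ℂ).isLinear (isLinearMap_project _ _)
  refine linear_ext_dyad (F := fun σ => (project (pairWires (f (out 0)) rw (hfr _)) t
    (applyCircuit D (load (joinWires qw tw hqt) σ (basisOp P₀)))).trace)
    (G := fun σ => ∑ o : Option Bool, if optBits (o.map fun b => (fun _ => b : Bits 1)) = t then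
      ((∑ ct : Bits l, avg fun c : Bits r =>
        tensor (decEffect (dec c s ct) o) (basisOp ct)) * σ).trace else 0) ?_ ?_ (fun A B => ?_) σ
  · have hDL := IsLinearMap.comp' (isLinearMap_circuit D)
      (isLinearMap_load_left (joinWires qw tw hqt) (basisOp P₀))
    exact IsLinearMap.comp' (F := fun σ => applyCircuit D (load _ σ _))
      (G := fun M => (project _ t M).trace) hT hDL
  · refine isLinearMap_sum _ fun o => ?_
    split_ifs
    · exact IsLinearMap.comp' (Matrix.traceLinearMap _ ℂ ℂ).isLinear
        (LinearMap.mulLeft ℂ (_ : Op (k + l))).isLinear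
    · exact isLinearMap_zero
  have hR : (∑ o : Option Bool, if optBits (o.map fun b => (fun _ => b : Bits 1)) = t then
      ((∑ ct : Bits l, avg fun c : Bits r =>
        tensor (decEffect (dec c s ct) o) (basisOp ct)) * dyad A B).trace else 0) =
      if B ∘ sndWires k l = A ∘ sndWires k l then avg fun c : Bits r =>
        ∑ o : Option Bool, if optBits (o.map fun b => (fun _ => b : Bits 1)) = t then
          decEffect (dec c s (B ∘ sndWires k l)) o (B ∘ fstWires k l) (A ∘ fstWires k l) else 0
      else 0 := by
    have ho : ∀ o, ((∑ ct : Bits l, avg fun c : Bits r =>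
        tensor (decEffect (dec c s ct) o) (basisOp ct)) * dyad A B).trace =
        if B ∘ sndWires k l = A ∘ sndWires k l then avg fun c : Bits r =>
          decEffect (dec c s (B ∘ sndWires k l)) o (B ∘ fstWires k l) (A ∘ fstWires k l) else 0 := by
      intro o
      rw [Matrix.trace_mul_single]
      simp only [avg, Matrix.sum_apply, Matrix.smul_apply, tensor_decEffect_apply]
      rw [Finset.sum_eq_single (B ∘ sndWires k l) (fun ct _ h => by
        simp only [if_neg h, Finset.sum_const_zero, smul_zero]) (by simp)]
      simp only [if_true]
      split_ifs
      · simp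
      · simp
    simp only [ho]
    by_cases h : B ∘ sndWires k l = A ∘ sndWires k l
    · simp only [if_pos h, avg, ← Finset.sum_filter]
      rw [← Finset.smul_sum, Finset.sum_comm]
    · simp only [if_neg h, ite_self, Finset.sum_const_zero]
  refine Eq.trans ?_ hR.symm
  have hproj : IsLinearMap ℝ fun M : Op (N + (k + 1)) =>
      (project (pairWires (f (out 0)) rw (hfr _)) t M).trace :=
    ⟨hT.map_add, fun r M => by
      have := hT.map_smul (r : ℂ) M
      simpa using this⟩
  have hlin : ∀ D : List (Gate (N + (k + 1))), IsLinearMap ℝ (applyCircuit D) := fun D =>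
    isLinearMap_real_of_complex (isLinearMap_circuit D)
  have et : ∀ (x : Bits k) (y : Bits l) P, Function.extend qw x (Function.extend tw y P) ∘ tw = y :=
    fun x y P => (extend_comp_of_ne qw tw hqt _ _).trans (extend_comp_self _ _ _)
  rw [load_dyad, hD, applyCircuit_append, applyCircuit_append, applyCircuit_append,
    applyCircuit_append, applyCircuit_measureAll_dyad, hinQ, hinQ, et, et]
  -- If the classical parts differ, the initial measurement kills the term on the left and the
  -- effects have no such entry on the right.
  by_cases hAB : A ∘ sndWires k l = B ∘ sndWires k l
  swap
  · rw [if_neg hAB, if_neg (Ne.symm hAB)]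
    simp only [(isLinearMap_circuit _).map_zero]
    exact hT.map_zero
  rw [if_pos hAB, if_pos hAB.symm, hAB]
  set ct := B ∘ sndWires k l with hct
  have ec : ∀ (x : Bits k) (P : Bits (N + (k + 1))), Function.extend qw x P ∘ cw = P ∘ cw :=
    fun x P => extend_comp_of_ne qw cw (fun i j => (hfq _ _).symm) _ _
  rw [applyCircuit_coins cw ((ec _ _).trans (ec _ _).symm), map_avg (hlin _), map_avg (hlin _),
    map_avg (hlin _)]
  refine (map_avg hproj _).trans (congrArg avg (funext fun c => ?_))
  rw [applyCircuit_quantum_dyad, applyClassical_map, applyClassical_map, sum_decEffect]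
  set S₀ : Fin r ⊕ Fin a ⊕ Fin l → Bool := Sum.elim c (Sum.elim s ct) with hS₀
  have hS : Function.extend Function.Embedding.inl c (Function.extend el ct
      (Function.extend ei s fun _ => false)) = S₀ := by
    funext i
    rcases i with i | i | i
    · exact extend_at Function.Embedding.inl _ _ i
    · rw [extend_off Function.Embedding.inl _ _ fun j => by simp,
        extend_off el _ _ fun j => by simp [el]]
      exact extend_at ei _ _ i
    · rw [extend_off Function.Embedding.inl _ _ fun j => by simp]
      exact extend_at el _ _ i
  have f₁ : ∀ x : Bits k, Function.extend cw c (Function.extend qw x (Function.extend tw ct P₀)) ∘ f =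
      Function.extend inp S₀ fun _ => false := fun x => by
    rw [extend_trans_comp, extend_comp_of_ne qw f fun i j => (hfq j i).symm, extend_trans_comp,
      hP₀, extend_trans_comp, ← hS]
    refine (congrArg _ ((congrArg _ ((congrArg _ (extend_const inp false)).trans
      (extend_trans_extend ei inp _ _ _))).trans
      (extend_trans_extend el inp _ _ _))).trans (extend_trans_extend _ inp _ _ _)
  rw [f₁, f₁]
  set Y := applyClassical C (Function.extend inp S₀ fun _ => false) with hY
  have hYout : Y ∘ out = optBits (dec c s ct) := hcomp S₀
  have eq : ∀ x : Bits k, Function.extend f Y (Function.extend cw c (Function.extend qw x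
      (Function.extend tw ct P₀))) ∘ qw = x := fun x => by
    rw [extend_comp_of_ne f qw hfq, extend_comp_of_ne cw qw fun i j => hfq _ _, extend_comp_self]
  -- The decryption circuit does not touch the qubits, so the two sides of the matrix unit still
  -- differ on the wires `qw` only.
  have eall : ∀ x x' : Bits k, Function.extend qw x' (Function.extend f Y (Function.extend cw c
      (Function.extend qw x (Function.extend tw ct P₀)))) = Function.extend f Y (Function.extend cw c
      (Function.extend qw x' (Function.extend tw ct P₀))) := fun x x' => by
    funext j
    by_cases hj : ∃ i, qw i = j
    · obtain ⟨i, rfl⟩ := hj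
      rw [extend_at]
      exact (congrFun (eq x') i).symm
    · have hq : ∀ i, qw i ≠ j := fun i h => hj ⟨i, h⟩
      rw [extend_off qw _ _ hq]
      by_cases hj' : ∃ i, f i = j
      · obtain ⟨i, rfl⟩ := hj'
        rw [extend_at, extend_at]
      · have hf' : ∀ i, f i ≠ j := fun i h => hj' ⟨i, h⟩
        rw [extend_off f _ _ hf', extend_off f _ _ hf', extend_off cw _ _ fun i => hf' _,
          extend_off cw _ _ fun i => hf' _, extend_off qw _ _ hq, extend_off qw _ _ hq]
  refine (trace_decCircuit θw qw _ _ rw (fun i j => hfq _ _) (fun i => (hfq _ _).symm)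
    (fun i => hout fun h => (Fin.castSucc_lt_last i).ne (Fin.succ_injective _ h))
    (fun i => (hfq _ _).symm) hqr (hout (Fin.succ_ne_zero _).symm) (hfr _) (hfr _)
    (fun x => (eall _ x).trans (eall _ x).symm) ?_ t).trans ?_
  · rw [extend_off f _ _ hfr, extend_off cw _ _ fun i => hfr _, extend_off qw _ _ hqr,
      extend_off tw _ _ fun i => hfr _]
    exact extend_off _ _ _ fun i => hfr _
  · have eo : ∀ x i, Function.extend f Y (Function.extend cw c (Function.extend qw x
        (Function.extend tw ct P₀))) (f (out i)) = optBits (dec c s ct) i := fun x i =>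
      (extend_at f _ _ _).trans (congrFun hYout i)
    rw [eq, eq]
    simp only [eo, Function.comp_def, hθw]

/-! ### The deletion circuit -/

theorem load_refl {n : ℕ} (σ : Op n) (P : Bits n) :
    load (Function.Embedding.refl _) σ (basisOp P) = σ := by
  ext y z
  have h : ∀ t y : Bits n, Function.extend (Function.Embedding.refl (Fin n)) t y = t := fun t y =>
    extend_comp_self (Function.Embedding.refl _) t y
  change σ y z * ∑ t : Bits n, basisOp P (Function.extend (Function.Embedding.refl _) t y)
    (Function.extend (Function.Embedding.refl _) t z) = σ y z
  simp only [h, ABE.basisOp_apply, and_self, Finset.sum_ite_eq, Finset.mem_univ, if_true, mul_one]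

theorem applyCircuit_allH_dyad {n k : ℕ} (w : Fin k ↪ Fin n) (P Q y z : Bits n) :
    applyCircuit (allH w) (dyad P Q) y z =
      if Function.extend w (y ∘ w) P = y ∧ Function.extend w (z ∘ w) Q = z then
        hadamardState (P ∘ w) (y ∘ w) * hadamardState (Q ∘ w) (z ∘ w) else 0 := by
  rw [applyCircuit_allH]
  simp only [dyad_apply, extend_eq_iff w]
  rw [Finset.sum_eq_single (P ∘ w), Finset.sum_eq_single (Q ∘ w)]
  · simp only [true_and]
    split_ifs
    · rw [mul_one]
    · rw [mul_zero]
  · intro x _ hx; simp [hx]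
  · simp
  · intro x _ hx; simp [hx]
  · simp

/-- The register itself is the whole machine, without ancillas. The Hadamard amplitudes are
symmetric, so rotating and reading the qubits is the measurement in the Hadamard basis, while the
classical part is ignored. -/
theorem quantumMeasures_del (k l : ℕ) :
    QuantumMeasures (k + l) (fun t : Bits k => t) fun (_ : Bits 0) (x : Bits k) =>
      tensor (ketbra (bb84 x fun _ => true)) (1 : Op l) := by
  refine ⟨k + l, allH (fstWires k l), ⟨Fin.elim0, fun i => i.elim0⟩, Function.Embedding.refl _,
    fstWires k l, le_rfl, ?_, fun i => i.elim0, fun s σ t => ?_⟩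
  · have : (allH (fstWires k l)).length ≤ k * 1 := length_sweep_le _ fun i => by simp
    omega
  rw [load_refl, Finset.sum_ite_eq' Finset.univ t, if_pos (Finset.mem_univ _)]
  refine linear_ext_dyad (F := fun σ => (project (fstWires k l) t
    (applyCircuit (allH (fstWires k l)) σ)).trace) (G := fun σ =>
      (tensor (ketbra (bb84 t fun _ => true)) (1 : Op l) * σ).trace) ?_ ?_ (fun A B => ?_) σ
  · exact IsLinearMap.comp' (Matrix.traceLinearMap _ ℂ ℂ).isLinear
      (IsLinearMap.comp' (isLinearMap_project _ _) (isLinearMap_circuit _))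
  · exact IsLinearMap.comp' (Matrix.traceLinearMap _ ℂ ℂ).isLinear
      (LinearMap.mulLeft ℂ (_ : Op (k + l))).isLinear
  · rw [trace_project, Matrix.trace_mul_single, tensor_apply, ketbra, Matrix.vecMulVec_apply,
      Pi.star_apply, bb84_star, Matrix.one_apply]
    simp only [applyCircuit_allH_dyad]
    have hs : ∀ (A : Bits (k + l)), Function.extend (fstWires k l) t A ∘ sndWires k l =
        A ∘ sndWires k l := fun A =>
      extend_comp_of_ne _ _ (fun i j => fstWires_ne_sndWires i j) _ _
    rw [Finset.sum_eq_single (Function.extend (fstWires k l) t A)]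
    · rw [extend_comp_self, if_pos rfl]
      have h : (Function.extend (fstWires k l) t A = Function.extend (fstWires k l) t A ∧
          Function.extend (fstWires k l) t B = Function.extend (fstWires k l) t A) ↔
          B ∘ sndWires k l = A ∘ sndWires k l := by
        constructor
        · intro h
          have := congrArg (fun y => y ∘ sndWires k l) h.2
          simpa only [hs] using this
        · intro h
          refine ⟨rfl, wires_ext ?_ ?_⟩
          · rw [extend_comp_self, extend_comp_self]
          · rw [hs, hs, h]
      rw [if_congr h rfl rfl, hadamardState, hadamardState, bb84_comm _ _ t, bb84_comm _ _ t,
        MulOpposite.op_one, one_smul]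
      split_ifs <;> ring
    · intro y _ hy
      by_cases h : y ∘ fstWires k l = t
      · rw [if_pos h, h, if_neg fun h' => hy h'.1.symm]
      · rw [if_neg h]
    · simp

/-! ### The verification circuit -/

/-- One step of the verification: the wires `(i, 0)`, `(i, 1)`, `(i, 2)` hold `x i`, `θ i` and the
`i`-th bit of the certificate, `(i, 3)` is an ancilla, and `(i, 4)` holds the result for the
positions before `i`. -/
def verStep {n k : ℕ} (w : Fin (k + 1) × Fin 5 ↪ Fin n) (i : Fin k) : List (Loc n) :=
  [Loc.cnot (w (i.castSucc, 2)) (w (i.castSucc, 0)),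
    Loc.toffoli (w (i.castSucc, 1)) (w (i.castSucc, 0)) (w (i.castSucc, 3)),
    Loc.free (w (i.castSucc, 3)),
    Loc.toffoli (w (i.castSucc, 3)) (w (i.castSucc, 4)) (w (i.succ, 4))]

/-- The gates form the disagreement `x i ⊕ t i`, mask it by `θ i` on a fresh ancilla, negate it, and
take the conjunction with the result so far. The last target is a fresh wire of the next row because
a conjunction cannot be computed reversibly in place. -/
theorem applyClassical_verStep {n k : ℕ} (w : Fin (k + 1) × Fin 5 ↪ Fin n) (i : Fin k)
    {P : Bits n} (hm : P (w (i.castSucc, 3)) = false) (ho : P (w (i.succ, 4)) = false) :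
    applyClassical (verStep w i) P (w (i.succ, 4)) = (P (w (i.castSucc, 4)) &&
      decide (P (w (i.castSucc, 1)) = true → P (w (i.castSucc, 0)) = P (w (i.castSucc, 2)))) ∧
    ∀ j, (∀ c, w (i.castSucc, c) ≠ j) → w (i.succ, 4) ≠ j →
      applyClassical (verStep w i) P j = P j := by
  have hw : ∀ {a b : Fin (k + 1)} {c d : Fin 5}, c ≠ d → w (a, c) ≠ w (b, d) := fun h h' =>
    h (Prod.ext_iff.mp (w.injective h')).2
  have hi : w (i.castSucc, 4) ≠ w (i.succ, 4) := fun h =>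
    (Fin.castSucc_lt_succ (i := i)).ne (Prod.ext_iff.mp (w.injective h)).1
  rw [verStep, applyClassical_cons, applyClassical_cons, applyClassical_cons, applyClassical_cons,
    applyClassical_nil, Loc.flip_cnot (hw (by decide)),
    Loc.flip_toffoli (hw (show (1 : Fin 5) ≠ 3 by decide)) (hw (show (0 : Fin 5) ≠ 3 by decide)),
    Loc.flip_free,
    Loc.flip_toffoli (hw (show (3 : Fin 5) ≠ 4 by decide)) hi]
  constructor
  · simp only [Function.update_self, Function.update_of_ne (hw (show (4 : Fin 5) ≠ 3 by decide)),
      Function.update_of_ne (hw (show (4 : Fin 5) ≠ 0 by decide)),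
      Function.update_of_ne (hw (show (3 : Fin 5) ≠ 0 by decide)),
      Function.update_of_ne (hw (show (1 : Fin 5) ≠ 0 by decide)), hm, ho]
    cases P (w (i.castSucc, 4)) <;> cases P (w (i.castSucc, 1)) <;>
      cases P (w (i.castSucc, 0)) <;> cases P (w (i.castSucc, 2)) <;> rfl
  · intro j hj hj'
    rw [Function.update_of_ne hj'.symm, Function.update_of_ne (hj 3).symm,
      Function.update_of_ne (hj 3).symm, Function.update_of_ne (hj 0).symm]

theorem applyClassical_sweep_verStep {n k : ℕ} (w : Fin (k + 1) × Fin 5 ↪ Fin n) {P : Bits n}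
    (hm : ∀ i : Fin k, P (w (i.castSucc, 3)) = false) (ho : ∀ i : Fin k, P (w (i.succ, 4)) = false) :
    applyClassical (sweep (verStep w)) P (w (Fin.last k, 4)) = (P (w (0, 4)) &&
      decide (∀ i : Fin k, P (w (i.castSucc, 1)) = true →
        P (w (i.castSucc, 0)) = P (w (i.castSucc, 2)))) ∧
    ∀ j, (∀ (i : Fin k) c, w (i.castSucc, c) ≠ j) → w (Fin.last k, 4) ≠ j →
      applyClassical (sweep (verStep w)) P j = P j := by
  induction k with
  | zero =>
    rw [sweep_zero, applyClassical_nil]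
    refine ⟨?_, fun _ _ _ => rfl⟩
    simp
  | succ k ih =>
    set w' : Fin (k + 1) × Fin 5 ↪ Fin n :=
      (Function.Embedding.prodMap Fin.castSuccEmb (Function.Embedding.refl _)).trans w with hw'
    have hs : sweep (verStep w) = sweep (verStep w') ++ verStep w (Fin.last k) := sweep_succ _
    have ho' : ∀ i : Fin k, P (w' (i.succ, 4)) = false := fun i => ho i.castSucc
    obtain ⟨h1, h2⟩ := ih w' (fun i => hm i.castSucc) ho'
    set P₁ := applyClassical (sweep (verStep w')) P with hP₁
    have hne : ∀ {a b : Fin (k + 2)} {c d : Fin 5}, a ≠ b → w (a, c) ≠ w (b, d) := fun h h' =>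
      h (Prod.ext_iff.mp (w.injective h')).1
    have hrow : ∀ c, c ≠ 4 → P₁ (w ((Fin.last k).castSucc, c)) =
        P (w ((Fin.last k).castSucc, c)) := fun c hc =>
      h2 _ (fun i c' => hne fun h => (Fin.castSucc_lt_last i).ne (Fin.castSucc_injective _ h))
        fun h => hc (Prod.ext_iff.mp (w.injective h)).2.symm
    have hlast : P₁ (w ((Fin.last k).succ, 4)) = P (w ((Fin.last k).succ, 4)) :=
      h2 _ (fun i c' => hne (Fin.castSucc_lt_last _).ne) (hne (Fin.castSucc_lt_last _).ne)
    obtain ⟨g1, g2⟩ := applyClassical_verStep w (Fin.last k) (P := P₁)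
      ((hrow 3 (by decide)).trans (hm _)) (hlast.trans (ho _))
    rw [hs, applyClassical_append]
    refine ⟨g1.trans ?_, fun j hj hj' => (g2 j (hj _) hj').trans
      (h2 j (fun i c => hj i.castSucc c) (hj _ _))⟩
    rw [show P₁ (w ((Fin.last k).castSucc, 4)) = _ from h1, hrow 1 (by decide), hrow 0 (by decide),
      hrow 2 (by decide), Bool.and_assoc, ← Bool.decide_and]
    refine congrArg₂ _ rfl (decide_eq_decide.mpr ?_)
    rw [Fin.forall_fin_succ']
    rfl

theorem classicalComputable_ver (k : ℕ) : ClassicalComputable (5 * k + 5)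
    fun (s : Fin (k + k) ⊕ Fin k → Bool) (_ : Unit) => decide (∀ i : Fin k,
      s (.inl (Fin.natAdd k i)) = true → s (.inl (Fin.castAdd k i)) = s (.inr i)) := by
  -- There is one row more than positions: the result for all of them is left on wire `4` of row
  -- `k`.
  set w : Fin (k + 1) × Fin 5 ↪ Fin ((k + 1) * 5) := finProdFinEquiv.toEmbedding with hw
  have hne : ∀ {a b : Fin (k + 1)} {c d : Fin 5}, c ≠ d → w (a, c) ≠ w (b, d) := fun h h' =>
    h (Prod.ext_iff.mp (w.injective h')).2
  have col : ∀ c : Fin 5, Function.Injective fun i : Fin k => w (i.castSucc, c) := fun c i j h =>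
    Fin.castSucc_injective _ (Prod.ext_iff.mp (w.injective h)).1
  set v : Fin (k + k) ↪ Fin ((k + 1) * 5) := joinWires ⟨_, col 0⟩ ⟨_, col 1⟩
    (fun i j => hne (by decide)) with hv
  have v0 : ∀ i, v (Fin.castAdd k i) = w (i.castSucc, 0) := joinWires_castAdd _ _ _
  have v1 : ∀ i, v (Fin.natAdd k i) = w (i.castSucc, 1) := joinWires_natAdd _ _ _
  have hvne : ∀ i (a : Fin (k + 1)) (c : Fin 5), c ≠ 0 → c ≠ 1 → v i ≠ w (a, c) := fun i a c h0 h1 => by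
    refine Fin.addCases (fun i => ?_) (fun i => ?_) i
    · rw [v0]; exact hne h0.symm
    · rw [v1]; exact hne h1.symm
  set inp : Fin (k + k) ⊕ Fin k ↪ Fin ((k + 1) * 5) :=
    ⟨Sum.elim v fun i => w (i.castSucc, 2), v.injective.sumElim (col 2)
      fun i j => hvne _ _ _ (by decide) (by decide)⟩ with hinp
  have hi : ∀ i (a : Fin (k + 1)) (c : Fin 5), c ≠ 0 → c ≠ 1 → c ≠ 2 → inp i ≠ w (a, c) := by
    rintro (i | i) a c h0 h1 h2
    · exact hvne _ _ _ h0 h1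
    · exact hne h2.symm
  -- The leading NOT sets the empty conjunction to true.
  refine ⟨(k + 1) * 5, Loc.free (w (0, 4)) :: sweep (verStep w), inp,
    ⟨fun _ => w (Fin.last k, 4), fun _ _ _ => rfl⟩, by omega, ?_, fun s => funext fun _ => ?_⟩
  · have : (sweep (verStep w)).length ≤ k * 4 := length_sweep_le _ fun i => le_rfl
    rw [List.length_cons]
    omega
  set P₀ : Bits ((k + 1) * 5) := Function.extend inp s fun _ => false with hP₀
  have off : ∀ (a : Fin (k + 1)) (c : Fin 5), c ≠ 0 → c ≠ 1 → c ≠ 2 → P₀ (w (a, c)) = false :=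
    fun a c h0 h1 h2 => extend_off inp _ _ fun i => hi i a c h0 h1 h2
  set P₁ : Bits ((k + 1) * 5) := Function.update P₀ (w (0, 4)) true with hP₁
  have ha : ∀ (a : Fin (k + 1)) (c : Fin 5), c ≠ 4 → P₁ (w (a, c)) = P₀ (w (a, c)) := fun a c h =>
    Function.update_of_ne (hne h) _ _
  have hm : ∀ i : Fin k, P₁ (w (i.castSucc, 3)) = false := fun i =>
    (ha _ _ (by decide)).trans (off _ _ (by decide) (by decide) (by decide))
  have ho : ∀ i : Fin k, P₁ (w (i.succ, 4)) = false := fun i =>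
    (Function.update_of_ne (fun h => Fin.succ_ne_zero _ (Prod.ext_iff.mp (w.injective h)).1)
      _ _).trans (off _ _ (by decide) (by decide) (by decide))
  have h1 : P₁ (w (0, 4)) = true := Function.update_self _ _ _
  have p0 : ∀ i : Fin k, P₁ (w (i.castSucc, 0)) = s (.inl (Fin.castAdd k i)) := fun i => by
    rw [ha _ _ (by decide), ← v0]; exact extend_at inp s _ (.inl _)
  have p1 : ∀ i : Fin k, P₁ (w (i.castSucc, 1)) = s (.inl (Fin.natAdd k i)) := fun i => by
    rw [ha _ _ (by decide), ← v1]; exact extend_at inp s _ (.inl _)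
  have p2 : ∀ i : Fin k, P₁ (w (i.castSucc, 2)) = s (.inr i) := fun i =>
    (ha _ _ (by decide)).trans (extend_at inp s _ (.inr i))
  have h := (applyClassical_sweep_verStep w hm ho).1
  simp only [p0, p1, p2, h1, Bool.true_and] at h
  change applyClassical (Loc.free (w (0, 4)) :: sweep (verStep w)) P₀ (w (Fin.last k, 4)) = _
  rw [applyClassical_cons, Loc.flip_free, off 0 4 (by decide) (by decide) (by decide),
    Bool.not_false]
  exact h

/-! ### Efficiency -/

theorem ClassicalComputable.mono {S T : ℕ} (h : S ≤ T) {ι κ : Type} {f : (ι → Bool) → (κ → Bool)}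
    (hf : ClassicalComputable S f) : ClassicalComputable T f := by
  obtain ⟨N, C, inp, out, h1, h2, h3⟩ := hf
  exact ⟨N, C, inp, out, h1.trans h, h2.trans h, h3⟩

theorem QuantumPrepares.mono {S T : ℕ} (h : S ≤ T) {ι : Type} {v q : ℕ}
    {F : (ι → Bool) → Bits v → Op q} (hF : QuantumPrepares S F) : QuantumPrepares T F := by
  obtain ⟨N, C, inp, outC, outQ, h1, h2, h3⟩ := hF
  exact ⟨N, C, inp, outC, outQ, h1.trans h, h2.trans h, h3⟩

theorem QuantumMeasures.mono {S T : ℕ} (h : S ≤ T) {ι O : Type} [Fintype O] {q m : ℕ}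
    {code : O → Bits m} {M : (ι → Bool) → O → Op q} (hM : QuantumMeasures S code M) :
    QuantumMeasures T code M := by
  obtain ⟨N, C, inC, inQ, out, h1, h2, h3⟩ := hM
  exact ⟨N, C, inC, inQ, out, h1.trans h, h2.trans h, h3⟩

theorem ClassicalComputable.length_le {S l : ℕ} {ι : Type} {f : (ι → Bool) → Bits l}
    (hf : ClassicalComputable S f) : l ≤ S := by
  obtain ⟨N, C, inp, out, h1, -, -⟩ := hf
  exact (by simpa using Fintype.card_le_of_embedding out : l ≤ N).trans h1

namespace ABE

variable (E : ABE fun k => k + 1)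

theorem decOp_eq (k d : ℕ) (sk : Bits (E.skLen k d)) (o : Option Bool) :
    E.decOp k d sk o = ∑ ct : Bits (E.ctLen k), avg fun c : Bits (E.decCoins k d) =>
      tensor (decEffect (E.dec k d c sk ct) o) (basisOp ct) := by
  refine Finset.sum_congr rfl fun ct _ => congrArg avg (funext fun c => ?_)
  have hL := isLinearMap_tensor_left (a := k) (basisOp ct)
  cases E.dec k d c sk ct with
  | none =>
    by_cases ho : o = none
    · simp only [decEffect, if_pos ho]
    · simp only [decEffect, if_neg ho]
      exact hL.map_zero.symm
  | some m =>
    refine Eq.trans ?_ (IsLinearMap.map_sum' hL _ _).symm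
    refine Finset.sum_congr rfl fun x _ => ?_
    split_ifs
    · rfl
    · exact hL.map_zero.symm

theorem efficient_withDeletion (hE : E.Efficient) : E.withDeletion.Efficient := by
  obtain ⟨hK, p, hp1, hp2⟩ := hE
  have he : ∀ n, (4 * p + 20 * Polynomial.X + 10 : Polynomial ℕ).eval n = 4 * p.eval n + 20 * n + 10 :=
    fun n => by simp
  refine ⟨hK, 4 * p + 20 * Polynomial.X + 10, fun k => ?_, fun k d => ?_, fun k => ?_, fun k => ?_⟩
  · exact (quantumPrepares_enc (hp1 k)).mono (by rw [he]; omega)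
  · have h := (quantumMeasures_dec (hp2 k d)).mono
      (T := (4 * p + 20 * Polynomial.X + 10 : Polynomial ℕ).eval (k + d)) (by rw [he]; omega)
    simp only [← decOp_eq] at h
    exact h
  · exact (quantumMeasures_del k (E.ctLen k)).mono (by
      -- The classical ciphertext fits on the output wires of the encryption circuit, which bounds
      -- its length.
      have := (hp1 k).length_le
      rw [he]; omega)
  · exact (classicalComputable_ver k).mono (by rw [he]; omega)

end ABE

end CertifiedDeletion

end

theorem mainTheorem3 (E : CertifiedDeletion.ABE fun k => k + 1) (hE : E.IsPostQuantumABE) :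
    E.withDeletion.IsABEWithCertifiedDeletion :=
  ⟨E.efficient_withDeletion hE.1, E.correct_withDeletion hE.2.1, E.deletionCorrect_withDeletion,
    E.secure_withDeletion hE.2.2⟩
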